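/- All graphs are finite and simple. A graph $G=(V,E)$ is a \emph{circuit} in the simple $(2,2)$-sparsity matroid $M^*(2,2)$ if $|E|=2|V|-1$ and every nonempty proper subset $X\subsetneq V$ spans at most $2|X|-2$ edges of $G$. The \emph{base graphs} are $K_5\setminus e$; $K_4\sqcup K_4$, the union of two copies of $K_4$ sharing exactly one edge (and its two ends); and $K_4\veebar K_4$, the union of two copies of $K_4$ sharing exactly one vertex, together with one additional edge joining the two copies. Consider the following moves. \emph{Henneberg 2 move within a component}: for an edge $uw$ and a vertex $z\ne u,w$ in the same connected component, delete $uw$ and add a new vertex adjacent to exactly $u,w,z$. A \emph{pendant} $K_4(a,b,c,d)$ consists of four vertices inducing a $K_4$ such that $\{a,b\}$ is a two-vertex cut of their connected component and $\{c,d\}$ is the vertex set of one of the components that remain after deleting $a,b$. In the sums below, $G_1$ and $G_2$ are two different connected components of the current graph. \emph{1-sum}: $G_1$ has an edge $a_1b_1$ and $G_2$ has a pendant $K_4(a_2,b_2,c_2,d_2)$; remove the edges $a_1b_1$, $a_2b_2$ and the vertices $c_2,d_2$, and identify $a_1$ with $a_2$ and $b_1$ with $b_2$. \emph{2-sum}: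 $G_i$ has a pendant $K_4(a_i,b_i,c_i,d_i)$ for $i=1,2$; remove the vertices $c_1,d_1,c_2,d_2$, and identify $a_1$ with $a_2$ and $b_1$ with $b_2$, keeping one copy of the edge $ab$. \emph{3-sum}: $G_i$ has a vertex $v_i$ with exactly three neighbours $a_i,b_i,c_i$ for $i=1,2$; delete $v_1,v_2$ and add the edges $a_1a_2,b_1b_2,c_1c_2$. \textbf{Theorem.} A graph $G$ is a circuit in $M^*(2,2)$ if and only if $G$ is connected and can be generated recursively from disjoint copies of base graphs by Henneberg 2 moves within connected components and 1-sums, 2-sums and 3-sums of different connected components. -/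

import Mathlib

universe u

namespace SimpleTwoTwo

open SimpleGraph

/-- The number `i_G(X)` of edges of `G` with both ends in `X`. -/
noncomputable def spannedEdges {V : Type u} (G : SimpleGraph V) (X : Set V) : ℕ :=
  {e ∈ G.edgeSet | ∀ v ∈ e, v ∈ X}.ncard

/-- `G` is a circuit of the simple `(2,2)`-sparsity matroid: `|E| = 2|V| - 1`, and every nonempty
proper vertex subset `X` spans at most `2|X| - 2` edges. (Used for finite `V`; the two
subtractions are written as additions on the other side.) -/
def IsCircuit {V : Type u} (G : SimpleGraph V) : Prop :=
  G.edgeSet.ncard + 1 = 2 * Nat.card V ∧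
    ∀ X : Set V, X.Nonempty → X ≠ Set.univ → spannedEdges G X + 2 ≤ 2 * X.ncard

/-- The complete graph on the vertices in `s`, the other vertices being isolated. -/
def cliqueOn {V : Type u} (s : Set V) : SimpleGraph V :=
  SimpleGraph.fromRel fun x y => x ∈ s ∧ y ∈ s

/-- `K₅ \ e`. -/
def K5MinusEdge : SimpleGraph (Fin 5) :=
  (⊤ : SimpleGraph (Fin 5)).deleteEdges {s(0, 1)}

/-- `K₄ ⊔ K₄`: two copies of `K₄` that share exactly one edge. -/
def K4ShareEdge : SimpleGraph (Fin 6) :=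
  cliqueOn {0, 1, 2, 3} ⊔ cliqueOn {0, 1, 4, 5}

/-- `K₄ ⊻ K₄`: two copies of `K₄` that share exactly one vertex, with one edge added between
them. -/
def K4ShareVertex : SimpleGraph (Fin 7) :=
  cliqueOn {0, 1, 2, 3} ⊔ cliqueOn {0, 4, 5, 6} ⊔ SimpleGraph.edge 1 4

/-- `G` is a copy of one of the three base graphs. -/
def IsBaseGraph {V : Type u} (G : SimpleGraph V) : Prop :=
  Nonempty (G ≃g K5MinusEdge) ∨ Nonempty (G ≃g K4ShareEdge) ∨ Nonempty (G ≃g K4ShareVertex)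

/-- The Henneberg 2 move: the edge `uw` is replaced by a path through a new vertex (`none`), which
is also joined to `z`. -/
def hennebergTwo {V : Type u} (G : SimpleGraph V) (u w z : V) : SimpleGraph (Option V) :=
  (G.deleteEdges {s(u, w)}).map some ⊔
    SimpleGraph.edge none (some u) ⊔ SimpleGraph.edge none (some w) ⊔
    SimpleGraph.edge none (some z)

/-- The vertices `a, b, c, d` induce a `K₄` in `G` and `{a, b}` is a two-vertex cut of the
component containing them, `{c, d}` being one of the components that it leaves: `c` and `d` have no
neighbours outside the `K₄`, and the component has a vertex outside the `K₄`. (The four vertices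
are distinct, since no vertex is its own neighbour.) -/
def IsPendantK4 {V : Type u} (G : SimpleGraph V) (a b c d : V) : Prop :=
  G.Adj a b ∧ G.neighborSet c = {a, b, d} ∧ G.neighborSet d = {a, b, c} ∧
    ∃ x, G.Reachable a x ∧ x ∉ ({a, b, c, d} : Set V)

/-- `v` is a vertex of degree three whose neighbours are `a, b, c`. -/
def IsNode {V : Type u} (G : SimpleGraph V) (v a b c : V) : Prop :=
  a ≠ b ∧ a ≠ c ∧ b ≠ c ∧ G.neighborSet v = {a, b, c}

open Classical in
/-- The map that superimposes `a₂` on `a₁` and `b₂` on `b₁`, and fixes every other vertex. -/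
noncomputable def glue {V : Type u} (a₁ b₁ a₂ b₂ : V) : V → V :=
  Function.update (Function.update id a₂ a₁) b₂ b₁

/-- The 1-sum inside `G`: the edges `a₁b₁` and `a₂b₂` and the vertices `c₂, d₂` are removed, and
`a₁, b₁` are merged with `a₂, b₂` (the merged vertices keep the names `a₁, b₁`). -/
noncomputable def oneSum {V : Type u} (G : SimpleGraph V) (a₁ b₁ a₂ b₂ c₂ d₂ : V) :
    SimpleGraph (({a₂, b₂, c₂, d₂} : Set V)ᶜ : Set V) :=
  ((G.deleteEdges {s(a₁, b₁), s(a₂, b₂)}).map (glue a₁ b₁ a₂ b₂)).induce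
    ({a₂, b₂, c₂, d₂} : Set V)ᶜ

/-- The 2-sum inside `G`: the vertices `c₁, d₁, c₂, d₂` are removed, and `a₁, b₁` are merged with
`a₂, b₂` (the merged vertices keep the names `a₁, b₁`); one copy of the edge `a₁b₁` is kept. -/
noncomputable def twoSum {V : Type u} (G : SimpleGraph V) (a₁ b₁ c₁ d₁ a₂ b₂ c₂ d₂ : V) :
    SimpleGraph (({c₁, d₁, a₂, b₂, c₂, d₂} : Set V)ᶜ : Set V) :=
  (G.map (glue a₁ b₁ a₂ b₂)).induce ({c₁, d₁, a₂, b₂, c₂, d₂} : Set V)ᶜ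

/-- The 3-sum inside `G`: the vertices `v₁, v₂` are removed, and the edges `a₁a₂`, `b₁b₂`, `c₁c₂`
are added. -/
def threeSum {V : Type u} (G : SimpleGraph V) (v₁ a₁ b₁ c₁ v₂ a₂ b₂ c₂ : V) :
    SimpleGraph (({v₁, v₂} : Set V)ᶜ : Set V) :=
  (G ⊔ SimpleGraph.edge a₁ a₂ ⊔ SimpleGraph.edge b₁ b₂ ⊔ SimpleGraph.edge c₁ c₂).induce
    ({v₁, v₂} : Set V)ᶜ

/-- The (possibly disconnected) graphs that are generated from disjoint copies of the base graphs
by Henneberg 2 moves within a connected component and by 1-sums, 2-sums and 3-sums of two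
different connected components. -/
inductive Generated : ∀ {V : Type u}, SimpleGraph V → Prop
  /-- Copies of the base graphs. -/
  | base {V : Type u} {G : SimpleGraph V} (h : IsBaseGraph G) : Generated G
  /-- Disjoint copies. -/
  | disjoint {V W : Type u} {G : SimpleGraph V} {H : SimpleGraph W}
      (hG : Generated G) (hH : Generated H) : Generated (G ⊕g H)
  /-- The names of the vertices do not matter. -/
  | iso {V W : Type u} {G : SimpleGraph V} {H : SimpleGraph W}
      (hG : Generated G) (e : G ≃g H) : Generated H
  | hennebergTwo {V : Type u} {G : SimpleGraph V} {u w z : V} (hG : Generated G)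
      (huw : G.Adj u w) (hzu : z ≠ u) (hzw : z ≠ w) (hz : G.Reachable u z) :
      Generated (hennebergTwo G u w z)
  | oneSum {V : Type u} {G : SimpleGraph V} {a₁ b₁ a₂ b₂ c₂ d₂ : V} (hG : Generated G)
      (h₁ : G.Adj a₁ b₁) (h₂ : IsPendantK4 G a₂ b₂ c₂ d₂) (h : ¬ G.Reachable a₁ a₂) :
      Generated (oneSum G a₁ b₁ a₂ b₂ c₂ d₂)
  | twoSum {V : Type u} {G : SimpleGraph V} {a₁ b₁ c₁ d₁ a₂ b₂ c₂ d₂ : V} (hG : Generated G)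
      (h₁ : IsPendantK4 G a₁ b₁ c₁ d₁) (h₂ : IsPendantK4 G a₂ b₂ c₂ d₂)
      (h : ¬ G.Reachable a₁ a₂) :
      Generated (twoSum G a₁ b₁ c₁ d₁ a₂ b₂ c₂ d₂)
  | threeSum {V : Type u} {G : SimpleGraph V} {v₁ a₁ b₁ c₁ v₂ a₂ b₂ c₂ : V} (hG : Generated G)
      (h₁ : IsNode G v₁ a₁ b₁ c₁) (h₂ : IsNode G v₂ a₂ b₂ c₂) (h : ¬ G.Reachable v₁ v₂) :
      Generated (threeSum G v₁ a₁ b₁ c₁ v₂ a₂ b₂ c₂)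

end SimpleTwoTwo

/-! `adjCount G X X` counts ordered adjacent pairs, hence twice the edges spanned by `X`. A circuit
has count `4|V| - 2`, and a nonempty proper subset has count at most `4|X| - 4`; the subsets with
equality are the critical sets. By submodularity, two intersecting critical sets whose union is
proper have a critical union and a critical intersection, and no edge joins their differences
(`Circ.critical_union`).

Generated graphs are circuits because "disjoint union of circuits" (`IsCircuitFamily`) is invariant
under every move; in such a graph the fibres are exactly the connected components, so a connected
one is a single circuit.

The converse is an induction on the number of vertices. Its core is `Circ.exists_reduction`: a
circuit that is not a base graph has a node at which a Henneberg 2 move can be undone, or a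
separating pair with two large sides (undoing a 1-sum or 2-sum), or a partition into two critical
sets of at least two vertices. Such a partition has exactly three crossing edges; they are disjoint,
which undoes a 3-sum, or they yield a separating pair.

Suppose that nothing applies. Then a critical set blocks every pair of nonadjacent neighbours of a
node, and uncrossing these sets shows that the three neighbours of a node are pairwise adjacent or
pairwise nonadjacent. Choose a maximal critical set `R` such that some vertex outside `R` has degree
other than three and `R` is not a single vertex of degree three. Since the vertices of degree three
induce a forest, maximality of `R` forces every vertex of degree three outside `R` into a `K₄`
(`Irreducible.isCliqueNode`), and this `K₄` avoids `R` (`Irreducible.disjoint_clique`). The maximal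
critical subsets of `Rᶜ` partition `Rᶜ`. A singleton part has degree at least four, and any other
part is left by at least four edges, so on each part the degree sum is at least four times its size.
But `R` is critical and is left by at least three edges, which makes the degree sum over `Rᶜ`
smaller than `4|Rᶜ|` (`Irreducible.false`). -/

namespace SimpleTwoTwo
open SimpleGraph Finset

/-! ### Counting ordered adjacent pairs -/

section Count
variable {V : Type*} {W : Type*} (G : SimpleGraph V)

open Classical in
/-- The indicator of adjacency. -/
noncomputable def adjInd (x y : V) : ℤ := if G.Adj x y then 1 else 0

/-- The number of ordered adjacent pairs in `X × Y`. -/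
noncomputable def adjCount (X Y : Finset V) : ℤ := ∑ x ∈ X, ∑ y ∈ Y, adjInd G x y

variable {G}

theorem adjInd_of_adj {x y : V} (h : G.Adj x y) : adjInd G x y = 1 := by simp [adjInd, h]

theorem adjInd_of_not_adj {x y : V} (h : ¬ G.Adj x y) : adjInd G x y = 0 := by simp [adjInd, h]

theorem adjInd_comm (x y : V) : adjInd G x y = adjInd G y x := by
  by_cases h : G.Adj x y
  · simp [adjInd, h, h.symm]
  · rw [adjInd_of_not_adj h, adjInd_of_not_adj fun h' => h h'.symm]

@[simp] theorem adjInd_self (x : V) : adjInd G x x = 0 := by simp [adjInd]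

theorem adjInd_nonneg (x y : V) : 0 ≤ adjInd G x y := by
  unfold adjInd; split_ifs <;> simp

theorem adjInd_le_one (x y : V) : adjInd G x y ≤ 1 := by
  unfold adjInd; split_ifs <;> simp

theorem adjCount_comm (X Y : Finset V) : adjCount G X Y = adjCount G Y X := by
  unfold adjCount
  rw [Finset.sum_comm]
  simp only [adjInd_comm]

theorem adjCount_nonneg (X Y : Finset V) : 0 ≤ adjCount G X Y :=
  sum_nonneg fun _ _ => sum_nonneg fun _ _ => adjInd_nonneg _ _

@[simp] theorem adjCount_empty_right (X : Finset V) : adjCount G X ∅ = 0 := by simp [adjCount]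

theorem adjCount_singleton_left (x : V) (Y : Finset V) :
    adjCount G {x} Y = ∑ y ∈ Y, adjInd G x y := by simp [adjCount]

@[simp] theorem adjCount_singleton (x y : V) : adjCount G {x} {y} = adjInd G x y := by
  simp [adjCount]

theorem adjCount_union_left [DecidableEq V] {X X' : Finset V} (h : Disjoint X X')
    (Y : Finset V) : adjCount G (X ∪ X') Y = adjCount G X Y + adjCount G X' Y := by
  simp [adjCount, sum_union h]

theorem adjCount_union_right [DecidableEq V] {Y Y' : Finset V} (X : Finset V)
    (h : Disjoint Y Y') : adjCount G X (Y ∪ Y') = adjCount G X Y + adjCount G X Y' := by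
  rw [adjCount_comm, adjCount_union_left h, adjCount_comm Y, adjCount_comm Y']

theorem adjCount_mono {X X' Y Y' : Finset V} (hX : X ⊆ X') (hY : Y ⊆ Y') :
    adjCount G X Y ≤ adjCount G X' Y' := by
  unfold adjCount
  calc _ ≤ ∑ x ∈ X, ∑ y ∈ Y', adjInd G x y :=
        sum_le_sum fun x _ => sum_le_sum_of_subset_of_nonneg hY fun _ _ _ => adjInd_nonneg _ _
    _ ≤ _ := sum_le_sum_of_subset_of_nonneg hX fun _ _ _ =>
        sum_nonneg fun _ _ => adjInd_nonneg _ _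

theorem adjCount_eq_zero_iff {X Y : Finset V} :
    adjCount G X Y = 0 ↔ ∀ x ∈ X, ∀ y ∈ Y, ¬ G.Adj x y := by
  unfold adjCount
  rw [sum_eq_zero_iff_of_nonneg fun _ _ => sum_nonneg fun _ _ => adjInd_nonneg _ _]
  refine forall₂_congr fun x _ => ?_
  rw [sum_eq_zero_iff_of_nonneg fun _ _ => adjInd_nonneg _ _]
  refine forall₂_congr fun y _ => ?_
  simp [adjInd]

/-- Inclusion-exclusion for the number of spanned edges. -/
theorem adjCount_union_add_inter [DecidableEq V] (X Y : Finset V) :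
    adjCount G (X ∪ Y) (X ∪ Y) + adjCount G (X ∩ Y) (X ∩ Y) =
      adjCount G X X + adjCount G Y Y + 2 * adjCount G (X \ Y) (Y \ X) := by
  have hX : X = (X \ Y) ∪ (X ∩ Y) := by grind
  have hY : Y = (Y \ X) ∪ (X ∩ Y) := by grind
  have hU : X ∪ Y = (X \ Y) ∪ ((Y \ X) ∪ (X ∩ Y)) := by grind
  have d1 : Disjoint (X \ Y) (X ∩ Y) := by rw [Finset.disjoint_left]; grind
  have d2 : Disjoint (Y \ X) (X ∩ Y) := by rw [Finset.disjoint_left]; grind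
  have d3 : Disjoint (X \ Y) ((Y \ X) ∪ (X ∩ Y)) := by rw [Finset.disjoint_left]; grind
  have e1 : adjCount G X X = adjCount G ((X \ Y) ∪ (X ∩ Y)) ((X \ Y) ∪ (X ∩ Y)) := by rw [← hX]
  have e2 : adjCount G Y Y = adjCount G ((Y \ X) ∪ (X ∩ Y)) ((Y \ X) ∪ (X ∩ Y)) := by rw [← hY]
  rw [hU, e1, e2]
  simp only [adjCount_union_left d3, adjCount_union_right _ d3, adjCount_union_left d2,
    adjCount_union_right _ d2, adjCount_union_left d1, adjCount_union_right _ d1]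
  rw [adjCount_comm (Y \ X) (X \ Y), adjCount_comm (X ∩ Y) (X \ Y), adjCount_comm (X ∩ Y) (Y \ X)]
  ring

theorem adjCount_union_self [DecidableEq V] {X Y : Finset V} (h : Disjoint X Y) :
    adjCount G (X ∪ Y) (X ∪ Y) =
      adjCount G X X + adjCount G Y Y + 2 * adjCount G X Y := by
  rw [adjCount_union_left h, adjCount_union_right _ h, adjCount_union_right _ h,
    adjCount_comm Y X]
  ring

theorem adjCount_insert_self [DecidableEq V] {X : Finset V} {v : V} (h : v ∉ X) :
    adjCount G (insert v X) (insert v X) = adjCount G X X + 2 * adjCount G {v} X := by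
  rw [insert_eq, adjCount_union_self (by simpa using h)]
  simp

theorem adjCount_eq_card [DecidableEq V] [DecidableRel G.Adj] (v : V) (X : Finset V) :
    adjCount G {v} X = #{x ∈ X | G.Adj v x} := by
  rw [adjCount_singleton_left, card_filter]
  push_cast
  refine sum_congr rfl fun x _ => ?_
  unfold adjInd; congr

/-- A vertex set spans at most all pairs. -/
theorem adjCount_self_le [DecidableEq V] (X : Finset V) :
    adjCount G X X ≤ #X * #X - #X := by
  have : adjCount G X X ≤ ∑ x ∈ X, ∑ y ∈ X, (if x = y then 0 else 1 : ℤ) := by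
    refine sum_le_sum fun x _ => sum_le_sum fun y _ => ?_
    split_ifs with h
    · simp [h]
    · exact adjInd_le_one _ _
  refine this.trans (le_of_eq ?_)
  have h : ∀ x ∈ X, ∑ y ∈ X, (if x = y then 0 else 1 : ℤ) = #X - 1 := by
    intro x hx
    have : ∀ y, (if x = y then 0 else 1 : ℤ) = 1 - if x = y then 1 else 0 := by
      intro y; split_ifs <;> simp
    simp_rw [this, sum_sub_distrib]
    simp [hx]
  rw [sum_congr rfl h]
  simp

theorem adjCount_le_mul (X Y : Finset V) : adjCount G X Y ≤ #X * #Y := by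
  refine (sum_le_sum fun x _ => sum_le_sum fun y _ => adjInd_le_one x y).trans ?_
  simp

theorem adjCount_self_le_of_not_adj [DecidableEq V] {X : Finset V} {x y : V} (hx : x ∈ X)
    (hy : y ∈ X) (hxy : x ≠ y) (h : ¬ G.Adj x y) : adjCount G X X ≤ #X * #X - #X - 2 := by
  have hX : {x, y} ∪ (X \ {x, y}) = X := by grind
  have h1 := adjCount_union_self (G := G) (disjoint_sdiff (s := {x, y}) (t := X))
  have h2 := card_union_of_disjoint (disjoint_sdiff (s := {x, y}) (t := X))
  rw [hX] at h1 h2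
  have h3 := adjCount_le_mul (G := G) {x, y} (X \ {x, y})
  have h4 := adjCount_self_le (G := G) (X \ {x, y})
  have h5 : adjCount G {x, y} {x, y} = 0 := by
    rw [adjCount_eq_zero_iff]
    simp [h, G.adj_comm y x]
  rw [card_pair hxy] at h2 h3
  rw [h1, h2, h5]
  push_cast at *
  linarith

theorem adjCount_clique [DecidableEq V] {X : Finset V}
    (hX : ∀ x ∈ X, ∀ y ∈ X, x ≠ y → G.Adj x y) : adjCount G X X = #X * #X - #X := by
  have : adjCount G X X = ∑ x ∈ X, ∑ y ∈ X, (if x = y then 0 else 1 : ℤ) := by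
    refine sum_congr rfl fun x hx => sum_congr rfl fun y hy => ?_
    split_ifs with h
    · simp [h]
    · exact adjInd_of_adj (hX x hx y hy h)
  rw [this]
  have h : ∀ x ∈ X, ∑ y ∈ X, (if x = y then 0 else 1 : ℤ) = #X - 1 := by
    intro x hx
    have : ∀ y, (if x = y then 0 else 1 : ℤ) = 1 - if x = y then 1 else 0 := by
      intro y; split_ifs <;> simp
    simp_rw [this, sum_sub_distrib]
    simp [hx]
  rw [sum_congr rfl h]
  simp

theorem adjCount_map (f : W ↪ V) (X Y : Finset W) :
    adjCount G (X.map f) (Y.map f) = adjCount (G.comap f) X Y := by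
  simp only [adjCount, sum_map]
  rfl

/-- The handshake lemma for the graph `H` of the edges inside `X`. It translates the natural-number
definition of a circuit into additive integer counts. -/
theorem two_mul_spannedEdges [Fintype V] (X : Finset V) :
    2 * (spannedEdges G (X : Set V) : ℤ) = adjCount G X X := by
  classical
  let H : SimpleGraph V :=
    { Adj := fun x y => G.Adj x y ∧ x ∈ X ∧ y ∈ X
      symm := ⟨fun _ _ h => ⟨h.1.symm, h.2.2, h.2.1⟩⟩
      loopless := ⟨fun _ h => h.1.ne rfl⟩ }
  have h1 : {e ∈ G.edgeSet | ∀ v ∈ e, v ∈ (X : Set V)} = H.edgeSet := by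
    ext e
    induction e with
    | _ x y => simp [H]
  unfold spannedEdges
  rw [h1, ← SimpleGraph.coe_edgeFinset, Set.ncard_coe_finset]
  have h2 := H.sum_degrees_eq_twice_card_edges
  have h3 : ((∑ v, H.degree v : ℕ) : ℤ) = adjCount G X X := by
    have : adjCount G X X = ∑ x, ∑ y, adjInd H x y := by
      unfold adjCount
      rw [← sum_subset (subset_univ X)]
      · refine sum_congr rfl fun x hx => ?_
        rw [← sum_subset (subset_univ X)]
        · refine sum_congr rfl fun y hy => ?_
          simp [adjInd, H, hx, hy]
        · intro y _ hy
          exact adjInd_of_not_adj fun h => hy h.2.2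
      · intro x _ hx
        exact sum_eq_zero fun y _ => adjInd_of_not_adj fun h => hx h.2.1
    rw [this]
    push_cast
    refine sum_congr rfl fun x _ => ?_
    rw [← adjCount_singleton_left, adjCount_eq_card, ← SimpleGraph.card_neighborFinset_eq_degree]
    congr 2
    ext y; simp
  rw [← h3, h2]
  push_cast; ring

variable (G) in
/-- The circuit property, in terms of ordered adjacent pairs. -/
def Circ [Fintype V] : Prop :=
  adjCount G univ univ = 4 * Fintype.card V - 2 ∧
    ∀ X : Finset V, X.Nonempty → X ≠ univ → adjCount G X X ≤ 4 * #X - 4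

theorem isCircuit_iff_circ [Fintype V] : IsCircuit G ↔ Circ G := by
  classical
  unfold IsCircuit Circ
  have h0 : G.edgeSet.ncard = spannedEdges G ((univ : Finset V) : Set V) := by
    unfold spannedEdges
    congr 1
    ext e; simp
  have h1 := two_mul_spannedEdges (G := G) univ
  rw [h0, Nat.card_eq_fintype_card]
  refine and_congr (by omega) ⟨fun h X hX hX' => ?_, fun h X hX hX' => ?_⟩
  · have := h X (by simpa using hX) (by simpa using hX')
    have h2 := two_mul_spannedEdges (G := G) X
    rw [Set.ncard_coe_finset] at this
    omega
  · have := h X.toFinset (by simpa using hX) (by simpa using hX')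
    have h2 := two_mul_spannedEdges (G := G) X.toFinset
    rw [Set.coe_toFinset] at h2
    rw [Set.ncard_eq_toFinset_card']
    omega

end Count

/-! ### Critical sets and nodes -/

section Critical
variable {V : Type*} {G : SimpleGraph V}

variable (G) in
/-- A critical set spans exactly `2|X| - 2` edges. -/
def Critical (X : Finset V) : Prop := adjCount G X X = 4 * #X - 4

theorem Critical.nonempty {X : Finset V} (h : Critical G X) : X.Nonempty := by
  rw [nonempty_iff_ne_empty]
  rintro rfl
  simp [Critical] at h

theorem critical_singleton (x : V) : Critical G {x} := by simp [Critical]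

theorem critical_of_isNClique [DecidableEq V] {K : Finset V} (h : G.IsNClique 4 K) :
    Critical G K := by
  have h1 := adjCount_clique (G := G) (X := K) fun x hx y hy hxy => h.isClique hx hy hxy
  rw [Critical, h1, h.card_eq]
  norm_num

/-- A simple graph on two or three vertices has too few edges: the counts 4 and 8 exceed 2 and 6. -/
theorem Critical.four_le_card [DecidableEq V] {X : Finset V} (h : Critical G X) (h2 : 2 ≤ #X) :
    4 ≤ #X := by
  have h1 := adjCount_self_le (G := G) X
  unfold Critical at h
  by_contra! h3
  have : #X = 2 ∨ #X = 3 := by omega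
  rcases this with h4 | h4 <;> rw [h4] at h h1 <;> norm_num at h h1 <;> omega

theorem Critical.isNClique [DecidableEq V] {X : Finset V} (h : Critical G X) (h4 : #X = 4) :
    G.IsNClique 4 X := by
  refine ⟨fun x hx y hy hxy => ?_, h4⟩
  by_contra hadj
  have h1 := adjCount_self_le_of_not_adj hx hy hxy hadj
  rw [h, h4] at h1
  norm_num at h1

theorem Critical.insert [DecidableEq V] {X : Finset V} (hX : Critical G X) {v : V} (hv : v ∉ X)
    (h2 : adjCount G {v} X = 2) : Critical G (insert v X) := by
  unfold Critical at *
  rw [adjCount_insert_self hv, card_insert_of_notMem hv]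
  push_cast
  omega

theorem sum_adjCount_singleton (A Y : Finset V) :
    ∑ x ∈ A, adjCount G {x} Y = adjCount G A Y := by
  simp [adjCount]

theorem IsNode.adj_iff {v a b c : V} (h : IsNode G v a b c) (x : V) :
    G.Adj v x ↔ x = a ∨ x = b ∨ x = c := by
  rw [← mem_neighborSet, h.2.2.2]; simp

theorem IsNode.swap {v a b c : V} (h : IsNode G v a b c) : IsNode G v b a c :=
  ⟨h.1.symm, h.2.2.1, h.2.1, by rw [h.2.2.2, Set.insert_comm]⟩

theorem IsNode.rotate {v a b c : V} (h : IsNode G v a b c) : IsNode G v b c a :=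
  ⟨h.2.2.1, h.1.symm, h.2.1.symm, by
    rw [h.2.2.2, Set.insert_comm]; congr 1; exact Set.pair_comm _ _⟩

theorem IsNode.card_insert [DecidableEq V] {v a b c : V} (h : IsNode G v a b c) :
    #{v, a, b, c} = 4 := by
  have hva := ((h.adj_iff a).2 (by simp)).ne
  have hvb := ((h.adj_iff b).2 (by simp)).ne
  have hvc := ((h.adj_iff c).2 (by simp)).ne
  simp [*, h.1, h.2.1, h.2.2.1]

theorem IsNode.adjCount [DecidableEq V] {v a b c : V} (h : IsNode G v a b c) (X : Finset V) :
    adjCount G {v} X = (if a ∈ X then 1 else 0) + (if b ∈ X then 1 else 0) +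
      (if c ∈ X then 1 else 0) := by
  have hab := h.1
  have hac := h.2.1
  have hbc := h.2.2.1
  rw [adjCount_singleton_left]
  have : ∀ x, adjInd G v x = (if x = a then 1 else 0) + (if x = b then 1 else 0) +
      (if x = c then 1 else 0) := by
    intro x
    by_cases hx : G.Adj v x
    · rw [adjInd_of_adj hx]
      rcases (h.adj_iff x).1 hx with rfl | rfl | rfl <;> simp [*, Ne.symm]
    · rw [adjInd_of_not_adj hx]
      have := mt (h.adj_iff x).2 hx
      push Not at this
      simp [this]
  simp only [this, sum_add_distrib, sum_ite_eq']

end Critical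

/-! ### Uncrossing, cuts and degrees in a circuit -/

section Circ
variable {V : Type*} [Fintype V] {G : SimpleGraph V}

theorem Circ.two_le_card (hG : Circ G) : 2 ≤ Fintype.card V := by
  classical
  have h1 := adjCount_self_le (G := G) univ
  have h2 := hG.1
  have h3 := adjCount_nonneg (G := G) univ univ
  rw [card_univ] at h1
  by_contra! h
  interval_cases Fintype.card V <;> norm_num at * <;> omega

variable [DecidableEq V]

/-- Submodularity: by inclusion-exclusion the counts of union and intersection add up to at least
the two tight values, while both sets are nonempty and proper, so every inequality is an equality.
-/
theorem Circ.critical_union (hG : Circ G) {X Y : Finset V} (hX : Critical G X)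
    (hY : Critical G Y) (hi : (X ∩ Y).Nonempty) (hu : X ∪ Y ≠ univ) :
    Critical G (X ∪ Y) ∧ Critical G (X ∩ Y) ∧ adjCount G (X \ Y) (Y \ X) = 0 := by
  have h1 := adjCount_union_add_inter (G := G) X Y
  have h2 := hG.2 _ (hi.mono (inter_subset_left.trans subset_union_left)) hu
  have h3 := hG.2 (X ∩ Y) hi (by
    intro h
    exact hu (by rw [eq_univ_iff_forall] at h ⊢; intro x; have := h x; grind))
  have h4 := adjCount_nonneg (G := G) (X \ Y) (Y \ X)
  have h5 := card_union_add_card_inter X Y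
  unfold Critical at *
  omega

/-- Three edges at `v` add six to the count, but one more vertex raises the bound for proper sets by
only four. -/
theorem Circ.insert_eq_univ (hG : Circ G) {X : Finset V} (hX : Critical G X) {v : V} (hv : v ∉ X)
    (h3 : 3 ≤ adjCount G {v} X) : insert v X = univ := by
  by_contra h
  have h1 := hG.2 _ (insert_nonempty _ _) h
  rw [adjCount_insert_self hv, card_insert_of_notMem hv] at h1
  unfold Critical at hX
  push_cast at h1
  omega

theorem adjCount_univ_eq (A : Finset V) :
    adjCount G A univ = adjCount G A A + adjCount G A Aᶜ := by
  rw [← adjCount_union_right _ disjoint_compl_right, union_compl]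

theorem adjCount_univ_univ_eq (A : Finset V) :
    adjCount G univ univ = adjCount G A A + adjCount G Aᶜ Aᶜ + 2 * adjCount G A Aᶜ := by
  rw [← adjCount_union_self disjoint_compl_right, union_compl]

/-- The two sides account for at most `4|V| - 8` of the `4|V| - 2` ordered pairs. The remaining six
or more pairs come from at least three crossing edges, with exactly three when both sides are
critical. -/
theorem Circ.three_le_cut (hG : Circ G) {A : Finset V} (hA : A.Nonempty) (hA' : A ≠ univ) :
    3 ≤ adjCount G A Aᶜ := by
  have h1 := adjCount_univ_univ_eq (G := G) A
  have h2 := hG.2 A hA hA'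
  have h3 := hG.2 Aᶜ (by simpa [nonempty_iff_ne_empty] using hA') (by simpa using hA.ne_empty)
  have h4 := hG.1
  have h5 := card_add_card_compl A
  omega

theorem Circ.three_le_degree (hG : Circ G) (v : V) : 3 ≤ adjCount G {v} univ := by
  have h := hG.three_le_cut (A := {v}) (singleton_nonempty v) (by
    intro h
    have := hG.two_le_card
    rw [← card_univ, ← h] at this
    simp at this)
  have := adjCount_univ_eq (G := G) {v}
  simp at this
  omega

/-- The vertices of degree three induce a forest. -/
theorem Circ.adjCount_self_le_of_degree_eq_three (hG : Circ G) {S : Finset V} (hS : S.Nonempty)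
    (hS' : S ≠ univ) (h : ∀ v ∈ S, adjCount G {v} univ = 3) : adjCount G S S ≤ 2 * #S - 2 := by
  have h1 := adjCount_univ_univ_eq (G := G) S
  have h3 := hG.2 Sᶜ (by simpa [nonempty_iff_ne_empty] using hS') (by simpa using hS.ne_empty)
  have h4 := hG.1
  have h5 := card_add_card_compl S
  -- The degree sum `3|S|` is the count inside `S` plus the cut. This eliminates the cut from `h1`,
  -- and the bound for `Sᶜ` gives the rest.
  have h6 := sum_adjCount_singleton (G := G) S univ
  rw [sum_congr rfl h, adjCount_univ_eq] at h6
  simp at h6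
  omega

/-- Together with `Circ.three_le_cut` this puts the average degree outside a proper critical set
below four, which drives the final contradiction. -/
theorem Circ.sum_degree_compl_critical (hG : Circ G) {R : Finset V} (hR : Critical G R) :
    adjCount G Rᶜ univ = 4 * #Rᶜ + 2 - adjCount G R Rᶜ := by
  have h1 := adjCount_univ_univ_eq (G := G) R
  have h2 := adjCount_univ_eq (G := G) Rᶜ
  rw [compl_compl, adjCount_comm Rᶜ R] at h2
  have h4 := hG.1
  have h5 := card_add_card_compl R
  unfold Critical at hR
  omega

theorem IsNode.degree {v a b c : V} (h : IsNode G v a b c) :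
    SimpleTwoTwo.adjCount G {v} univ = 3 := by
  simp [h.adjCount]

theorem exists_isNode {v : V} (h : SimpleTwoTwo.adjCount G {v} univ = 3) :
    ∃ a b c, IsNode G v a b c := by
  classical
  rw [adjCount_eq_card] at h
  have h' : #{x ∈ univ | G.Adj v x} = 3 := by exact_mod_cast h
  obtain ⟨a, b, c, hab, hac, hbc, hs⟩ := card_eq_three.1 h'
  refine ⟨a, b, c, hab, hac, hbc, ?_⟩
  ext x
  have := congrArg (x ∈ ·) hs
  simpa using this

end Circ

/-! ### Irreducible circuits and the neighbours of a node -/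

section Reduction
variable {V : Type*} [Fintype V] [DecidableEq V] {G : SimpleGraph V}

variable (G) in
/-- The Henneberg 2 move can be undone at the node `v`, by adding the edge `ab`. -/
def Admissible (v a b c : V) : Prop :=
  IsNode G v a b c ∧ ¬ G.Adj a b ∧
    ∀ X : Finset V, Critical G X → a ∈ X → b ∈ X → v ∉ X → c ∈ X

variable (G) in
/-- A separation along the pair `a, b`, both sides of which are large enough for an inverse
1-sum or 2-sum to produce smaller graphs. -/
def IsSep (P Q : Finset V) (a b : V) : Prop :=
  P ∪ Q = univ ∧ P ∩ Q = {a, b} ∧ a ≠ b ∧ adjCount G (P \ Q) (Q \ P) = 0 ∧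
    ((¬ G.Adj a b ∧ 3 ≤ #P ∧ 3 ≤ #Q) ∨ (5 ≤ #P ∧ 5 ≤ #Q))

variable (G) in
/-- No inverse move applies, and the graph is not a base graph. -/
structure Irreducible : Prop where
  circ : Circ G
  not_admissible : ∀ v a b c, ¬ Admissible G v a b c
  not_sep : ∀ P Q a b, ¬ IsSep G P Q a b
  not_partition : ∀ A, Critical G A → Critical G Aᶜ → 2 ≤ #A → 2 ≤ #Aᶜ → False
  card_inter_le : ∀ K L, G.IsNClique 4 K → G.IsNClique 4 L → K ≠ L → #(K ∩ L) ≤ 1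
  card_ne_four : ∀ K R, G.IsNClique 4 K → G.IsNClique 4 R → K ∪ R = univ → #(K ∩ R) ≠ 1

namespace Irreducible

theorem exists_block (hG : Irreducible G) {v a b c : V} (hv : IsNode G v a b c)
    (hab : ¬ G.Adj a b) : ∃ X, Critical G X ∧ a ∈ X ∧ b ∈ X ∧ v ∉ X ∧ c ∉ X := by
  by_contra! h
  exact hG.not_admissible v a b c ⟨hv, hab, fun X h1 h2 h3 h4 => h X h1 h2 h3 h4⟩

/-- The union of two blocking sets of a node consists of all other vertices. -/
theorem union_block (hG : Irreducible G) {v a b c : V} (hv : IsNode G v a b c)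
    {X Y : Finset V} (hX : Critical G X) (hY : Critical G Y) (hXa : a ∈ X) (hXb : b ∈ X)
    (hXv : v ∉ X) (hYa : a ∈ Y) (hYc : c ∈ Y) (hYv : v ∉ Y) :
    insert v (X ∪ Y) = univ ∧ adjCount G (X \ Y) (Y \ X) = 0 := by
  have hvu : v ∉ X ∪ Y := by grind
  obtain ⟨h1, -, h2⟩ := hG.circ.critical_union hX hY ⟨a, by grind⟩ (by
    intro h; rw [h] at hvu; simp at hvu)
  refine ⟨hG.circ.insert_eq_univ h1 hvu ?_, h2⟩
  rw [hv.adjCount]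
  simp [hXa, hXb, hYc]

/-- Otherwise `ac` and `bc` are both blocked. The blocking set of `ac` contains `a` but not `b`,
that of `bc` contains `b` but not `a`, and uncrossing forbids the edge `ab` between their
differences. -/
theorem adj_of_adj (hG : Irreducible G) {v a b c : V} (hv : IsNode G v a b c)
    (hab : G.Adj a b) : G.Adj a c ∨ G.Adj b c := by
  by_contra! h
  obtain ⟨X, hX, hXa, hXc, hXv, hXb⟩ := hG.exists_block hv.rotate.rotate.swap h.1
  obtain ⟨Y, hY, hYb, hYc, hYv, hYa⟩ := hG.exists_block hv.rotate h.2
  have h1 := (hG.union_block hv.rotate.rotate hX hY hXc hXa hXv hYc hYb hYv).2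
  rw [adjCount_eq_zero_iff] at h1
  exact h1 a (by grind) b (by grind) hab

/-- If `bc` were missing, a set `X` blocking it would extend to the critical set `X ∪ {v}`, in which
`a` has the three neighbours `v, b, c`. Hence `a` and `v` are the only vertices outside `X`, and `b,
c` is a forbidden separating pair. -/
theorem adj_of_adj_of_adj (hG : Irreducible G) {v a b c : V} (hv : IsNode G v a b c)
    (hab : G.Adj a b) (hac : G.Adj a c) : G.Adj b c := by
  by_contra hbc
  obtain ⟨X, hX, hXb, hXc, hXv, hXa⟩ := hG.exists_block hv.rotate hbc
  have hvb : v ≠ b := ((hv.adj_iff b).2 (by simp)).ne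
  have hvc : v ≠ c := ((hv.adj_iff c).2 (by simp)).ne
  have hva : v ≠ a := ((hv.adj_iff a).2 (by simp)).ne
  have h1 : Critical G (insert v X) := hX.insert hXv (by
    rw [hv.adjCount]; simp [hXa, hXb, hXc])
  have hav : a ∉ insert v X := by grind
  have h2 : adjCount G {a} {v, b, c} ≤ adjCount G {a} (insert v X) :=
    adjCount_mono le_rfl (by grind)
  have h3 : adjCount G {a} {v, b, c} = 3 := by
    rw [adjCount_singleton_left, sum_insert (by grind), sum_pair hv.2.2.1,
      adjInd_of_adj hab, adjInd_of_adj hac, adjInd_of_adj ((hv.adj_iff a).2 (by simp)).symm]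
    rfl
  have h4 := hG.circ.insert_eq_univ h1 hav (by omega)
  -- A fourth neighbour of `a` would make the total count exceed `4|V| - 2`.
  have h5 : adjCount G {a} (insert v X) ≤ 3 := by
    by_contra! h5
    have h6 := hG.circ.1
    rw [← h4, adjCount_insert_self hav] at h6
    have h7 : Fintype.card V = #(insert v X) + 1 := by
      rw [← card_univ, ← h4, card_insert_of_notMem hav]
    rw [h7] at h6
    unfold Critical at h1
    push_cast at h6
    omega
  refine hG.not_sep {v, a, b, c} X b c ⟨?_, ?_, hv.2.2.1, ?_, Or.inl ⟨hbc, ?_, ?_⟩⟩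
  · rw [← h4]; grind
  · grind
  · have h6 : adjCount G {a} (insert v X \ {v, b, c}) = 0 := by
      have := adjCount_union_right (G := G) {a} (disjoint_sdiff (s := {v, b, c}) (t := insert v X))
      rw [union_sdiff_of_subset (by grind)] at this
      have := adjCount_nonneg (G := G) {a} (insert v X \ {v, b, c})
      omega
    rw [adjCount_eq_zero_iff] at h6 ⊢
    intro x hx y hy hxy
    have hx' : x = v ∨ x = a := by grind
    rcases hx' with rfl | rfl
    · have := (hv.adj_iff y).1 hxy
      grind
    · exact h6 x (by grind) y (by grind) hxy
  · rw [hv.card_insert]; norm_num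
  · have := hX.four_le_card (by
      have : ({b, c} : Finset V) ⊆ X := by grind
      have := card_le_card this
      rwa [card_pair hv.2.2.1] at this)
    omega

/-- The neighbours of a node are pairwise adjacent or pairwise nonadjacent. -/
theorem clique_or_independent (hG : Irreducible G) {v a b c : V} (hv : IsNode G v a b c) :
    G.IsNClique 4 {v, a, b, c} ∨ ¬ G.Adj a b ∧ ¬ G.Adj a c ∧ ¬ G.Adj b c := by
  by_cases hab : G.Adj a b
  · left
    have h1 : G.Adj a c ∧ G.Adj b c := by
      rcases hG.adj_of_adj hv hab with h | h
      · exact ⟨h, hG.adj_of_adj_of_adj hv hab h⟩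
      · exact ⟨hG.adj_of_adj_of_adj hv.swap hab.symm h, h⟩
    have hva := (hv.adj_iff a).2 (by simp)
    have hvb := (hv.adj_iff b).2 (by simp)
    have hvc := (hv.adj_iff c).2 (by simp)
    refine ⟨?_, hv.card_insert⟩
    simp [SimpleGraph.isClique_insert, *]
  · right
    refine ⟨hab, fun h => ?_, fun h => ?_⟩
    · rcases hG.adj_of_adj hv.rotate.rotate.swap h with h' | h'
      · exact hab h'
      · exact hab (hG.adj_of_adj_of_adj hv.rotate.rotate h.symm h')
    · rcases hG.adj_of_adj hv.rotate h with h' | h'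
      · exact hab h'.symm
      · exact hab (hG.adj_of_adj_of_adj hv.rotate.rotate h' h.symm)

end Irreducible
end Reduction

/-! ### Maximal feasible sets: irreducible circuits do not exist -/

section Analysis
variable {V : Type*} [Fintype V] [DecidableEq V] {G : SimpleGraph V}

variable (G) in
/-- A vertex of degree three that lies in a copy of `K₄`. -/
def IsCliqueNode (v : V) : Prop :=
  ∃ a b c, IsNode G v a b c ∧ G.IsNClique 4 {v, a, b, c}

variable (G) in
/-- A critical set that is not a single vertex of degree three and whose complement has a vertex of
larger degree. -/
def Feasible (R : Finset V) : Prop :=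
  Critical G R ∧ (∃ y ∉ R, adjCount G {y} univ ≠ 3) ∧
    ∀ x, R = {x} → adjCount G {x} univ ≠ 3

/-- Two vertices of degree other than three would do, one as a singleton `R` and one outside it.
With at most one such vertex `x`, the other `n - 1` vertices induce a forest and send at most `n -
1` edges to `x`, which is too few for a degree sum of `3(n - 1)`. -/
theorem Circ.exists_feasible (hG : Circ G) : ∃ R, Feasible G R := by
  by_contra! h
  have h1 : ∀ x y, adjCount G {x} univ ≠ 3 → y ≠ x → adjCount G {y} univ = 3 := by
    intro x y hx hyx
    by_contra hy
    refine h {x} ⟨critical_singleton x, ⟨y, by simpa using hyx, hy⟩, fun z hz => ?_⟩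
    rwa [← hz]
  have h2 : ∃ x : V, ∀ y ≠ x, adjCount G {y} univ = 3 := by
    by_cases h3 : ∃ x, adjCount G {x} univ ≠ 3
    · obtain ⟨x, hx⟩ := h3
      exact ⟨x, fun y hy => h1 x y hx hy⟩
    · push Not at h3
      have := hG.two_le_card
      have : Nonempty V := Fintype.card_pos_iff.1 (by omega)
      exact ⟨Classical.arbitrary V, fun y _ => h3 y⟩
  obtain ⟨x, hx⟩ := h2
  have hc := hG.two_le_card
  have hS : #({x}ᶜ : Finset V) = Fintype.card V - 1 := by simp [card_compl]
  have h4 := hG.adjCount_self_le_of_degree_eq_three (S := {x}ᶜ) (card_pos.1 (by omega))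
    (by simp) (fun v hv => hx v (by simpa using hv))
  have h5 := sum_adjCount_singleton (G := G) {x}ᶜ univ
  rw [sum_congr rfl fun v hv => hx v (by simpa using hv), adjCount_univ_eq, compl_compl] at h5
  have h6 := adjCount_le_mul (G := G) {x}ᶜ {x}
  simp only [sum_const, card_singleton, nsmul_eq_mul] at h5 h6
  push_cast at h6
  omega

theorem Circ.exists_maximal_feasible (hG : Circ G) :
    ∃ R, Feasible G R ∧ ∀ R', Feasible G R' → R ⊆ R' → R' = R := by
  classical
  obtain ⟨R₀, h₀⟩ := hG.exists_feasible
  obtain ⟨R, hR, hmax⟩ := exists_max_image (univ.filter (Feasible G)) card ⟨R₀, by simpa using h₀⟩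
  refine ⟨R, by simpa using hR, fun R' hR' hsub => ?_⟩
  exact (eq_of_subset_of_card_le hsub (hmax R' (by simpa using hR'))).symm

theorem adjCount_singleton_add_compl (v : V) (X : Finset V) :
    adjCount G {v} univ = adjCount G {v} X + adjCount G {v} Xᶜ := by
  rw [← adjCount_union_right _ disjoint_compl_right, union_compl]

theorem degree_eq_three_of_mem_clique (hG : Circ G) {K : Finset V} (hK : #K = 4) {y : V}
    (hy : y ∈ K) (h : adjCount G {y} Kᶜ = 0) : adjCount G {y} univ = 3 := by
  have h1 := hG.three_le_degree y
  have h2 := adjCount_singleton_add_compl (G := G) y K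
  have h3 : adjCount G {y} K = adjCount G {y} {y} + adjCount G {y} (K \ {y}) := by
    rw [← adjCount_union_right _ disjoint_sdiff, union_sdiff_of_subset (by simpa using hy)]
  have h4 := adjCount_le_mul (G := G) {y} (K \ {y})
  rw [card_sdiff_of_subset (by simpa using hy), hK] at h4
  simp at h3 h4
  omega

namespace Irreducible

/-- Away from a maximal feasible set, every vertex of degree three lies in a `K₄`. -/
theorem isCliqueNode (hG : Irreducible G) {R : Finset V} (hR : Feasible G R)
    (hmax : ∀ R', Feasible G R' → R ⊆ R' → R' = R) {w : V} (hw : w ∉ R)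
    (hw3 : adjCount G {w} univ = 3) : IsCliqueNode G w := by
  classical
  by_contra hwK
  have hC := hG.circ
  -- enlarging `R` by a critical set
  have key : ∀ X, Critical G X → (X ∩ R).Nonempty → X ∪ R ≠ univ → ¬ X ⊆ R →
      ∀ k, k ∉ X → k ∉ R → adjCount G {k} univ = 3 := by
    intro X hX hXR hu hsub k hkX hkR
    by_contra hk
    have h1 := (hC.critical_union hX hR.1 hXR hu).1
    have h2 := hmax (X ∪ R) ⟨h1, ⟨k, by grind, hk⟩, fun x hx => ?_⟩ subset_union_right
    · exact hsub (h2 ▸ subset_union_left)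
    · exfalso
      obtain ⟨y, hy⟩ := hXR
      apply hsub
      intro z hz
      have hz' : z = x := by
        have : z ∈ X ∪ R := by grind
        rw [hx] at this; simpa using this
      have hy' : y = x := by
        have : y ∈ X ∪ R := by grind
        rw [hx] at this; simpa using this
      grind
  -- With exactly two neighbours in `R`, the vertex `w` could join `R` and the set would stay
  -- feasible. With three, `R ∪ {w}` would be everything and leave no room for `y`.
  have hfew : ∀ w, w ∉ R → adjCount G {w} univ = 3 → adjCount G {w} R ≤ 1 := by
    intro w hw hw3
    by_contra! h
    obtain ⟨y, hyR, hy⟩ := hR.2.1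
    have hyw : y ≠ w := by rintro rfl; exact hy hw3
    by_cases h3 : 3 ≤ adjCount G {w} R
    · have := hC.insert_eq_univ hR.1 hw h3
      have : y ∈ insert w R := by rw [this]; simp
      grind
    · have h1 := hR.1.insert hw (by omega)
      have h2 := hmax _ ⟨h1, ⟨y, by grind, hy⟩, fun x hx => ?_⟩ (subset_insert _ _)
      · exact hw (h2 ▸ mem_insert_self w R)
      · exfalso
        obtain ⟨r, hr⟩ := hR.1.nonempty
        have e1 : r ∈ ({x} : Finset V) := hx ▸ mem_insert_of_mem hr
        have e2 : w ∈ ({x} : Finset V) := hx ▸ mem_insert_self w R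
        simp at e1 e2
        grind
  have hind : ∀ w, adjCount G {w} univ = 3 → ¬ IsCliqueNode G w →
      ∀ x y, G.Adj w x → G.Adj w y → ¬ G.Adj x y := by
    intro w hw hwK x y hx hy hxy
    obtain ⟨a, b, c, hN⟩ := exists_isNode hw
    have := (hG.clique_or_independent hN).resolve_left fun h => hwK ⟨a, b, c, hN, h⟩
    have hx' := (hN.adj_iff x).1 hx
    have hy' := (hN.adj_iff y).1 hy
    have hne := hxy.ne
    have hyx := hxy.symm
    rcases hx' with rfl | rfl | rfl <;> rcases hy' with rfl | rfl | rfl <;> tauto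
  -- The counterexamples. Each of them turns out to have two neighbours in `S`, against the forest
  -- bound for vertices of degree three.
  let S : Finset V := {w | w ∉ R ∧ adjCount G {w} univ = 3 ∧ ¬ IsCliqueNode G w}
  have hnext : ∀ w ∈ S, ∀ t, G.Adj w t → t ∉ R → adjCount G {t} univ = 3 → t ∈ S := by
    intro w hw t hwt htR ht3
    have hwS : w ∉ R ∧ adjCount G {w} univ = 3 ∧ ¬ IsCliqueNode G w := by simpa [S] using hw
    have : ¬ IsCliqueNode G t := by
      rintro ⟨a, b, c, hN, hK⟩
      have hi := hind w hwS.2.1 hwS.2.2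
      have hwn := (hN.adj_iff w).1 hwt.symm
      have hab : G.Adj a b := hK.isClique (by simp) (by simp) hN.1
      have hac : G.Adj a c := hK.isClique (by simp) (by simp) hN.2.1
      have hbc : G.Adj b c := hK.isClique (by simp) (by simp) hN.2.2.1
      rcases hwn with rfl | rfl | rfl
      · exact hi t b hwt hab ((hN.adj_iff b).2 (by simp))
      · exact hi t a hwt hab.symm ((hN.adj_iff a).2 (by simp))
      · exact hi t a hwt hac.symm ((hN.adj_iff a).2 (by simp))
    simp [S, *]
  have hdeg : ∀ w ∈ S, 2 ≤ adjCount G {w} S := by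
    intro w hw
    have hwS : w ∉ R ∧ adjCount G {w} univ = 3 ∧ ¬ IsCliqueNode G w := by simpa [S] using hw
    have hfew' := hfew w hwS.1 hwS.2.1
    -- a blocking set for two neighbours, one of them outside `R`, forces the third one
    have step : ∀ p q r, IsNode G w p q r → r ∉ R → ¬ (p ∈ R ∧ q ∈ R) →
        ∀ X, Critical G X → p ∈ X → q ∈ X → w ∉ X → r ∉ X → (X ∩ R).Nonempty → r ∈ S := by
      intro p q r hN hr hpq X hX hp hq hwX hrX hXR
      refine hnext w hw r ((hN.adj_iff r).2 (by simp)) hr (key X hX hXR ?_ ?_ r hrX hr)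
      · intro h
        have : w ∈ X ∪ R := by rw [h]; simp
        grind
      · intro h; exact hpq ⟨h hp, h hq⟩
    have main : ∀ p q r, IsNode G w p q r → q ∉ R → r ∉ R → 2 ≤ adjCount G {w} S := by
      intro p q r hN hq hr
      have hi := hind w hwS.2.1 hwS.2.2
      have ap := (hN.adj_iff p).2 (by simp)
      have aq := (hN.adj_iff q).2 (by simp)
      have ar := (hN.adj_iff r).2 (by simp)
      obtain ⟨X, hX, hXp, hXq, hXw, hXr⟩ := hG.exists_block hN (hi p q ap aq)
      obtain ⟨Y, hY, hYq, hYr, hYw, hYp⟩ := hG.exists_block hN.rotate (hi q r aq ar)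
      obtain ⟨Z, hZ, hZr, hZp, hZw, hZq⟩ := hG.exists_block hN.rotate.rotate (hi r p ar ap)
      have sX := step p q r hN hr (by tauto) X hX hXp hXq hXw hXr
      have sZ := step r p q hN.rotate.rotate hq (by tauto) Z hZ hZr hZp hZw hZq
      rw [hN.adjCount]
      by_cases hp : p ∈ R
      · have h1 := sX ⟨p, by grind⟩
        have h2 := sZ ⟨p, by grind⟩
        simp [h1, h2]
        split_ifs <;> norm_num
      · have sY := step q r p hN.rotate hp (by tauto) Y hY hYq hYr hYw hYp
        -- Any two of the blocking sets cover all vertices except `w`. So a vertex `x` of `R` lies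
        -- in at least two of the three, and each set that contains `x` puts the neighbour it omits
        -- into `S`.
        obtain ⟨x, hx⟩ := hR.1.nonempty
        have hxw : x ≠ w := by rintro rfl; exact hwS.1 hx
        have u1 := (hG.union_block hN hX hZ hXp hXq hXw hZp hZr hZw).1
        have u2 := (hG.union_block hN.rotate hY hX hYq hYr hYw hXq hXp hXw).1
        have u3 := (hG.union_block hN.rotate.rotate hZ hY hZr hZp hZw hYr hYq hYw).1
        have m1 : x ∈ insert w (X ∪ Z) := by rw [u1]; simp
        have m2 : x ∈ insert w (Y ∪ X) := by rw [u2]; simp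
        have m3 : x ∈ insert w (Z ∪ Y) := by rw [u3]; simp
        have nX : x ∈ X → r ∈ S := fun h => sX ⟨x, by grind⟩
        have nY : x ∈ Y → p ∈ S := fun h => sY ⟨x, by grind⟩
        have nZ : x ∈ Z → q ∈ S := fun h => sZ ⟨x, by grind⟩
        have : (p ∈ S ∧ q ∈ S) ∨ (q ∈ S ∧ r ∈ S) ∨ (p ∈ S ∧ r ∈ S) := by grind
        rcases this with h | h | h <;> simp only [h.1, h.2, if_true] <;> split_ifs <;> norm_num
    obtain ⟨p, q, r, hN⟩ := exists_isNode hwS.2.1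
    rw [hN.adjCount] at hfew'
    by_cases hp : p ∈ R <;> by_cases hq : q ∈ R <;> by_cases hr : r ∈ R <;>
      simp [hp, hq, hr] at hfew'
    · exact main p q r hN hq hr
    · exact main q r p hN.rotate hr hp
    · exact main r p q hN.rotate.rotate hp hq
    · exact main p q r hN hq hr
  have hwS : w ∈ S := by simp [S, *]
  have hSu : S ≠ univ := by
    obtain ⟨r, hr⟩ := hR.1.nonempty
    intro h
    have : r ∈ S := by rw [h]; simp
    simp [S, hr] at this
  have h1 := hC.adjCount_self_le_of_degree_eq_three ⟨w, hwS⟩ hSu fun v hv => by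
    have : v ∉ R ∧ adjCount G {v} univ = 3 ∧ ¬ IsCliqueNode G v := by simpa [S] using hv
    exact this.2.1
  have h2 := sum_le_sum hdeg
  rw [sum_adjCount_singleton] at h2
  simp at h2
  omega

/-- A `K₄` around a vertex of degree three outside a maximal feasible set avoids this set. -/
theorem disjoint_clique (hG : Irreducible G) {R : Finset V} (hR : Feasible G R)
    (hmax : ∀ R', Feasible G R' → R ⊆ R' → R' = R) {K : Finset V} (hK : G.IsNClique 4 K)
    {k : V} (hk : k ∉ R) (hkK : k ∈ K) : Disjoint K R := by
  by_contra hdis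
  have hC := hG.circ
  have hKR : (K ∩ R).Nonempty := by
    rwa [nonempty_iff_ne_empty, ne_eq, ← disjoint_iff_inter_eq_empty]
  have hKc := critical_of_isNClique hK
  have hm1 : 1 ≤ #(K ∩ R) := card_pos.2 hKR
  have hm3 : #(K ∩ R) < 4 := by
    rw [← hK.card_eq]
    exact card_lt_card ⟨inter_subset_left, fun h => by have := h hkK; grind⟩
  have hcl := adjCount_clique (G := G) (X := K ∩ R) fun x hx y hy hxy =>
    hK.isClique (by grind) (by grind) hxy
  have hsum := adjCount_union_add_inter (G := G) K R
  have hcard := card_union_add_card_inter K R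
  have hK4 := hK.card_eq
  have hRc := hR.1
  obtain ⟨y, hyR, hy⟩ := hR.2.1
  by_cases hu : K ∪ R = univ
  · rw [hu, hC.1, hKc, hRc, hcl, hK4] at hsum
    rw [hu, card_univ, hK4] at hcard
    have hyK : y ∈ K := by
      have : y ∈ K ∪ R := by rw [hu]; simp
      grind
    -- Otherwise all neighbours of `y` lie in `K`, and `y` has degree three.
    have hzero : adjCount G (K \ R) (R \ K) ≠ 0 := by
      intro h0
      refine hy (degree_eq_three_of_mem_clique hC hK4 hyK ?_)
      rw [adjCount_eq_zero_iff] at h0 ⊢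
      intro x hx z hz
      have hz' : z ∈ K ∪ R := by rw [hu]; simp
      have hzK : z ∉ K := by simpa using hz
      exact h0 x (by grind) z (by grind)
    -- With `m = #(K ∩ R)` and `d` crossing edges, inclusion-exclusion reads `m² - 5m + 6 = 2d`; for
    -- `1 ≤ m ≤ 3` and `d ≠ 0` only `m = d = 1` remains.
    have hd : #(K ∩ R) = 1 ∧ adjCount G (K \ R) (R \ K) = 1 := by
      generalize #(K ∩ R) = m at *
      interval_cases m <;> norm_num at hsum <;> omega
    obtain ⟨x, hx⟩ := card_eq_one.1 hd.1
    obtain ⟨p, hp, z, hz, hpz⟩ : ∃ p ∈ K \ R, ∃ z ∈ R \ K, G.Adj p z := by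
      by_contra! h
      exact hzero (adjCount_eq_zero_iff.2 h)
    have hxm : x ∈ K ∩ R := by rw [hx]; simp
    have hxz : x ≠ z := by grind
    -- The common vertex `x` and the end `z` in `R` of the only crossing edge separate. If `R` had
    -- just four vertices it would be a `K₄`, and `G` would be covered by two `K₄` sharing one
    -- vertex.
    refine hG.not_sep (insert z K) R x z ⟨?_, ?_, hxz, ?_, Or.inr ⟨?_, ?_⟩⟩
    · rw [eq_univ_iff_forall] at hu ⊢
      intro v; have := hu v; grind
    · rw [insert_inter_of_mem (by grind), hx, pair_comm]
    · have e1 : insert z K \ R = K \ R := by grind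
      have e2 : R \ insert z K = (R \ K) \ {z} := by grind
      rw [e1, e2]
      have h1 := adjCount_union_right (G := G) (K \ R)
        (disjoint_sdiff (s := {z}) (t := R \ K))
      rw [union_sdiff_of_subset (by simpa using hz), hd.2] at h1
      have h2 : adjCount G {p} {z} ≤ adjCount G (K \ R) {z} :=
        adjCount_mono (by simpa using hp) le_rfl
      rw [adjCount_singleton, adjInd_of_adj hpz] at h2
      have h3 := adjCount_nonneg (G := G) (K \ R) ((R \ K) \ {z})
      omega
    · rw [card_insert_of_notMem (by grind), hK4]
    · have h2 : 2 ≤ #R := by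
        rw [← card_pair hxz]
        exact card_le_card (by grind)
      have h4 := hRc.four_le_card h2
      by_contra! h5
      exact hG.card_ne_four K R hK (hRc.isNClique (by omega)) hu hd.1
  · obtain ⟨hKRc, hIc, hd⟩ := hC.critical_union hKc hRc hKR hu
    -- A clique on `m < 4` vertices is critical only if `m² - m = 4m - 4`, that is, `m = 1`.
    have hone : #(K ∩ R) = 1 := by
      unfold Critical at hIc
      rw [hcl] at hIc
      generalize #(K ∩ R) = m at *
      interval_cases m <;> norm_num at hIc
      rfl
    obtain ⟨x, hx⟩ := card_eq_one.1 hone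
    have hxm : x ∈ K ∩ R := by rw [hx]; simp
    rw [adjCount_eq_zero_iff] at hd
    -- Otherwise `K ∪ R` would be a larger feasible set.
    have hout : ∀ t, t ∉ K → t ∉ R → adjCount G {t} univ = 3 := by
      intro t htK htR
      by_contra ht
      have := hmax (K ∪ R) ⟨hKRc, ⟨t, by grind, ht⟩, fun x hx => ?_⟩ subset_union_right
      · exact hk (this ▸ mem_union_left R hkK)
      · have := card_le_card (subset_union_left (s₁ := K) (s₂ := R))
        rw [hx, hK4] at this
        simp at this
    -- If `K` met the rest of the graph only at `x`, the total count would be at most `12 + 4(|V| -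
    -- 3) - 4 = 4|V| - 4`.
    obtain ⟨s, hs, t, ht, hst⟩ : ∃ s ∈ K \ R, ∃ t ∉ K, G.Adj s t := by
      by_contra! h
      have h1 := adjCount_union_add_inter (G := G) K (K \ R)ᶜ
      have e1 : K ∪ (K \ R)ᶜ = univ := by
        rw [eq_univ_iff_forall]; intro v; simp; tauto
      have e2 : K ∩ (K \ R)ᶜ = {x} := by rw [← hx]; ext v; simp; tauto
      have e3 : adjCount G (K \ (K \ R)ᶜ) ((K \ R)ᶜ \ K) = 0 := by
        rw [adjCount_eq_zero_iff]
        intro a ha b hb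
        exact h a (by simp at ha ⊢; tauto) b (by simp at hb; tauto)
      have h2 := hC.2 (K \ R)ᶜ ⟨x, by simp; grind⟩ (by
        intro h
        have : k ∈ (K \ R)ᶜ := by rw [h]; simp
        simp at this; grind)
      have h3 := card_union_add_card_inter K (K \ R)ᶜ
      rw [e1, e2, e3, hC.1, hKc] at h1
      rw [e1, e2, card_univ, card_singleton] at h3
      simp at h1
      omega
    have htR : t ∉ R := fun h => hd s hs t (by grind) hst
    obtain ⟨a, b, c, hN, hL⟩ := hG.isCliqueNode hR hmax htR (hout t ht htR)
    set L : Finset V := {t, a, b, c} with hLdef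
    have hsL : s ∈ L := by
      have := (hN.adj_iff s).1 hst.symm
      simp [hLdef, this]
    have hLK : #(L ∩ K) ≤ 1 := hG.card_inter_le L K hL hK (by rintro h; apply ht; rw [← h]; simp [hLdef])
    have hrest : ∀ v ∈ L.erase s, adjCount G {v} univ = 3 := by
      intro v hv
      have hvL : v ∈ L := by grind
      have hvs : v ≠ s := by grind
      have hvK : v ∉ K := by
        intro hvK
        exact hvs (card_le_one.1 hLK v (by grind) s (by grind))
      refine hout v hvK fun hvR => hd s hs v (by grind) ?_
      exact hL.isClique (by simpa using hsL) (by simpa using hvL) hvs.symm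
    have h3 : #(L.erase s) = 3 := by rw [card_erase_of_mem hsL, hL.card_eq]
    -- The other three vertices of `L` lie outside `K ∪ R`, so they form a triangle of vertices of
    -- degree three: the count 6 exceeds the forest bound 4.
    have h4 := hC.adjCount_self_le_of_degree_eq_three (S := L.erase s)
      (card_pos.1 (by omega)) (fun h => by
        have : s ∈ L.erase s := by rw [h]; simp
        simp at this) hrest
    rw [adjCount_clique fun x hx y hy hxy => hL.isClique (by grind) (by grind) hxy, h3] at h4
    norm_num at h4

/-- Discharging: the sum of `4 - deg` over `Rᶜ` is `cut(R) - 2 ≥ 1`, yet it is at most zero on every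
maximal critical subset of `Rᶜ`. -/
theorem false (hG : Irreducible G) : False := by
  classical
  have hC := hG.circ
  obtain ⟨R, hR, hmax⟩ := hC.exists_maximal_feasible
  have hRne := hR.1.nonempty
  obtain ⟨y, hyR, -⟩ := hR.2.1
  have hU : ∀ a ∈ Rᶜ, ∃ U, Critical G U ∧ a ∈ U ∧ U ⊆ Rᶜ ∧
      ∀ U', Critical G U' → a ∈ U' → U' ⊆ Rᶜ → #U' ≤ #U := by
    intro a ha
    obtain ⟨U, hU, hUm⟩ := exists_max_image
      (univ.filter fun U => Critical G U ∧ a ∈ U ∧ U ⊆ Rᶜ) card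
      ⟨{a}, by simpa [critical_singleton] using ha⟩
    simp only [mem_filter, mem_univ, true_and] at hU hUm
    exact ⟨U, hU.1, hU.2.1, hU.2.2, fun U' h1 h2 h3 => hUm U' ⟨h1, h2, h3⟩⟩
  choose! U hUc hUa hUR hUm using hU
  -- Critical subsets of `Rᶜ` that meet have a critical union, since `R` keeps the union proper. So
  -- the maximal ones partition `Rᶜ`.
  have hUeq : ∀ a ∈ Rᶜ, ∀ b ∈ U a, U b = U a := by
    intro a ha b hb
    have hbR := hUR a ha hb
    have hcu := (hC.critical_union (hUc a ha) (hUc b hbR) ⟨b, by grind⟩ (by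
      obtain ⟨r, hr⟩ := hRne
      intro h
      have h1 : r ∈ U a ∪ U b := by rw [h]; simp
      have h2 : r ∈ Rᶜ := union_subset (hUR a ha) (hUR b hbR) h1
      simp [hr] at h2)).1
    have hsub : U a ∪ U b ⊆ Rᶜ := union_subset (hUR a ha) (hUR b hbR)
    have e1 := eq_of_subset_of_card_le (subset_union_left (s₁ := U a) (s₂ := U b))
      (hUm a ha _ hcu (by grind) hsub)
    have e2 := eq_of_subset_of_card_le (subset_union_right (s₁ := U a) (s₂ := U b))
      (hUm b hbR _ hcu (by grind) hsub)
    rw [e2, ← e1]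
  have hpart : ∑ T ∈ Rᶜ.image U, ∑ a ∈ Rᶜ with U a = T, (4 - adjCount G {a} univ) =
      ∑ a ∈ Rᶜ, (4 - adjCount G {a} univ) :=
    sum_fiberwise_of_maps_to (fun a ha => mem_image_of_mem U ha) _
  have hle : ∑ T ∈ Rᶜ.image U, ∑ a ∈ Rᶜ with U a = T, (4 - adjCount G {a} univ) ≤ 0 := by
    refine sum_nonpos fun T hT => ?_
    obtain ⟨a, ha, rfl⟩ := mem_image.1 hT
    have hfib : ({b ∈ Rᶜ | U b = U a} : Finset V) = U a := by
      ext b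
      simp only [mem_filter]
      constructor
      · rintro ⟨hb, h⟩; rw [← h]; exact hUa b hb
      · intro hb; exact ⟨hUR a ha hb, hUeq a ha b hb⟩
    rw [hfib]
    by_cases h2 : 2 ≤ #(U a)
    · have hne : U a ≠ univ := by
        obtain ⟨r, hr⟩ := hRne
        intro h
        have h1 : r ∈ U a := by rw [h]; simp
        have := hUR a ha h1
        simp [hr] at this
      have hcut := hC.three_le_cut ⟨a, hUa a ha⟩ hne
      have hcut4 : 4 ≤ adjCount G (U a) (U a)ᶜ := by
        by_contra! h
        have h1 := adjCount_univ_univ_eq (G := G) (U a)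
        have h5 := card_add_card_compl (U a)
        have hcc : Critical G (U a)ᶜ := by
          have := hUc a ha
          have := hC.1
          unfold Critical at *
          omega
        refine hG.not_partition (U a) (hUc a ha) hcc h2 ?_
        -- If the complement of `U a` is a single vertex, that vertex is `R` and has degree three;
        -- the last clause of `Feasible` excludes exactly this.
        by_contra! h6
        have hRsub : R ⊆ (U a)ᶜ := fun r hr => by
          have := hUR a ha
          simp only [mem_compl]
          intro h; have := this h; simp [hr] at this
        have hc1 : 1 ≤ #R := card_pos.2 hRne
        have hc2 := card_le_card hRsub
        have hReq : R = (U a)ᶜ := eq_of_subset_of_card_le hRsub (by omega)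
        obtain ⟨x, hx⟩ := card_eq_one.1 (show #R = 1 by omega)
        refine hR.2.2 x hx ?_
        have h7 := adjCount_univ_eq (G := G) R
        rw [show Rᶜ = U a by rw [hReq, compl_compl], adjCount_comm R (U a)] at h7
        rw [← hReq] at h hcut
        rw [hx] at h7 h hcut
        rw [h7, adjCount_singleton, adjInd_self]
        omega
      have h8 := hUc a ha
      have h9 := adjCount_univ_eq (G := G) (U a)
      rw [sum_sub_distrib, sum_adjCount_singleton, h9, h8]
      simp
      omega
    · have h1 : #(U a) = 1 := by
        have : 1 ≤ #(U a) := card_pos.2 ⟨a, hUa a ha⟩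
        omega
      obtain ⟨b, hb⟩ := card_eq_one.1 h1
      have hba : a = b := by have := hUa a ha; rw [hb] at this; simpa using this
      subst hba
      rw [hb, sum_singleton]
      have hd := hC.three_le_degree a
      -- A vertex of degree three would lie in a `K₄` inside `Rᶜ`, a critical set larger than the
      -- maximal one `{a}`.
      have : adjCount G {a} univ ≠ 3 := by
        intro h3
        have haR : a ∉ R := by simpa using ha
        obtain ⟨p, q, r, hN, hK⟩ := hG.isCliqueNode hR hmax haR h3
        have hdis := hG.disjoint_clique hR hmax hK haR (by simp)
        have := hUm a ha _ (critical_of_isNClique hK) (by simp) (by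
          intro z hz; simp only [mem_compl]; exact Finset.disjoint_left.1 hdis hz)
        rw [hK.card_eq] at this
        omega
      omega
  rw [hpart, sum_sub_distrib, sum_adjCount_singleton, hC.sum_degree_compl_critical hR.1] at hle
  have := hC.three_le_cut hRne (by intro h; rw [h] at hyR; simp at hyR)
  simp at hle
  omega

end Irreducible
end Analysis

/-! ### Base graphs and the list of reductions -/

section Base

theorem cliqueOn_adj {V : Type*} (s : Set V) (x y : V) :
    (cliqueOn s).Adj x y ↔ x ≠ y ∧ x ∈ s ∧ y ∈ s := by
  simp only [cliqueOn, fromRel_adj]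
  tauto

theorem K5MinusEdge_adj (i j : Fin 5) : K5MinusEdge.Adj i j ↔
    i ≠ j ∧ ((i ≠ 0 ∧ j ≠ 0) ∨ (i ≠ 1 ∧ j ≠ 1)) := by
  simp only [K5MinusEdge, deleteEdges_adj, top_adj, Set.mem_singleton_iff, Sym2.eq_iff]
  revert i j
  decide

theorem K4ShareEdge_adj (i j : Fin 6) : K4ShareEdge.Adj i j ↔
    i ≠ j ∧ ((i ≤ 3 ∧ j ≤ 3) ∨ ((i ≤ 1 ∨ 4 ≤ i) ∧ (j ≤ 1 ∨ 4 ≤ j))) := by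
  simp only [K4ShareEdge, sup_adj, cliqueOn_adj, Set.mem_insert_iff, Set.mem_singleton_iff]
  revert i j
  decide

theorem K4ShareVertex_adj (i j : Fin 7) : K4ShareVertex.Adj i j ↔
    i ≠ j ∧ ((i ≤ 3 ∧ j ≤ 3) ∨ ((i = 0 ∨ 4 ≤ i) ∧ (j = 0 ∨ 4 ≤ j)) ∨
      (i = 1 ∧ j = 4) ∨ (i = 4 ∧ j = 1)) := by
  simp only [K4ShareVertex, sup_adj, cliqueOn_adj, Set.mem_insert_iff, Set.mem_singleton_iff,
    edge_adj]
  revert i j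
  decide

/-- Replaces adjacency by a decidable relation, so that all vertex subsets of a base graph can be
checked by evaluation. -/
theorem circ_of_adj_iff {n : ℕ} {H : SimpleGraph (Fin n)} {r : Fin n → Fin n → Prop}
    [DecidableRel r] (h : ∀ i j, H.Adj i j ↔ r i j)
    (h₁ : (∑ i, ∑ j, if r i j then 1 else 0 : ℤ) = 4 * n - 2)
    (h₂ : ∀ X : Finset (Fin n), X.Nonempty → X ≠ univ →
      (∑ i ∈ X, ∑ j ∈ X, if r i j then 1 else 0 : ℤ) ≤ 4 * #X - 4) : Circ H := by
  have h' : ∀ i j, adjInd H i j = if r i j then 1 else 0 := by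
    intro i j
    by_cases hr : r i j
    · rw [if_pos hr, adjInd_of_adj ((h i j).2 hr)]
    · rw [if_neg hr, adjInd_of_not_adj (mt (h i j).1 hr)]
  simp only [Circ, adjCount, h', Fintype.card_fin]
  exact ⟨h₁, h₂⟩

theorem circ_K5MinusEdge : Circ K5MinusEdge :=
  circ_of_adj_iff K5MinusEdge_adj (by decide +kernel) (by decide +kernel)

theorem circ_K4ShareEdge : Circ K4ShareEdge :=
  circ_of_adj_iff K4ShareEdge_adj (by decide +kernel) (by decide +kernel)

theorem circ_K4ShareVertex : Circ K4ShareVertex :=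
  circ_of_adj_iff K4ShareVertex_adj (by decide +kernel) (by decide +kernel)

theorem adj_of_isNClique {V : Type*} {G : SimpleGraph V} {K : Finset V} {m : ℕ} (hK : G.IsNClique m K) {x y : V} (hx : x ∈ K)
    (hy : y ∈ K) (hxy : x ≠ y) : G.Adj x y :=
  hK.isClique (mem_coe.2 hx) (mem_coe.2 hy) hxy

variable {V : Type*} [Fintype V] {G : SimpleGraph V}

/-- A circuit that contains a circuit with equally many vertices is isomorphic to it. -/
theorem Circ.nonempty_iso_of_injective {n : ℕ} {H : SimpleGraph (Fin n)} (hG : Circ G)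
    (hH : Circ H) (hn : Fintype.card V = n) (f : Fin n → V) (hf : Function.Injective f)
    (h : ∀ i j, H.Adj i j → G.Adj (f i) (f j)) : Nonempty (G ≃g H) := by
  have hbij : Function.Bijective f :=
    (Fintype.bijective_iff_injective_and_card f).2 ⟨hf, by simp [hn]⟩
  let e := Equiv.ofBijective f hbij
  have hle : ∀ i j, adjInd H i j ≤ adjInd G (f i) (f j) := by
    intro i j
    by_cases hij : H.Adj i j
    · rw [adjInd_of_adj hij, adjInd_of_adj (h i j hij)]
    · rw [adjInd_of_not_adj hij]; exact adjInd_nonneg _ _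
  -- Both totals are `4n - 2`, so the termwise inequality `hle` is an equality everywhere.
  have hsum : ∑ i, ∑ j, adjInd H i j = ∑ i, ∑ j, adjInd G (f i) (f j) := by
    have h1 : ∑ i, ∑ j, adjInd G (f i) (f j) = adjCount G univ univ := by
      unfold adjCount
      rw [← e.sum_comp]
      refine sum_congr rfl fun i _ => ?_
      rw [← e.sum_comp]
      rfl
    rw [h1, hG.1, hn]
    have := hH.1
    rw [Fintype.card_fin] at this
    exact this
  have h1 := (sum_eq_sum_iff_of_le fun i _ => sum_le_sum fun j _ => hle i j).1 hsum
  refine ⟨(SimpleGraph.Iso.symm ⟨e, ?_⟩)⟩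
  intro i j
  have h2 := (sum_eq_sum_iff_of_le fun j _ => hle i j).1 (h1 i (mem_univ i)) j (mem_univ j)
  change G.Adj (f i) (f j) ↔ H.Adj i j
  refine ⟨fun hij => ?_, h i j⟩
  by_contra hij'
  rw [adjInd_of_adj hij, adjInd_of_not_adj hij'] at h2
  norm_num at h2

variable [DecidableEq V]

/-- Two copies of `K₄` with two common vertices only occur in base graphs. -/
theorem Circ.isBaseGraph_of_two_le_card_inter (hG : Circ G) {K L : Finset V}
    (hK : G.IsNClique 4 K) (hL : G.IsNClique 4 L) (hKL : K ≠ L) (h2 : 2 ≤ #(K ∩ L)) :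
    IsBaseGraph G := by
  have hI := adjCount_clique (G := G) (X := K ∩ L) fun x hx y hy hxy =>
    adj_of_isNClique hK (by grind) (by grind) hxy
  have hK4 := hK.card_eq
  have hL4 := hL.card_eq
  have h3 : #(K ∩ L) ≤ 3 := by
    by_contra! h
    have e1 := eq_of_subset_of_card_le (inter_subset_left (s₁ := K) (s₂ := L)) (by omega)
    have e2 := eq_of_subset_of_card_le (inter_subset_right (s₁ := K) (s₂ := L)) (by omega)
    exact hKL (e1.symm.trans e2)
  have hcard := card_union_add_card_inter K L
  -- Otherwise the intersection would be critical, which two or three vertices cannot be.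
  have hu : K ∪ L = univ := by
    by_contra hu
    have := (hG.critical_union (critical_of_isNClique hK) (critical_of_isNClique hL)
      (card_pos.1 (by omega)) hu).2.1
    rw [Critical, hI] at this
    have h' : #(K ∩ L) = 2 ∨ #(K ∩ L) = 3 := by omega
    rcases h' with h' | h' <;> rw [h'] at this <;> norm_num at this
  rw [hu, card_univ] at hcard
  have hKs := card_sdiff_add_card_inter K L
  have hLs := card_sdiff_add_card_inter L K
  rw [inter_comm] at hLs
  have h' : #(K ∩ L) = 3 ∨ #(K ∩ L) = 2 := by omega
  rcases h' with h' | h'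
  · left
    obtain ⟨p, q, r, hpq, hpr, hqr, hI⟩ := card_eq_three.1 h'
    obtain ⟨s, hs⟩ := card_eq_one.1 (show #(K \ L) = 1 by omega)
    obtain ⟨t, ht⟩ := card_eq_one.1 (show #(L \ K) = 1 by omega)
    have mp : p ∈ K ∩ L := by rw [hI]; simp
    have mq : q ∈ K ∩ L := by rw [hI]; simp
    have mr : r ∈ K ∩ L := by rw [hI]; simp
    have ms : s ∈ K \ L := by rw [hs]; simp
    have mt : t ∈ L \ K := by rw [ht]; simp
    have hinj : Function.Injective ![s, t, p, q, r] := by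
      intro i j hij
      fin_cases i <;> fin_cases j <;> simp at hij ⊢ <;> grind
    refine hG.nonempty_iso_of_injective circ_K5MinusEdge (by omega) _ hinj fun i j hij => ?_
    obtain ⟨hne, h | h⟩ := (K5MinusEdge_adj i j).1 hij
    · have : ∀ i : Fin 5, i ≠ 0 → ![s, t, p, q, r] i ∈ L := by
        intro i hi; fin_cases i <;> simp at hi ⊢ <;> grind
      exact adj_of_isNClique hL (this i h.1) (this j h.2) (hinj.ne hne)
    · have : ∀ i : Fin 5, i ≠ 1 → ![s, t, p, q, r] i ∈ K := by
        intro i hi; fin_cases i <;> simp at hi ⊢ <;> grind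
      exact adj_of_isNClique hK (this i h.1) (this j h.2) (hinj.ne hne)
  · right; left
    obtain ⟨p, q, hpq, hI⟩ := card_eq_two.1 h'
    obtain ⟨s, s', hss, hs⟩ := card_eq_two.1 (show #(K \ L) = 2 by omega)
    obtain ⟨t, t', htt, ht⟩ := card_eq_two.1 (show #(L \ K) = 2 by omega)
    have mp : p ∈ K ∩ L := by rw [hI]; simp
    have mq : q ∈ K ∩ L := by rw [hI]; simp
    have ms : s ∈ K \ L := by rw [hs]; simp
    have ms' : s' ∈ K \ L := by rw [hs]; simp
    have mt : t ∈ L \ K := by rw [ht]; simp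
    have mt' : t' ∈ L \ K := by rw [ht]; simp
    have hinj : Function.Injective ![p, q, s, s', t, t'] := by
      intro i j hij
      fin_cases i <;> fin_cases j <;> simp at hij ⊢ <;> grind
    refine hG.nonempty_iso_of_injective circ_K4ShareEdge (by omega) _ hinj fun i j hij => ?_
    obtain ⟨hne, h | h⟩ := (K4ShareEdge_adj i j).1 hij
    · have : ∀ i : Fin 6, i ≤ 3 → ![p, q, s, s', t, t'] i ∈ K := by
        intro i hi; fin_cases i <;> simp at hi ⊢ <;> grind
      exact adj_of_isNClique hK (this i h.1) (this j h.2) (hinj.ne hne)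
    · have : ∀ i : Fin 6, i ≤ 1 ∨ 4 ≤ i → ![p, q, s, s', t, t'] i ∈ L := by
        intro i hi; fin_cases i <;> simp at hi ⊢ <;> grind
      exact adj_of_isNClique hL (this i h.1) (this j h.2) (hinj.ne hne)

/-- A circuit covered by two copies of `K₄` with one common vertex is a base graph. -/
theorem Circ.isBaseGraph_of_card_inter_eq_one (hG : Circ G) {K L : Finset V}
    (hK : G.IsNClique 4 K) (hL : G.IsNClique 4 L) (hu : K ∪ L = univ) (h1 : #(K ∩ L) = 1) :
    IsBaseGraph G := by
  have hK4 := hK.card_eq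
  have hL4 := hL.card_eq
  have hcard := card_union_add_card_inter K L
  rw [hu, card_univ] at hcard
  have hKs := card_sdiff_add_card_inter K L
  have hLs := card_sdiff_add_card_inter L K
  rw [inter_comm] at hLs
  have hsum := adjCount_union_add_inter (G := G) K L
  have hI := adjCount_clique (G := G) (X := K ∩ L) fun x hx y hy hxy =>
    adj_of_isNClique hK (by grind) (by grind) hxy
  rw [hu, hG.1, critical_of_isNClique hK, critical_of_isNClique hL, hI, h1, hK4, hL4] at hsum
  obtain ⟨s, hs, t, ht, hst⟩ : ∃ s ∈ K \ L, ∃ t ∈ L \ K, G.Adj s t := by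
    by_contra! h
    rw [adjCount_eq_zero_iff.2 h] at hsum
    norm_num at hsum
    omega
  obtain ⟨p, hp⟩ := card_eq_one.1 h1
  obtain ⟨s₁, s₂, hss, hs'⟩ := card_eq_two.1
    (show #((K \ L).erase s) = 2 by rw [card_erase_of_mem hs]; omega)
  obtain ⟨t₁, t₂, htt, ht'⟩ := card_eq_two.1
    (show #((L \ K).erase t) = 2 by rw [card_erase_of_mem ht]; omega)
  have mp : p ∈ K ∩ L := by rw [hp]; simp
  have ms₁ : s₁ ∈ (K \ L).erase s := by rw [hs']; simp
  have ms₂ : s₂ ∈ (K \ L).erase s := by rw [hs']; simp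
  have mt₁ : t₁ ∈ (L \ K).erase t := by rw [ht']; simp
  have mt₂ : t₂ ∈ (L \ K).erase t := by rw [ht']; simp
  have hinj : Function.Injective ![p, s, s₁, s₂, t, t₁, t₂] := by
    intro i j hij
    fin_cases i <;> fin_cases j <;> simp at hij ⊢ <;> grind
  right; right
  refine hG.nonempty_iso_of_injective circ_K4ShareVertex (by omega) _ hinj fun i j hij => ?_
  obtain ⟨hne, h | h | ⟨rfl, rfl⟩ | ⟨rfl, rfl⟩⟩ := (K4ShareVertex_adj i j).1 hij
  · have : ∀ i : Fin 7, i ≤ 3 → ![p, s, s₁, s₂, t, t₁, t₂] i ∈ K := by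
      intro i hi; fin_cases i <;> simp at hi ⊢ <;> grind
    exact adj_of_isNClique hK (this i h.1) (this j h.2) (hinj.ne hne)
  · have : ∀ i : Fin 7, i = 0 ∨ 4 ≤ i → ![p, s, s₁, s₂, t, t₁, t₂] i ∈ L := by
      intro i hi; fin_cases i <;> simp at hi ⊢ <;> grind
    exact adj_of_isNClique hL (this i h.1) (this j h.2) (hinj.ne hne)
  · exact hst
  · exact hst.symm

/-- A circuit that is not a base graph can be reduced. -/
theorem Circ.exists_reduction (hG : Circ G) :
    IsBaseGraph G ∨ (∃ v a b c, Admissible G v a b c) ∨ (∃ P Q a b, IsSep G P Q a b) ∨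
      ∃ A, Critical G A ∧ Critical G Aᶜ ∧ 2 ≤ #A ∧ 2 ≤ #Aᶜ := by
  by_contra! h
  obtain ⟨h1, h2, h3, h4⟩ := h
  refine Irreducible.false (G := G) ⟨hG, h2, h3, fun A a b c d => ?_, ?_, ?_⟩
  · have := h4 A a b c; omega
  · intro K L hK hL hKL
    by_contra! h
    exact h1 (hG.isBaseGraph_of_two_le_card_inter hK hL hKL h)
  · intro K R hK hR hu hc
    exact h1 (hG.isBaseGraph_of_card_inter_eq_one hK hR hu hc)

end Base

/-! ### Counts after adding edges or vertices and under vertex maps -/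

section Modify
variable {V W : Type*} {G : SimpleGraph V}

theorem adjInd_congr {H : SimpleGraph W} {x y : V} {x' y' : W} (h : G.Adj x y ↔ H.Adj x' y') :
    adjInd G x y = adjInd H x' y' := by
  by_cases hG : G.Adj x y
  · rw [adjInd_of_adj hG, adjInd_of_adj (h.1 hG)]
  · rw [adjInd_of_not_adj hG, adjInd_of_not_adj (mt h.2 hG)]

theorem sum_sum_ite_pair [DecidableEq V] (X Y : Finset V) (u w : V) :
    (∑ x ∈ X, ∑ y ∈ Y, if x = u ∧ y = w then (1 : ℤ) else 0) =
      if u ∈ X ∧ w ∈ Y then 1 else 0 := by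
  simp [ite_and, Finset.sum_ite_eq']

theorem adjCount_sup_edge [DecidableEq V] {u w : V} (huw : u ≠ w) (h : ¬ G.Adj u w)
    (X : Finset V) : adjCount (G ⊔ edge u w) X X =
      adjCount G X X + if u ∈ X ∧ w ∈ X then 2 else 0 := by
  have hp : ∀ x y, adjInd (G ⊔ edge u w) x y = adjInd G x y +
      (if x = u ∧ y = w then 1 else 0) + (if x = w ∧ y = u then 1 else 0) := by
    intro x y
    by_cases h1 : x = u ∧ y = w
    · obtain ⟨rfl, rfl⟩ := h1
      rw [adjInd_of_adj (by simp [edge_adj, huw]), adjInd_of_not_adj h]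
      simp [huw]
    · by_cases h2 : x = w ∧ y = u
      · obtain ⟨rfl, rfl⟩ := h2
        rw [adjInd_of_adj (by simp [edge_adj, huw.symm]),
          adjInd_of_not_adj fun h' => h h'.symm]
        simp [huw]
      · have : (G ⊔ edge u w).Adj x y ↔ G.Adj x y := by
          simp only [sup_adj, edge_adj]; tauto
        simp [h1, h2, adjInd_congr this]
  unfold adjCount
  simp only [hp, sum_add_distrib, sum_sum_ite_pair]
  split_ifs <;> first | omega | tauto

theorem adjCount_deleteEdge [DecidableEq V] {u w : V} (h : G.Adj u w) (X : Finset V) :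
    adjCount (G.deleteEdges {s(u, w)}) X X =
      adjCount G X X - if u ∈ X ∧ w ∈ X then 2 else 0 := by
  have h1 : G.deleteEdges {s(u, w)} ⊔ edge u w = G := by
    ext x y
    simp only [sup_adj, edge_adj, deleteEdges_adj, Set.mem_singleton_iff, Sym2.eq_iff]
    constructor
    · rintro (h' | ⟨⟨rfl, rfl⟩ | ⟨rfl, rfl⟩, -⟩)
      · exact h'.1
      · exact h
      · exact h.symm
    · intro h'
      have := h'.ne
      tauto
  have h2 := adjCount_sup_edge (G := G.deleteEdges {s(u, w)}) h.ne (by simp) X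
  rw [h1] at h2
  omega

variable (G) in
/-- The graph with a new vertex `none` that is joined to the vertices in `S`. -/
def addVertex (S : Set V) : SimpleGraph (Option V) where
  Adj
    | some x, some y => G.Adj x y
    | some x, none => x ∈ S
    | none, some y => y ∈ S
    | none, none => False
  symm := ⟨fun x y h => by
    cases x <;> cases y
    · exact h
    · exact h
    · exact h
    · exact G.symm.symm _ _ h⟩
  loopless := ⟨fun x h => by
    cases x
    · exact h
    · exact G.loopless.irrefl _ h⟩

@[simp] theorem addVertex_adj_some_some {S : Set V} {x y : V} :
    (addVertex G S).Adj (some x) (some y) ↔ G.Adj x y := Iff.rfl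

@[simp] theorem addVertex_adj_some_none {S : Set V} {x : V} :
    (addVertex G S).Adj (some x) none ↔ x ∈ S := Iff.rfl

@[simp] theorem addVertex_adj_none_some {S : Set V} {y : V} :
    (addVertex G S).Adj none (some y) ↔ y ∈ S := Iff.rfl

theorem hennebergTwo_eq_addVertex (u w z : V) :
    hennebergTwo G u w z = addVertex (G.deleteEdges {s(u, w)}) {u, w, z} := by
  ext x y
  cases x <;> cases y <;>
    simp [hennebergTwo, edge_adj, SimpleGraph.map_adj', - deleteEdges_adj]
  · tauto
  · tauto
  · exact fun h => h.ne

theorem eq_map_some_or_eq_insertNone (X : Finset (Option V)) :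
    ∃ Y : Finset V, X = Y.map .some ∨ X = insertNone Y := by
  classical
  refine ⟨eraseNone X, ?_⟩
  by_cases h : none ∈ X
  · right; rw [insertNone_eraseNone, insert_eq_of_mem h]
  · left; rw [map_some_eraseNone, erase_eq_of_notMem h]

theorem adjCount_addVertex_map (S : Set V) (Y : Finset V) :
    adjCount (addVertex G S) (Y.map .some) (Y.map .some) = adjCount G Y Y := by
  rw [adjCount_map]
  rfl

theorem adjCount_addVertex_insertNone (S : Set V) (Y : Finset V) :
    adjCount (addVertex G S) (insertNone Y) (insertNone Y) =
      adjCount G Y Y + 2 * adjCount (addVertex G S) {none} (Y.map .some) := by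
  classical
  have h : insertNone Y = insert none (Y.map .some) := by
    ext x; cases x <;> simp
  rw [h, adjCount_insert_self (by simp), adjCount_addVertex_map]

theorem isNode_addVertex {a b c : V} (hab : a ≠ b) (hac : a ≠ c) (hbc : b ≠ c) :
    IsNode (addVertex G {a, b, c}) none (some a) (some b) (some c) := by
  refine ⟨by simpa, by simpa, by simpa, ?_⟩
  ext x
  cases x <;> simp [mem_neighborSet]

theorem adjCount_addVertex_triple [DecidableEq V] {a b c : V} (hab : a ≠ b) (hac : a ≠ c)
    (hbc : b ≠ c) (Y : Finset V) :
    adjCount (addVertex G {a, b, c}) (insertNone Y) (insertNone Y) =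
      adjCount G Y Y + 2 * ((if a ∈ Y then 1 else 0) + (if b ∈ Y then 1 else 0) +
        (if c ∈ Y then 1 else 0)) := by
  rw [adjCount_addVertex_insertNone, (isNode_addVertex hab hac hbc).adjCount]
  simp

theorem adjCount_addVertex_pair [DecidableEq V] {a b : V} (hab : a ≠ b) (Y : Finset V) :
    adjCount (addVertex G {a, b}) (insertNone Y) (insertNone Y) =
      adjCount G Y Y + 2 * ((if a ∈ Y then 1 else 0) + (if b ∈ Y then 1 else 0)) := by
  rw [adjCount_addVertex_insertNone, adjCount_singleton_left, sum_map]
  have : ∀ x, adjInd (addVertex G {a, b}) none (some x) =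
      (if x = a then 1 else 0) + (if x = b then 1 else 0) := by
    intro x
    by_cases hx : x = a ∨ x = b
    · rw [adjInd_of_adj (by simpa using hx)]
      rcases hx with rfl | rfl <;> simp [hab, hab.symm]
    · rw [adjInd_of_not_adj (by simpa using hx)]
      push Not at hx
      simp [hx]
  simp only [Function.Embedding.some_apply, this, sum_add_distrib, sum_ite_eq']

/-- Counting in an image under a map that does not identify edges. -/
theorem adjCount_simpleGraph_map [Fintype V] [DecidableEq W] (f : V → W)
    (hne : ∀ u v, G.Adj u v → f u ≠ f v)
    (hinj : ∀ u v u' v', G.Adj u v → G.Adj u' v' → f u = f u' → f v = f v' → u = u' ∧ v = v')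
    (X Y : Finset W) : adjCount (G.map f) X Y =
      adjCount G {u | f u ∈ X} {v | f v ∈ Y} := by
  classical
  -- By `hinj`, an adjacent pair of the image comes from exactly one adjacent pair, so the inner
  -- double sum has a single nonzero term.
  have hpair : ∀ x y, adjInd (G.map f) x y =
      ∑ u with f u = x, ∑ v with f v = y, adjInd G u v := by
    intro x y
    by_cases h : (G.map f).Adj x y
    · rw [adjInd_of_adj h]
      obtain ⟨-, u, v, huv, rfl, rfl⟩ := h
      rw [sum_eq_single_of_mem u (by simp), sum_eq_single_of_mem v (by simp),
        adjInd_of_adj huv]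
      · intro v' hv' hne'
        refine adjInd_of_not_adj fun h => hne' ?_
        exact (hinj _ _ _ _ h huv rfl (by simpa using hv')).2
      · intro u' hu' hne'
        refine sum_eq_zero fun v' hv' => adjInd_of_not_adj fun h => hne' ?_
        exact (hinj _ _ _ _ h huv (by simpa using hu') (by simpa using hv')).1
    · rw [adjInd_of_not_adj h]
      refine (sum_eq_zero fun u hu => sum_eq_zero fun v hv => adjInd_of_not_adj fun huv => h ?_).symm
      simp at hu hv
      subst hu hv
      exact ⟨hne u v huv, u, v, huv, rfl, rfl⟩
  have hfib : ∀ (Z : Finset W) (g : V → ℤ),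
      ∑ x ∈ Z, ∑ u with f u = x, g u = ∑ u with f u ∈ Z, g u := by
    intro Z g
    rw [← sum_fiberwise_of_maps_to (s := {u | f u ∈ Z}) (t := Z) (g := f) (by simp)]
    refine sum_congr rfl fun x hx => sum_congr ?_ fun _ _ => rfl
    ext u
    simp only [mem_filter, mem_univ, true_and]
    constructor
    · rintro rfl; exact ⟨hx, rfl⟩
    · exact And.right
  unfold adjCount
  simp only [hpair]
  rw [← hfib]
  refine sum_congr rfl fun x _ => ?_
  rw [sum_comm]
  refine sum_congr rfl fun u _ => ?_
  rw [← hfib]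

end Modify

/-! ### Disjoint unions of circuits and the Henneberg 2 move -/

section Family
variable {V W : Type*} {ι κ : Type*} {G : SimpleGraph V} {H : SimpleGraph W}

variable (G) in
/-- `G` is a disjoint union of circuits, on the fibres of `c`. -/
def IsCircuitFamily (c : V → ι) : Prop :=
  (∀ x y, G.Adj x y → c x = c y) ∧
    ∀ (X : Finset V) (i : ι), X.Nonempty → (∀ x ∈ X, c x = i) →
      ((∃ y ∉ X, c y = i) → adjCount G X X ≤ 4 * #X - 4) ∧
      ((∀ y, c y = i → y ∈ X) → adjCount G X X = 4 * #X - 2)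

theorem Circ.isCircuitFamily [Fintype V] (hG : Circ G) :
    IsCircuitFamily G fun _ => PUnit.unit.{u + 1} := by
  refine ⟨fun _ _ _ => rfl, fun X i hX _ => ⟨fun ⟨y, hy, _⟩ => hG.2 X hX ?_, fun h => ?_⟩⟩
  · rintro rfl; simp at hy
  · have : X = univ := by rw [eq_univ_iff_forall]; exact fun y => h y rfl
    rw [this, hG.1, card_univ]

namespace IsCircuitFamily
variable {c : V → ι} {d : W → κ}

theorem adjCount_le (h : IsCircuitFamily G c) {X : Finset V} {i : ι} (hX : X.Nonempty)
    (hi : ∀ x ∈ X, c x = i) : adjCount G X X ≤ 4 * #X - 2 := by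
  by_cases hy : ∃ y ∉ X, c y = i
  · have := (h.2 X i hX hi).1 hy; omega
  · push Not at hy
    have := (h.2 X i hX hi).2 fun y hy' => by by_contra h; exact hy y h hy'
    omega

theorem eq_of_reachable (h : IsCircuitFamily G c) {x y : V} (hxy : G.Reachable x y) :
    c x = c y := by
  obtain ⟨p⟩ := hxy
  induction p with
  | nil => rfl
  | cons hadj _ ih => exact (h.1 _ _ hadj).trans ih

/-- A disconnected fibre would split into two proper parts `A` and `B` without edges between them,
giving at most `4|A| + 4|B| - 8`, which is short of `4|A ∪ B| - 2`. -/
theorem reachable_of_eq [Finite V] (h : IsCircuitFamily G c) {x y : V} (hxy : c x = c y) :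
    G.Reachable x y := by
  classical
  have := Fintype.ofFinite V
  by_contra hn
  let A : Finset V := {z | c z = c x ∧ G.Reachable x z}
  let B : Finset V := {z | c z = c x ∧ ¬ G.Reachable x z}
  have hxA : x ∈ A := by simp [A]
  have hyB : y ∈ B := by simp [B, hxy, hn]
  have hd : Disjoint A B := by
    rw [Finset.disjoint_left]; intro z hz hz'; simp [A, B] at hz hz'; tauto
  have h1 := (h.2 A (c x) ⟨x, hxA⟩ (by simp [A]; tauto)).1 ⟨y, by simp [A, hn], hxy.symm⟩
  have h2 := (h.2 B (c x) ⟨y, hyB⟩ (by simp [B]; tauto)).1 ⟨x, by simp [B], rfl⟩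
  have h3 := (h.2 (A ∪ B) (c x) ⟨x, mem_union_left _ hxA⟩ (by simp [A, B]; tauto)).2
    (by simp [A, B]; tauto)
  have h4 : adjCount G A B = 0 := by
    rw [adjCount_eq_zero_iff]
    intro a ha b hb hab
    simp [A, B] at ha hb
    exact hb.2 (ha.2.trans hab.reachable)
  rw [adjCount_union_self hd, card_union_of_disjoint hd, h4] at h3
  push_cast at h3
  omega

theorem circ_of_connected [Fintype V] (h : IsCircuitFamily G c) (hG : G.Connected) : Circ G := by
  obtain ⟨x⟩ := hG.nonempty
  have hc : ∀ y, c y = c x := fun y => h.eq_of_reachable (hG.preconnected y x)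
  refine ⟨?_, fun X hX hX' => (h.2 X (c x) hX fun y _ => hc y).1 ?_⟩
  · rw [← card_univ]
    exact (h.2 univ (c x) ⟨x, mem_univ x⟩ fun y _ => hc y).2 fun y _ => mem_univ y
  · by_contra! hy
    exact hX' (eq_univ_iff_forall.2 fun y => by by_contra h'; exact hy y h' (hc y))

theorem iso (h : IsCircuitFamily G c) (e : G ≃g H) : IsCircuitFamily H (c ∘ e.symm) := by
  refine ⟨fun x y hxy => h.1 _ _ (e.symm.map_rel_iff.2 hxy), fun X i hX hi => ?_⟩
  have hm : ∀ x, x ∈ X.map e.symm.toEquiv.toEmbedding ↔ e x ∈ X := fun x => mem_map_equiv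
  have h1 := h.2 (X.map e.symm.toEquiv.toEmbedding) i (by simpa using hX)
    fun x hx => by simpa using hi (e x) ((hm x).1 hx)
  rw [adjCount_map, card_map] at h1
  have h2 : G.comap e.symm.toEquiv.toEmbedding = H := by
    ext x y; exact e.symm.map_rel_iff
  rw [h2] at h1
  refine ⟨fun ⟨y, hy, hy'⟩ => h1.1 ⟨e.symm y, ?_, hy'⟩, fun h' => h1.2 fun y hy => ?_⟩
  · rw [hm]; simpa using hy
  · rw [hm]; exact h' (e y) (by simpa using hy)

theorem sum (h : IsCircuitFamily G c) (h' : IsCircuitFamily H d) :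
    IsCircuitFamily (G ⊕g H) (Sum.map c d) := by
  classical
  refine ⟨?_, fun X i hX hi => ?_⟩
  · rintro (x | x) (y | y) hxy
    · simp [h.1 x y (by simpa using hxy)]
    · simp at hxy
    · simp at hxy
    · simp [h'.1 x y (by simpa using hxy)]
  · rcases i with i | i
    · obtain ⟨Y, rfl⟩ : ∃ Y : Finset V, X = Y.map .inl := by
        refine ⟨X.toLeft, ?_⟩
        ext (x | x)
        · simp
        · simpa using fun hx => by simpa using hi _ hx
      rw [adjCount_map, card_map]
      have h2 : (G ⊕g H).comap (Function.Embedding.inl : V ↪ V ⊕ W) = G := by ext x y; simp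
      rw [h2]
      have h1 := h.2 Y i (by simpa using hX) (by simpa using hi)
      refine ⟨fun ⟨y, hy, hy'⟩ => h1.1 ?_, fun h' => h1.2 fun y hy => ?_⟩
      · rcases y with y | y
        · exact ⟨y, by simpa using hy, by simpa using hy'⟩
        · simp at hy'
      · simpa using h' (Sum.inl y) (by simpa using hy)
    · obtain ⟨Y, rfl⟩ : ∃ Y : Finset W, X = Y.map .inr := by
        refine ⟨X.toRight, ?_⟩
        ext (x | x)
        · simpa using fun hx => by simpa using hi _ hx
        · simp
      rw [adjCount_map, card_map]
      have h2 : (G ⊕g H).comap (Function.Embedding.inr : W ↪ V ⊕ W) = H := by ext x y; simp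
      rw [h2]
      have h1 := h'.2 Y i (by simpa using hX) (by simpa using hi)
      refine ⟨fun ⟨y, hy, hy'⟩ => h1.1 ?_, fun h' => h1.2 fun y hy => ?_⟩
      · rcases y with y | y
        · simp at hy'
        · exact ⟨y, by simpa using hy, by simpa using hy'⟩
      · simpa using h' (Sum.inr y) (by simpa using hy)

/-- The new vertex adds at most four to the count of a nonempty set: it adds six only if `u, w, z`
are all present, and then the lost edge `uw` takes two away. -/
theorem hennebergTwo (h : IsCircuitFamily G c) {u w z : V} (huw : G.Adj u w) (hzu : z ≠ u)
    (hzw : z ≠ w) (hz : c u = c z) :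
    IsCircuitFamily (SimpleTwoTwo.hennebergTwo G u w z) fun o => o.elim (c u) c := by
  classical
  rw [hennebergTwo_eq_addVertex]
  have hcw := h.1 u w huw
  refine ⟨?_, fun X i hX hi => ?_⟩
  · rintro (_ | x) (_ | y) hxy
    · rfl
    · simp at hxy ⊢; rcases hxy with rfl | rfl | rfl <;> first | rfl | assumption
    · simp at hxy ⊢; rcases hxy with rfl | rfl | rfl <;> first | rfl | (symm; assumption)
    · exact h.1 x y hxy.1
  · obtain ⟨Y, rfl | rfl⟩ := eq_map_some_or_eq_insertNone X
    · rw [adjCount_addVertex_map, adjCount_deleteEdge huw, card_map]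
      have hY : Y.Nonempty := by simpa using hX
      have hYi : ∀ y ∈ Y, c y = i := by simpa using hi
      have h1 := h.2 Y i hY hYi
      have hle := h.adjCount_le hY hYi
      refine ⟨fun ⟨y, hy, hy'⟩ => ?_, fun h' => ?_⟩
      -- A set of old vertices may now be a whole old fibre, with count `4#Y - 2`; but then it
      -- contains `u` and `w` and has lost an edge.
      · split_ifs with hif
        · omega
        · rw [sub_zero]
          refine h1.1 ?_
          rcases y with _ | y
          · simp at hy'
            by_cases hu : u ∈ Y
            · exact ⟨w, by tauto, by rw [← hcw, hy']⟩
            · exact ⟨u, hu, hy'⟩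
          · exact ⟨y, by simpa using hy, by simpa using hy'⟩
      · have hne : c u ≠ i := fun hc => by simpa using h' none (by simpa using hc)
        have hu : u ∉ Y := fun hu => hne (hYi u hu)
        simp only [hu, false_and, if_false, sub_zero]
        exact h1.2 fun y hy => by simpa using h' (some y) (by simpa using hy)
    · rw [adjCount_addVertex_triple huw.ne hzu.symm hzw.symm, adjCount_deleteEdge huw,
        card_insertNone]
      have hi0 : c u = i := by simpa using hi none (by simp)
      have hYi : ∀ y ∈ Y, c y = i := fun y hy => by simpa using hi (some y) (by simpa using hy)
      push_cast
      rcases Y.eq_empty_or_nonempty with rfl | hY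
      · refine ⟨fun _ => by simp, fun h' => ?_⟩
        have := h' (some u) hi0
        simp at this
      · have h1 := h.2 Y i hY hYi
        refine ⟨fun ⟨y, hy, hy'⟩ => ?_, fun h' => ?_⟩
        · have h2 := h1.1 (by
            rcases y with _ | y
            · simp at hy
            · exact ⟨y, by simpa using hy, by simpa using hy'⟩)
          split_ifs <;> first | omega | tauto
        · have hall : ∀ y, c y = i → y ∈ Y := fun y hy => by
            simpa using h' (some y) (by simpa using hy)
          have h2 := h1.2 hall
          have hu := hall u hi0
          have hw := hall w (by rw [← hcw, hi0])
          have hz' := hall z (by rw [← hz, hi0])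
          simp only [hu, hw, hz', and_self, if_true]
          omega

end IsCircuitFamily
end Family

/-! ### Merging fibres and the 3-sum -/

section Sums
variable {V : Type*} {ι : Type*} {G : SimpleGraph V} {c : V → ι}

/-- The two fibres `i` and `j` are merged. -/
noncomputable def mergeFibre (c : V → ι) (i j : ι) (x : V) : ι :=
  open Classical in if c x = j then i else c x

theorem mergeFibre_eq_left {i j : ι} {x : V} :
    mergeFibre c i j x = i ↔ c x = i ∨ c x = j := by
  unfold mergeFibre; split_ifs <;> simp_all

theorem mergeFibre_eq_of_ne {i j k : ι} (hk : k ≠ i) {x : V} :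
    mergeFibre c i j x = k ↔ c x = k ∧ k ≠ j := by
  unfold mergeFibre; split_ifs with h
  · subst h; simp only [hk.symm, ne_eq, false_iff]; tauto
  · constructor
    · rintro rfl; exact ⟨rfl, h⟩
    · exact And.left

theorem three_ite_le {p q r : Prop} [Decidable p] [Decidable q] [Decidable r]
    (h : ¬ (p ∧ q ∧ r)) :
    (if p then 2 else 0) + (if q then 2 else 0) + (if r then 2 else 0) ≤ (4 : ℤ) := by
  split_ifs <;> first | (norm_num; done) | tauto

theorem adjCount_induce (H : SimpleGraph V) (D : Set V) (X : Finset (Dᶜ : Set V)) :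
    adjCount (H.induce Dᶜ) X X = adjCount H (X.map (.subtype _)) (X.map (.subtype _)) := by
  rw [adjCount_map]

theorem adjCount_union_of_fibre [DecidableEq V] (hc : ∀ x y, G.Adj x y → c x = c y)
    {X Y : Finset V} {i j : ι} (hij : i ≠ j) (hX : ∀ x ∈ X, c x = i) (hY : ∀ y ∈ Y, c y = j) :
    adjCount G (X ∪ Y) (X ∪ Y) = adjCount G X X + adjCount G Y Y ∧
      #(X ∪ Y) = #X + #Y := by
  have hd : Disjoint X Y := by
    rw [Finset.disjoint_left]; intro x hx hx'; exact hij ((hX x hx).symm.trans (hY x hx'))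
  have h0 : adjCount G X Y = 0 := by
    rw [adjCount_eq_zero_iff]
    intro x hx y hy hxy
    exact hij ((hX x hx).symm.trans ((hc x y hxy).trans (hY y hy)))
  rw [adjCount_union_self hd, card_union_of_disjoint hd, h0]
  simp

namespace IsCircuitFamily

/-- The bounds for the part of a 3-sum on one side. -/
theorem node_side [DecidableEq V] (h : IsCircuitFamily G c) {v a b d : V} (hv : IsNode G v a b d)
    {Y : Finset V} (hY : Y.Nonempty) (hYc : ∀ y ∈ Y, c y = c v) (hvY : v ∉ Y) :
    adjCount G Y Y ≤ 4 * #Y - 4 ∧ (a ∈ Y → b ∈ Y → d ∈ Y →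
      ((∃ y ∉ Y, y ≠ v ∧ c y = c v) → adjCount G Y Y ≤ 4 * #Y - 6) ∧
      ((∀ y, c y = c v → y ≠ v → y ∈ Y) → adjCount G Y Y = 4 * #Y - 4)) := by
  refine ⟨(h.2 Y _ hY hYc).1 ⟨v, hvY, rfl⟩, fun ha hb hd => ?_⟩
  have h1 := h.2 (insert v Y) (c v) (insert_nonempty _ _) (by simpa using hYc)
  rw [adjCount_insert_self hvY, card_insert_of_notMem hvY, hv.adjCount] at h1
  simp only [ha, hb, hd, if_true] at h1
  push_cast at h1
  refine ⟨fun ⟨y, hy, hyv, hyc⟩ => ?_, fun hall => ?_⟩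
  · have := h1.1 ⟨y, by simp [hy, hyv], hyc⟩; omega
  · have := h1.2 fun y hy => by
      by_cases hyv : y = v
      · simp [hyv]
      · exact mem_insert_of_mem (hall y hy hyv)
    omega

/-- Without its node, a side has slack 4 below `4|Y|`, or at least 6 when it contains all three
neighbours but not everything. The three new edges add six, so the full set has slack `4 + 4 - 6 =
2` and proper sets keep slack 4. -/
theorem threeSum (h : IsCircuitFamily G c) {v₁ a₁ b₁ c₁ v₂ a₂ b₂ c₂ : V}
    (h₁ : IsNode G v₁ a₁ b₁ c₁) (h₂ : IsNode G v₂ a₂ b₂ c₂) (hne : c v₁ ≠ c v₂) :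
    IsCircuitFamily (SimpleTwoTwo.threeSum G v₁ a₁ b₁ c₁ v₂ a₂ b₂ c₂)
      fun x => mergeFibre c (c v₁) (c v₂) x := by
  classical
  have ca₁ := h.1 _ _ ((h₁.adj_iff a₁).2 (by simp))
  have cb₁ := h.1 _ _ ((h₁.adj_iff b₁).2 (by simp))
  have cc₁ := h.1 _ _ ((h₁.adj_iff c₁).2 (by simp))
  have ca₂ := h.1 _ _ ((h₂.adj_iff a₂).2 (by simp))
  have cb₂ := h.1 _ _ ((h₂.adj_iff b₂).2 (by simp))
  have cc₂ := h.1 _ _ ((h₂.adj_iff c₂).2 (by simp))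
  have hcross : ∀ x y, c v₁ = c x → c v₂ = c y → x ≠ y ∧ ¬ G.Adj x y := by
    intro x y hx hy
    refine ⟨?_, fun hxy => hne (by rw [hx, hy, h.1 x y hxy])⟩
    rintro rfl; exact hne (hx.trans hy.symm)
  have hcount : ∀ X : Finset V, adjCount
      (G ⊔ edge a₁ a₂ ⊔ edge b₁ b₂ ⊔ edge c₁ c₂) X X = adjCount G X X +
      (if a₁ ∈ X ∧ a₂ ∈ X then 2 else 0) + (if b₁ ∈ X ∧ b₂ ∈ X then 2 else 0) +
      (if c₁ ∈ X ∧ c₂ ∈ X then 2 else 0) := by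
    intro X
    have hA := hcross a₁ a₂ ca₁ ca₂
    have hB := hcross b₁ b₂ cb₁ cb₂
    have hC := hcross c₁ c₂ cc₁ cc₂
    have ab := h₁.1
    have ac := h₁.2.1
    have bc := h₁.2.2.1
    have ab' := (hcross b₁ a₂ cb₁ ca₂).1
    have ac' := (hcross c₁ a₂ cc₁ ca₂).1
    have bc' := (hcross c₁ b₂ cc₁ cb₂).1
    rw [adjCount_sup_edge hC.1, adjCount_sup_edge hB.1, adjCount_sup_edge hA.1 hA.2]
    · simp [edge_adj, hB.2, ab.symm, ab']
    · simp [edge_adj, hC.2, ac.symm, ac', bc.symm, bc']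
  unfold SimpleTwoTwo.threeSum
  refine ⟨?_, fun X i hX hi => ?_⟩
  · rintro ⟨x, hx⟩ ⟨y, hy⟩ hxy
    change mergeFibre c (c v₁) (c v₂) x = mergeFibre c (c v₁) (c v₂) y
    simp only [comap_adj, Function.Embedding.subtype_apply, sup_adj, edge_adj] at hxy
    have hm₁ : ∀ z, c v₁ = c z → mergeFibre c (c v₁) (c v₂) z = c v₁ := fun z hz =>
      mergeFibre_eq_left.2 (Or.inl hz.symm)
    have hm₂ : ∀ z, c v₂ = c z → mergeFibre c (c v₁) (c v₂) z = c v₁ := fun z hz =>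
      mergeFibre_eq_left.2 (Or.inr hz.symm)
    rcases hxy with ((hxy | hxy) | hxy) | hxy
    · simp only [mergeFibre, h.1 x y hxy]
    all_goals
      rcases hxy with ⟨⟨rfl, rfl⟩ | ⟨rfl, rfl⟩, -⟩
      · rw [hm₁ _ (by assumption), hm₂ _ (by assumption)]
      · rw [hm₂ _ (by assumption), hm₁ _ (by assumption)]
  · rw [adjCount_induce, hcount]
    obtain ⟨Z, hZ⟩ : ∃ Z, Z = X.map (.subtype _) := ⟨_, rfl⟩
    have hcard : #X = #Z := by rw [hZ, card_map]
    have hZm : ∀ x, x ∈ Z → mergeFibre c (c v₁) (c v₂) x = i ∧ x ≠ v₁ ∧ x ≠ v₂ := by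
      intro x hx
      rw [hZ] at hx
      obtain ⟨⟨y, hy⟩, hyX, rfl⟩ := mem_map.1 hx
      exact ⟨hi _ hyX, by simpa using hy⟩
    have hmem : ∀ y (hy : y ∈ ({v₁, v₂}ᶜ : Set V)), y ∈ Z ↔ (⟨y, hy⟩ : ({v₁, v₂}ᶜ : Set V)) ∈ X := by
      intro y hy
      rw [hZ]; simp at hy ⊢; tauto
    have hZne : Z.Nonempty := by rw [hZ]; simpa using hX
    rw [← hZ, hcard]
    by_cases hi1 : i = c v₁
    · let Y₁ : Finset V := {x ∈ Z | c x = c v₁}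
      let Y₂ : Finset V := {x ∈ Z | c x = c v₂}
      have hU : Z = Y₁ ∪ Y₂ := by
        ext x
        simp only [Y₁, Y₂, mem_union, mem_filter]
        constructor
        · intro hx
          have := (hZm x hx).1
          rw [hi1, mergeFibre_eq_left] at this
          tauto
        · tauto
      have hY₁ : ∀ x ∈ Y₁, c x = c v₁ := by simp [Y₁]
      have hY₂ : ∀ x ∈ Y₂, c x = c v₂ := by simp [Y₂]
      have hv₁ : v₁ ∉ Y₁ := fun h => (hZm v₁ (mem_filter.1 h).1).2.1 rfl
      have hv₂ : v₂ ∉ Y₂ := fun h => (hZm v₂ (mem_filter.1 h).1).2.2 rfl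
      obtain ⟨hadd, hcadd⟩ := adjCount_union_of_fibre h.1 hne hY₁ hY₂
      rw [← hU] at hadd hcadd
      rw [hadd, hcadd]
      have m₁ : ∀ x, c v₁ = c x → (x ∈ Z ↔ x ∈ Y₁) := fun x hx => by simp [Y₁, hx]
      have m₂ : ∀ x, c v₂ = c x → (x ∈ Z ↔ x ∈ Y₂) := fun x hx => by simp [Y₂, hx]
      simp only [m₁ a₁ ca₁, m₁ b₁ cb₁, m₁ c₁ cc₁, m₂ a₂ ca₂, m₂ b₂ cb₂, m₂ c₂ cc₂]
      have s₁ := fun hne => h.node_side h₁ (Y := Y₁) hne hY₁ hv₁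
      have s₂ := fun hne => h.node_side h₂ (Y := Y₂) hne hY₂ hv₂
      have full₁ : (∀ y, mergeFibre c (c v₁) (c v₂) y = i → y ≠ v₁ → y ≠ v₂ → y ∈ Z) →
          ∀ y, c y = c v₁ → y ≠ v₁ → y ∈ Y₁ := by
        intro hall y hy hyv
        rw [← m₁ y hy.symm]
        refine hall y (by rw [hi1, mergeFibre_eq_left]; exact Or.inl hy) hyv ?_
        rintro rfl; exact hne hy.symm
      have full₂ : (∀ y, mergeFibre c (c v₁) (c v₂) y = i → y ≠ v₁ → y ≠ v₂ → y ∈ Z) →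
          ∀ y, c y = c v₂ → y ≠ v₂ → y ∈ Y₂ := by
        intro hall y hy hyv
        rw [← m₂ y hy.symm]
        refine hall y (by rw [hi1, mergeFibre_eq_left]; exact Or.inr hy) ?_ hyv
        rintro rfl; exact hne hy
      have hnv : ∀ {v a : V}, G.Adj v a → a ≠ v := fun h => h.ne'
      have va₁ := hnv ((h₁.adj_iff a₁).2 (by simp))
      have vb₁ := hnv ((h₁.adj_iff b₁).2 (by simp))
      have vc₁ := hnv ((h₁.adj_iff c₁).2 (by simp))
      have va₂ := hnv ((h₂.adj_iff a₂).2 (by simp))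
      have vb₂ := hnv ((h₂.adj_iff b₂).2 (by simp))
      have vc₂ := hnv ((h₂.adj_iff c₂).2 (by simp))
      refine ⟨fun ⟨⟨y, hyD⟩, hyX, hyi⟩ => ?_, fun hall => ?_⟩
      · have hyZ : y ∉ Z := by rwa [hmem y hyD]
        have hyv : y ≠ v₁ ∧ y ≠ v₂ := by simpa using hyD
        have hyc : c y = c v₁ ∨ c y = c v₂ := by
          rw [← mergeFibre_eq_left]; exact hyi.trans hi1
        rcases Y₁.eq_empty_or_nonempty with hE₁ | hN₁
        · rcases Y₂.eq_empty_or_nonempty with hE₂ | hN₂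
          · rw [hE₁, hE₂, union_empty] at hU
            exact absurd hU hZne.ne_empty
          · have := (s₂ hN₂).1
            simp only [hE₁]
            simp
            omega
        · rcases Y₂.eq_empty_or_nonempty with hE₂ | hN₂
          · have := (s₁ hN₁).1
            simp only [hE₂]
            simp
            omega
          · have t₁ := (s₁ hN₁).1
            have t₂ := (s₂ hN₂).1
            -- With all new edges present the incomplete side must use its stronger bound; at most
            -- two new edges add only four, which the general bounds absorb.
            by_cases hall : (a₁ ∈ Y₁ ∧ a₂ ∈ Y₂) ∧ (b₁ ∈ Y₁ ∧ b₂ ∈ Y₂) ∧ (c₁ ∈ Y₁ ∧ c₂ ∈ Y₂)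
            · simp only [hall, and_self, if_true]
              rcases hyc with hyc | hyc
              · have := ((s₁ hN₁).2 hall.1.1 hall.2.1.1 hall.2.2.1).1
                  ⟨y, by rwa [← m₁ y hyc.symm], hyv.1, hyc⟩
                push_cast; omega
              · have := ((s₂ hN₂).2 hall.1.2 hall.2.1.2 hall.2.2.2).1
                  ⟨y, by rwa [← m₂ y hyc.symm], hyv.2, hyc⟩
                push_cast; omega
            · have := three_ite_le hall
              push_cast
              omega
      · have hall' : ∀ y, mergeFibre c (c v₁) (c v₂) y = i → y ≠ v₁ → y ≠ v₂ → y ∈ Z :=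
          fun y hy h1 h2 => (hmem y (by simp [h1, h2])).2 (hall ⟨y, by simp [h1, h2]⟩ hy)
        have f₁ := full₁ hall'
        have f₂ := full₂ hall'
        have ma₁ := f₁ a₁ ca₁.symm va₁
        have mb₁ := f₁ b₁ cb₁.symm vb₁
        have mc₁ := f₁ c₁ cc₁.symm vc₁
        have ma₂ := f₂ a₂ ca₂.symm va₂
        have mb₂ := f₂ b₂ cb₂.symm vb₂
        have mc₂ := f₂ c₂ cc₂.symm vc₂
        have t₁ := ((s₁ ⟨_, ma₁⟩).2 ma₁ mb₁ mc₁).2 f₁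
        have t₂ := ((s₂ ⟨_, ma₂⟩).2 ma₂ mb₂ mc₂).2 f₂
        simp only [ma₁, mb₁, mc₁, ma₂, mb₂, mc₂, and_self, if_true]
        push_cast
        omega
    · have hZi : ∀ x ∈ Z, c x = i ∧ i ≠ c v₂ := fun x hx =>
        (mergeFibre_eq_of_ne hi1).1 (hZm x hx).1
      have hn : ∀ x, c v₁ = c x → x ∉ Z := fun x hx hxZ =>
        hi1 ((hZi x hxZ).1.symm.trans hx.symm)
      simp only [hn _ ca₁, hn _ cb₁, hn _ cc₁, false_and, if_false, add_zero]
      have h2 := h.2 Z i hZne fun x hx => (hZi x hx).1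
      have hi2 : i ≠ c v₂ := (hZi _ hZne.choose_spec).2
      refine ⟨fun ⟨⟨y, hyD⟩, hyX, hyi⟩ => h2.1 ⟨y, ?_, ?_⟩, fun hall => h2.2 fun y hy => ?_⟩
      · rwa [hmem y hyD]
      · exact ((mergeFibre_eq_of_ne hi1).1 hyi).1
      · have hyD : y ∈ ({v₁, v₂}ᶜ : Set V) := by
          simp only [Set.mem_compl_iff, Set.mem_insert_iff, Set.mem_singleton_iff, not_or]
          constructor
          · rintro rfl; exact hi1 hy.symm
          · rintro rfl; exact hi2 hy.symm
        exact (hmem y hyD).2 (hall ⟨y, hyD⟩ ((mergeFibre_eq_of_ne hi1).2 ⟨hy, hi2⟩))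

end IsCircuitFamily
end Sums

/-! ### Identifying two pairs of vertices -/

section Glue
variable {V : Type*} {ι : Type*} {G : SimpleGraph V} {c : V → ι}

theorem two_ite_le {p q : Prop} [Decidable p] [Decidable q] (h : ¬ (p ∧ q)) :
    (if p then 1 else 0) + (if q then 1 else 0) ≤ (1 : ℤ) := by
  split_ifs <;> first | (norm_num; done) | tauto

theorem glue_left {a₁ b₁ a₂ b₂ : V} (h : a₂ ≠ b₂) : glue a₁ b₁ a₂ b₂ a₂ = a₁ := by
  simp [glue, h]

theorem glue_right {a₁ b₁ a₂ b₂ : V} : glue a₁ b₁ a₂ b₂ b₂ = b₁ := by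
  simp [glue]

theorem glue_of_ne {a₁ b₁ a₂ b₂ x : V} (ha : x ≠ a₂) (hb : x ≠ b₂) :
    glue a₁ b₁ a₂ b₂ x = x := by
  simp [glue, ha, hb]

theorem eq_or_of_glue_eq {a₁ b₁ a₂ b₂ u v : V} (hn₁ : a₁ ≠ b₁) (hn₂ : a₂ ≠ b₂)
    (h : glue a₁ b₁ a₂ b₂ u = glue a₁ b₁ a₂ b₂ v) : u = v ∨
      (u = a₁ ∧ v = a₂) ∨ (u = a₂ ∧ v = a₁) ∨ (u = b₁ ∧ v = b₂) ∨ (u = b₂ ∧ v = b₁) := by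
  have hcases : ∀ u, (u = a₂ ∧ glue a₁ b₁ a₂ b₂ u = a₁) ∨ (u = b₂ ∧ glue a₁ b₁ a₂ b₂ u = b₁) ∨
      glue a₁ b₁ a₂ b₂ u = u := by
    intro u
    by_cases ha : u = a₂
    · subst ha; exact Or.inl ⟨rfl, glue_left hn₂⟩
    · by_cases hb : u = b₂
      · subst hb; exact Or.inr (Or.inl ⟨rfl, glue_right⟩)
      · exact Or.inr (Or.inr (glue_of_ne ha hb))
  have hu := hcases u
  have hv := hcases v
  grind

theorem mergeFibre_glue {a₁ b₁ a₂ b₂ : V} (hab : c a₁ = c b₁) (hab' : c a₂ = c b₂)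
    (hn : a₂ ≠ b₂) (x : V) :
    mergeFibre c (c a₁) (c a₂) (glue a₁ b₁ a₂ b₂ x) = mergeFibre c (c a₁) (c a₂) x := by
  by_cases ha : x = a₂
  · subst ha
    rw [glue_left hn, mergeFibre_eq_left.2 (Or.inl rfl), mergeFibre_eq_left.2 (Or.inr rfl)]
  · by_cases hb : x = b₂
    · subst hb
      rw [glue_right, mergeFibre_eq_left.2 (Or.inl hab.symm),
        mergeFibre_eq_left.2 (Or.inr hab'.symm)]
    · rw [glue_of_ne ha hb]

set_option maxHeartbeats 1000000 in
/-- Two fibres whose bounds are tight enough are glued to one circuit. -/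
theorem isCircuitFamily_glue [Fintype V] {D : Set V} {a₁ b₁ a₂ b₂ : V}
    (hc : ∀ x y, G.Adj x y → c x = c y) (hab : c a₁ = c b₁) (hab' : c a₂ = c b₂)
    (hne : c a₁ ≠ c a₂) (hn₁ : a₁ ≠ b₁) (hn₂ : a₂ ≠ b₂) (hadj : ¬ G.Adj a₂ b₂)
    (ha₁ : a₁ ∉ D) (hb₁ : b₁ ∉ D) (ha₂ : a₂ ∈ D) (hb₂ : b₂ ∈ D)
    (hD : ∀ x ∈ D, c x = c a₁ ∨ c x = c a₂)
    (h₀ : ∀ (X : Finset V) (i : ι), X.Nonempty → i ≠ c a₁ → i ≠ c a₂ → (∀ x ∈ X, c x = i) →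
      ((∃ y ∉ X, c y = i) → adjCount G X X ≤ 4 * #X - 4) ∧
      ((∀ y, c y = i → y ∈ X) → adjCount G X X = 4 * #X - 2))
    (h₁ : ∀ Y : Finset V, Y.Nonempty → (∀ y ∈ Y, c y = c a₁ ∧ y ∉ D) →
      adjCount G Y Y ≤ 4 * #Y - 4 ∧ (a₁ ∈ Y → b₁ ∈ Y →
        ((∃ y ∉ Y, y ∉ D ∧ c y = c a₁) → adjCount G Y Y ≤ 4 * #Y - 6) ∧
        ((∀ y ∉ D, c y = c a₁ → y ∈ Y) → adjCount G Y Y = 4 * #Y - 4)))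
    (h₂ : ∀ Y : Finset V, Y.Nonempty → (∀ y ∈ Y, c y = c a₂ ∧ (y ∈ D → y = a₂ ∨ y = b₂)) →
      adjCount G Y Y ≤ 4 * #Y - 4 ∧ (a₂ ∈ Y → b₂ ∈ Y →
        ((∃ y ∉ Y, y ∉ D ∧ c y = c a₂) → adjCount G Y Y ≤ 4 * #Y - 8) ∧
        ((∀ y ∉ D, c y = c a₂ → y ∈ Y) → adjCount G Y Y = 4 * #Y - 6))) :
    IsCircuitFamily ((G.map (glue a₁ b₁ a₂ b₂)).induce Dᶜ)
      fun x => mergeFibre c (c a₁) (c a₂) x := by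
  classical
  have hg := mergeFibre_glue hab hab' hn₂
  have ncases := fun u v => eq_or_of_glue_eq (u := u) (v := v) hn₁ hn₂
  have hnab : ∀ u v, G.Adj u v → glue a₁ b₁ a₂ b₂ u ≠ glue a₁ b₁ a₂ b₂ v := by
    intro u v huv h
    have h1 := hc u v huv
    rcases ncases u v h with rfl | ⟨rfl, rfl⟩ | ⟨rfl, rfl⟩ | ⟨rfl, rfl⟩ | ⟨rfl, rfl⟩
    · exact huv.ne rfl
    · exact hne h1
    · exact hne h1.symm
    · exact hne (hab.trans (h1.trans hab'.symm))
    · exact hne (hab.trans (h1.symm.trans hab'.symm))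
  have hadj' : ¬ G.Adj b₂ a₂ := fun h => hadj h.symm
  have hinj : ∀ u v u' v', G.Adj u v → G.Adj u' v' → glue a₁ b₁ a₂ b₂ u = glue a₁ b₁ a₂ b₂ u' →
      glue a₁ b₁ a₂ b₂ v = glue a₁ b₁ a₂ b₂ v' → u = u' ∧ v = v' := by
    intro u v u' v' huv huv' hu hv
    have h1 := hc u v huv
    have h2 := hc u' v' huv'
    have hcne : ∀ x y, glue a₁ b₁ a₂ b₂ x = glue a₁ b₁ a₂ b₂ y → c x = c y → x = y := by
      intro x y h hxy
      rcases ncases x y h with rfl | ⟨rfl, rfl⟩ | ⟨rfl, rfl⟩ | ⟨rfl, rfl⟩ | ⟨rfl, rfl⟩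
      · rfl
      · exact absurd hxy hne
      · exact absurd hxy.symm hne
      · exact absurd (hab.trans (hxy.trans hab'.symm)) hne
      · exact absurd (hab.trans (hxy.symm.trans hab'.symm)) hne
    by_cases huu : u = u'
    · subst huu
      exact ⟨rfl, hcne v v' hv (h1.symm.trans h2)⟩
    · have hvv : v ≠ v' := by
        rintro rfl
        exact huu (hcne u u' hu (h1.trans h2.symm))
      have h3 := huv.ne
      have h4 := huv'.ne
      -- Two different edges with the same image would have both ends merged; then one of them is
      -- `a₂b₂`, which is not an edge, or joins the two fibres.
      exfalso
      have cu := (ncases u u' hu).resolve_left huu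
      have cv := (ncases v v' hv).resolve_left hvv
      clear hu hv hnab ncases hcne hg h₀ h₁ h₂ hD hc
      rcases cu with ⟨e, e'⟩ | ⟨e, e'⟩ | ⟨e, e'⟩ | ⟨e, e'⟩ <;>
        rcases cv with ⟨f, f'⟩ | ⟨f, f'⟩ | ⟨f, f'⟩ | ⟨f, f'⟩ <;> subst e e' f f' <;>
        first | exact h3 rfl | exact hadj huv | exact hadj huv' | exact hadj' huv |
          exact hadj' huv' | grind
  refine ⟨?_, fun X i hX hi => ?_⟩
  · rintro ⟨x, hx⟩ ⟨y, hy⟩ hxy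
    obtain ⟨-, u, v, huv, hu, hv⟩ := hxy
    change glue a₁ b₁ a₂ b₂ u = x at hu
    change glue a₁ b₁ a₂ b₂ v = y at hv
    change mergeFibre c (c a₁) (c a₂) x = mergeFibre c (c a₁) (c a₂) y
    rw [← hu, ← hv, hg, hg]
    simp only [mergeFibre, hc u v huv]
  · rw [adjCount_induce, adjCount_simpleGraph_map _ hnab hinj]
    obtain ⟨Z, hZ⟩ : ∃ Z, Z = X.map (.subtype _) := ⟨_, rfl⟩
    have hcard : #X = #Z := by rw [hZ, card_map]
    have hZm : ∀ x, x ∈ Z → mergeFibre c (c a₁) (c a₂) x = i ∧ x ∉ D := by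
      intro x hx
      rw [hZ] at hx
      obtain ⟨⟨y, hy⟩, hyX, rfl⟩ := mem_map.1 hx
      exact ⟨hi _ hyX, by simpa using hy⟩
    have hmem : ∀ y (hy : y ∈ Dᶜ), y ∈ Z ↔ (⟨y, hy⟩ : (Dᶜ : Set V)) ∈ X := by
      intro y hy
      rw [hZ]; simp at hy ⊢; tauto
    have hZne : Z.Nonempty := by rw [hZ]; simpa using hX
    rw [← hZ, hcard]
    have haZ : a₂ ∉ Z := fun h => (hZm _ h).2 ha₂
    have hbZ : b₂ ∉ Z := fun h => (hZm _ h).2 hb₂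
    obtain ⟨T, hT⟩ : ∃ T : Finset V, T = univ.filter fun u => glue a₁ b₁ a₂ b₂ u ∈ Z :=
      ⟨_, rfl⟩
    have hTm : ∀ u, u ∈ T ↔ (u ∈ Z ∨ (u = a₂ ∧ a₁ ∈ Z) ∨ (u = b₂ ∧ b₁ ∈ Z)) := by
      intro u
      rw [hT, mem_filter]
      simp only [mem_univ, true_and]
      by_cases u1 : u = a₂
      · subst u1; simp [glue_left hn₂, haZ, hn₂]
      · by_cases u2 : u = b₂
        · subst u2; simp [glue_right, hbZ, hn₂.symm]
        · simp [glue_of_ne u1 u2, u1, u2]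
    rw [← hT]
    by_cases hi1 : i = c a₁
    · obtain ⟨Y₁, hY₁⟩ : ∃ Y₁ : Finset V, Y₁ = {x ∈ Z | c x = c a₁} := ⟨_, rfl⟩
      obtain ⟨Z₂, hZ₂⟩ : ∃ Z₂ : Finset V, Z₂ = {x ∈ Z | c x = c a₂} := ⟨_, rfl⟩
      obtain ⟨Y₂, hY₂⟩ : ∃ Y₂ : Finset V, Y₂ = {x ∈ T | c x = c a₂} := ⟨_, rfl⟩
      have hY₁m : ∀ x, x ∈ Y₁ ↔ x ∈ Z ∧ c x = c a₁ := by simp [hY₁]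
      have hZ₂m : ∀ x, x ∈ Z₂ ↔ x ∈ Z ∧ c x = c a₂ := by simp [hZ₂]
      have hY₂m : ∀ x, x ∈ Y₂ ↔ x ∈ T ∧ c x = c a₂ := by simp [hY₂]
      have hZc : ∀ x ∈ Z, c x = c a₁ ∨ c x = c a₂ := by
        intro x hx
        rw [← mergeFibre_eq_left, ← hi1]
        have := (hZm x hx).1
        rwa [hi1] at this ⊢
      have hU : T = Y₁ ∪ Y₂ := by
        ext x
        rw [mem_union, hY₁m, hY₂m, hTm]
        constructor
        · rintro (h | ⟨rfl, h⟩ | ⟨rfl, h⟩)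
          · have := hZc x h; tauto
          · tauto
          · right; exact ⟨by tauto, hab'.symm⟩
        · tauto
      have hUZ : Z = Y₁ ∪ Z₂ := by
        ext x
        rw [mem_union, hY₁m, hZ₂m]
        have := hZc x
        tauto
      -- The second side regains its own copies of the merged vertices, so each merged vertex in the
      -- set adds four to the sum of the two bounds.
      have hZ₂card : (#Y₂ : ℤ) = #Z₂ + (if a₁ ∈ Y₁ then 1 else 0) + (if b₁ ∈ Y₁ then 1 else 0) := by
        have na : a₂ ∉ Z₂ := by rw [hZ₂m]; tauto
        have nb : b₂ ∉ Z₂ := by rw [hZ₂m]; tauto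
        have ea : a₁ ∈ Y₁ ↔ a₁ ∈ Z := by rw [hY₁m]; tauto
        have eb : b₁ ∈ Y₁ ↔ b₁ ∈ Z := by rw [hY₁m, hab]; tauto
        simp only [ea, eb]
        by_cases hA : a₁ ∈ Z <;> by_cases hB : b₁ ∈ Z
        · have : Y₂ = insert a₂ (insert b₂ Z₂) := by
            ext x; rw [hY₂m, hTm, mem_insert, mem_insert, hZ₂m]; grind
          rw [this, card_insert_of_notMem (by simp [hn₂, na]), card_insert_of_notMem nb]
          simp [hA, hB]
        · have : Y₂ = insert a₂ Z₂ := by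
            ext x; rw [hY₂m, hTm, mem_insert, hZ₂m]; grind
          rw [this, card_insert_of_notMem na]
          simp [hA, hB]
        · have : Y₂ = insert b₂ Z₂ := by
            ext x; rw [hY₂m, hTm, mem_insert, hZ₂m]; grind
          rw [this, card_insert_of_notMem nb]
          simp [hA, hB]
        · have : Y₂ = Z₂ := by
            ext x; rw [hY₂m, hTm, hZ₂m]; grind
          rw [this]
          simp [hA, hB]
      have hadd := (adjCount_union_of_fibre hc hne (X := Y₁) (Y := Y₂)
        (fun x hx => ((hY₁m x).1 hx).2) (fun x hx => ((hY₂m x).1 hx).2)).1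
      have hcadd := (adjCount_union_of_fibre hc hne (X := Y₁) (Y := Z₂)
        (fun x hx => ((hY₁m x).1 hx).2) (fun x hx => ((hZ₂m x).1 hx).2)).2
      rw [← hU] at hadd
      rw [← hUZ] at hcadd
      rw [hadd, hcadd]
      have s₁ := fun hne => h₁ Y₁ hne fun y hy =>
        ⟨((hY₁m y).1 hy).2, (hZm y ((hY₁m y).1 hy).1).2⟩
      have s₂ := fun hne => h₂ Y₂ hne fun y hy => ⟨((hY₂m y).1 hy).2, fun hyD => by
        rcases (hTm y).1 ((hY₂m y).1 hy).1 with h | h | h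
        · exact absurd hyD (hZm y h).2
        · exact Or.inl h.1
        · exact Or.inr h.1⟩
      have ea : a₂ ∈ Y₂ ↔ a₁ ∈ Y₁ := by rw [hY₂m, hTm, hY₁m]; tauto
      have eb : b₂ ∈ Y₂ ↔ b₁ ∈ Y₁ := by
        rw [hY₂m, hTm, hY₁m, ← hab, ← hab']; grind
      refine ⟨fun ⟨⟨y, hyD⟩, hyX, hyi⟩ => ?_, fun hall => ?_⟩
      · have hyZ : y ∉ Z := by rwa [hmem y hyD]
        have hyc : c y = c a₁ ∨ c y = c a₂ := by
          rw [← mergeFibre_eq_left]; exact hyi.trans hi1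
        -- With both merged vertices the overlap costs 8, and the slacks are `6 + 6` or `4 + 8`;
        -- with at most one it costs at most 4, against `4 + 4`. Either way 4 is left.
        by_cases hA : a₁ ∈ Y₁ ∧ b₁ ∈ Y₁
        · have hA' := hA
          rw [← ea, ← eb] at hA'
          have t₁ := s₁ ⟨_, hA.1⟩
          have t₂ := s₂ ⟨_, hA'.1⟩
          simp only [hA.1, hA.2, if_true] at hZ₂card
          rcases hyc with hyc | hyc
          · have u₁ := (t₁.2 hA.1 hA.2).1 ⟨y, by rw [hY₁m]; tauto, hyD, hyc⟩
            have u₂ : adjCount G Y₂ Y₂ ≤ 4 * #Y₂ - 6 := by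
              by_cases hf : ∃ y ∉ Y₂, y ∉ D ∧ c y = c a₂
              · have := (t₂.2 hA'.1 hA'.2).1 hf; omega
              · push Not at hf
                exact ((t₂.2 hA'.1 hA'.2).2 fun y hy hyc => by
                  by_contra hn; exact hf y hn hy hyc).le
            push_cast; omega
          · have hyY₂ : y ∉ Y₂ := by
              rw [hY₂m, hTm]
              rintro ⟨h | h | h, -⟩
              · exact hyZ h
              · exact hyD (h.1 ▸ ha₂)
              · exact hyD (h.1 ▸ hb₂)
            have u₂ := (t₂.2 hA'.1 hA'.2).1 ⟨y, hyY₂, hyD, hyc⟩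
            push_cast; omega
        · rcases Y₁.eq_empty_or_nonempty with hE₁ | hN₁
          · have hN₂ : Y₂.Nonempty := by
              rw [hE₁, empty_union] at hUZ
              obtain ⟨z, hz⟩ := hZne
              refine ⟨z, (hY₂m z).2 ⟨(hTm z).2 (Or.inl hz), ((hZ₂m z).1 (hUZ ▸ hz)).2⟩⟩
            have := (s₂ hN₂).1
            simp only [hE₁] at hZ₂card ⊢
            simp at hZ₂card ⊢
            omega
          · have t₁ := (s₁ hN₁).1
            rcases Y₂.eq_empty_or_nonempty with hE₂ | hN₂
            · have na : a₁ ∉ Y₁ := by rw [← ea, hE₂]; simp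
              have nb : b₁ ∉ Y₁ := by rw [← eb, hE₂]; simp
              simp only [hE₂, na, nb] at hZ₂card ⊢
              simp at hZ₂card ⊢
              omega
            · have t₂ := (s₂ hN₂).1
              have : (if a₁ ∈ Y₁ then 1 else 0) + (if b₁ ∈ Y₁ then 1 else 0) ≤ (1 : ℤ) :=
                two_ite_le hA
              push_cast; omega
      · have hall' : ∀ y ∉ D, c y = c a₁ ∨ c y = c a₂ → y ∈ Z := fun y hyD hyc =>
          (hmem y hyD).2 (hall ⟨y, hyD⟩ ((mergeFibre_eq_left.2 hyc).trans hi1.symm))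
        have mA : a₁ ∈ Y₁ := (hY₁m _).2 ⟨hall' _ ha₁ (Or.inl rfl), rfl⟩
        have mB : b₁ ∈ Y₁ := (hY₁m _).2 ⟨hall' _ hb₁ (Or.inl hab.symm), hab.symm⟩
        have t₁ := ((s₁ ⟨_, mA⟩).2 mA mB).2 fun y hyD hyc =>
          (hY₁m y).2 ⟨hall' y hyD (Or.inl hyc), hyc⟩
        have t₂ := ((s₂ ⟨_, ea.2 mA⟩).2 (ea.2 mA) (eb.2 mB)).2 fun y hyD hyc =>
          (hY₂m y).2 ⟨(hTm y).2 (Or.inl (hall' y hyD (Or.inr hyc))), hyc⟩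
        simp only [mA, mB, if_true] at hZ₂card
        push_cast; omega
    · have hZi : ∀ x ∈ Z, c x = i ∧ i ≠ c a₂ := fun x hx =>
        (mergeFibre_eq_of_ne hi1).1 (hZm x hx).1
      have hn : ∀ x, c a₁ = c x → x ∉ Z := fun x hx hxZ =>
        hi1 ((hZi x hxZ).1.symm.trans hx.symm)
      have hTZ : T = Z := by
        ext x
        rw [hTm]
        have := hn a₁ rfl
        have := hn b₁ hab
        tauto
      rw [hTZ]
      have hi2 : i ≠ c a₂ := (hZi _ hZne.choose_spec).2
      have h2 := h₀ Z i hZne hi1 hi2 fun x hx => (hZi x hx).1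
      refine ⟨fun ⟨⟨y, hyD⟩, hyX, hyi⟩ => h2.1 ⟨y, ?_, ?_⟩, fun hall => h2.2 fun y hy => ?_⟩
      · rwa [hmem y hyD]
      · exact ((mergeFibre_eq_of_ne hi1).1 hyi).1
      · have hyD : y ∈ Dᶜ := by
          intro hyD
          rcases hD y hyD with h | h
          · exact hi1 (hy.symm.trans h)
          · exact hi2 (hy.symm.trans h)
        exact (hmem y hyD).2 (hall ⟨y, hyD⟩ ((mergeFibre_eq_of_ne hi1).2 ⟨hy, hi2⟩))

end Glue

/-! ### The 1-sum and the 2-sum, and the invariant for all moves -/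

section PendantSums
variable {V : Type*} {ι : Type*} {G : SimpleGraph V} {f : V → ι}

theorem IsPendantK4.isNode_left {a b c d : V} (h : IsPendantK4 G a b c d) :
    IsNode G c a b d := by
  have h1 : G.Adj d a := by rw [← mem_neighborSet, h.2.2.1]; simp
  have h2 : G.Adj d b := by rw [← mem_neighborSet, h.2.2.1]; simp
  exact ⟨h.1.ne, h1.ne', h2.ne', h.2.1⟩

theorem IsPendantK4.isNode_right {a b c d : V} (h : IsPendantK4 G a b c d) :
    IsNode G d a b c := by
  have h1 : G.Adj c a := by rw [← mem_neighborSet, h.2.1]; simp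
  have h2 : G.Adj c b := by rw [← mem_neighborSet, h.2.1]; simp
  exact ⟨h.1.ne, h1.ne', h2.ne', h.2.2.1⟩

namespace IsCircuitFamily

theorem pendant_eq (h : IsCircuitFamily G f) {a b c d : V} (hp : IsPendantK4 G a b c d) :
    f b = f a ∧ f c = f a ∧ f d = f a :=
  ⟨(h.1 a b hp.1).symm, h.1 c a ((hp.isNode_left.adj_iff a).2 (by simp)),
    h.1 d a ((hp.isNode_right.adj_iff a).2 (by simp))⟩

/-- The bounds for what remains of a circuit when a pendant `K₄` is cut off. -/
theorem pendant_side [DecidableEq V] (h : IsCircuitFamily G f) {a b c d : V}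
    (hp : IsPendantK4 G a b c d) {Y : Finset V} (hY : Y.Nonempty) (hYf : ∀ y ∈ Y, f y = f a)
    (hc : c ∉ Y) (hd : d ∉ Y) :
    adjCount G Y Y ≤ 4 * #Y - 4 ∧ (a ∈ Y → b ∈ Y →
      ((∃ y ∉ Y, y ≠ c ∧ y ≠ d ∧ f y = f a) → adjCount G Y Y ≤ 4 * #Y - 6) ∧
      ((∀ y, f y = f a → y ≠ c → y ≠ d → y ∈ Y) → adjCount G Y Y = 4 * #Y - 4)) := by
  obtain ⟨-, fc, fd⟩ := h.pendant_eq hp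
  refine ⟨(h.2 Y _ hY hYf).1 ⟨c, hc, fc⟩, fun ha hb => ?_⟩
  have hcd : d ≠ c := ((hp.isNode_left.adj_iff d).2 (by simp)).ne'
  have hd' : d ∉ insert c Y := by simp [hcd, hd]
  have h1 := h.2 (insert d (insert c Y)) (f a) (insert_nonempty _ _) (by simpa [fc, fd] using hYf)
  rw [adjCount_insert_self hd', adjCount_insert_self hc, card_insert_of_notMem hd',
    card_insert_of_notMem hc, hp.isNode_left.adjCount, hp.isNode_right.adjCount] at h1
  -- Restoring `c` and `d` adds five edges, so ten to the count, and eight to the bound: the slack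
  -- of `Y` is two more than that of the restored set.
  simp only [ha, hb, hd, mem_insert, or_true, true_or, if_true, if_false] at h1
  push_cast at h1
  refine ⟨fun ⟨y, hy, hyc, hyd, hyf⟩ => ?_, fun hall => ?_⟩
  · have := h1.1 ⟨y, by simp [hy, hyc, hyd], hyf⟩; omega
  · have := h1.2 fun y hy => by
      by_cases hyc : y = c
      · simp [hyc]
      · by_cases hyd : y = d
        · simp [hyd]
        · simpa [hyc, hyd] using hall y hy hyc hyd
    omega

theorem oneSum [Fintype V] (h : IsCircuitFamily G f) {a₁ b₁ a₂ b₂ c₂ d₂ : V}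
    (h₁ : G.Adj a₁ b₁) (h₂ : IsPendantK4 G a₂ b₂ c₂ d₂) (hne : f a₁ ≠ f a₂) :
    IsCircuitFamily (SimpleTwoTwo.oneSum G a₁ b₁ a₂ b₂ c₂ d₂)
      fun x => mergeFibre f (f a₁) (f a₂) x := by
  classical
  obtain ⟨fb₂, fc₂, fd₂⟩ := h.pendant_eq h₂
  have fb₁ := h.1 a₁ b₁ h₁
  have hn : ∀ x y, f x = f a₁ → f y = f a₂ → x ≠ y := by
    rintro x y hx hy rfl; exact hne (hx.symm.trans hy)
  have hcount : ∀ Y : Finset V, adjCount (G.deleteEdges {s(a₁, b₁), s(a₂, b₂)}) Y Y =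
      adjCount G Y Y - (if a₁ ∈ Y ∧ b₁ ∈ Y then 2 else 0) -
        (if a₂ ∈ Y ∧ b₂ ∈ Y then 2 else 0) := by
    intro Y
    have e : G.deleteEdges {s(a₁, b₁), s(a₂, b₂)} =
        (G.deleteEdges {s(a₁, b₁)}).deleteEdges {s(a₂, b₂)} := by
      rw [deleteEdges_deleteEdges]; rfl
    rw [e, adjCount_deleteEdge, adjCount_deleteEdge h₁]
    rw [deleteEdges_adj]
    refine ⟨h₂.1, ?_⟩
    simp [(hn a₁ a₂ rfl rfl).symm, (hn b₁ a₂ fb₁.symm rfl).symm]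
  refine isCircuitFamily_glue (fun x y hxy => h.1 x y hxy.1) fb₁ fb₂.symm hne h₁.ne h₂.1.ne
    (by simp) ?_ ?_ (by simp) (by simp) ?_ ?_ ?_ ?_
  · simp [hn a₁ a₂ rfl rfl, hn a₁ b₂ rfl fb₂, hn a₁ c₂ rfl fc₂, hn a₁ d₂ rfl fd₂]
  · have := fb₁.symm
    simp [hn b₁ a₂ this rfl, hn b₁ b₂ this fb₂, hn b₁ c₂ this fc₂, hn b₁ d₂ this fd₂]
  · rintro x (rfl | rfl | rfl | rfl) <;> simp [*]
  · intro X i hX hi1 hi2 hXi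
    have ha₁ : a₁ ∉ X := fun hx => hi1 (hXi a₁ hx).symm
    have ha₂ : a₂ ∉ X := fun hx => hi2 (hXi a₂ hx).symm
    rw [hcount]
    simpa [ha₁, ha₂] using h.2 X i hX hXi
  · intro Y hY hYf
    have ha₂ : a₂ ∉ Y := fun hx => hne (hYf a₂ hx).1.symm
    rw [hcount]
    simp only [ha₂, false_and, if_false, sub_zero]
    have hs := h.2 Y (f a₁) hY fun y hy => (hYf y hy).1
    have hle := h.adjCount_le hY fun y hy => (hYf y hy).1
    refine ⟨?_, fun ha hb => ?_⟩
    · split_ifs with hif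
      · omega
      · rw [sub_zero]
        refine hs.1 ?_
        by_cases ha : a₁ ∈ Y
        · exact ⟨b₁, fun hb => hif ⟨ha, hb⟩, fb₁.symm⟩
        · exact ⟨a₁, ha, rfl⟩
    · simp only [ha, hb, and_self, if_true]
      refine ⟨fun ⟨y, hy, _, hyf⟩ => ?_, fun hall => ?_⟩
      · have := hs.1 ⟨y, hy, hyf⟩; omega
      · have := hs.2 fun y hyf => by
          refine hall y ?_ hyf
          simp [hn y a₂ hyf rfl, hn y b₂ hyf fb₂, hn y c₂ hyf fc₂, hn y d₂ hyf fd₂]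
        omega
  · intro Y hY hYf
    have ha₁ : a₁ ∉ Y := fun hx => hne (hYf a₁ hx).1
    have hc₂ : c₂ ∉ Y := fun hx => by
      rcases (hYf c₂ hx).2 (by simp) with e | e
      · exact ((h₂.isNode_left.adj_iff a₂).2 (by simp)).ne e
      · exact ((h₂.isNode_left.adj_iff b₂).2 (by simp)).ne e
    have hd₂ : d₂ ∉ Y := fun hx => by
      rcases (hYf d₂ hx).2 (by simp) with e | e
      · exact ((h₂.isNode_right.adj_iff a₂).2 (by simp)).ne e
      · exact ((h₂.isNode_right.adj_iff b₂).2 (by simp)).ne e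
    rw [hcount]
    simp only [ha₁, false_and, if_false, sub_zero]
    have hs := h.pendant_side h₂ hY (fun y hy => (hYf y hy).1) hc₂ hd₂
    refine ⟨?_, fun ha hb => ?_⟩
    · split_ifs <;> omega
    · simp only [ha, hb, and_self, if_true]
      refine ⟨fun ⟨y, hy, hyD, hyf⟩ => ?_, fun hall => ?_⟩
      · simp only [Set.mem_insert_iff, Set.mem_singleton_iff, not_or] at hyD
        have := (hs.2 ha hb).1 ⟨y, hy, hyD.2.2.1, hyD.2.2.2, hyf⟩
        omega
      · have := (hs.2 ha hb).2 fun y hyf hyc hyd => by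
          by_cases hya : y = a₂
          · rwa [hya]
          · by_cases hyb : y = b₂
            · rwa [hyb]
            · exact hall y (by simp [*]) hyf
        omega

/-- The edge `a₂b₂` can be deleted before gluing, because `a₁b₁` has the same image. Afterwards no
two edges are identified and `isCircuitFamily_glue` applies. -/
theorem twoSum [Fintype V] (h : IsCircuitFamily G f) {a₁ b₁ c₁ d₁ a₂ b₂ c₂ d₂ : V}
    (h₁ : IsPendantK4 G a₁ b₁ c₁ d₁) (h₂ : IsPendantK4 G a₂ b₂ c₂ d₂) (hne : f a₁ ≠ f a₂) :
    IsCircuitFamily (SimpleTwoTwo.twoSum G a₁ b₁ c₁ d₁ a₂ b₂ c₂ d₂)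
      fun x => mergeFibre f (f a₁) (f a₂) x := by
  classical
  obtain ⟨fb₁, fc₁, fd₁⟩ := h.pendant_eq h₁
  obtain ⟨fb₂, fc₂, fd₂⟩ := h.pendant_eq h₂
  have hn : ∀ x y, f x = f a₁ → f y = f a₂ → x ≠ y := by
    rintro x y hx hy rfl; exact hne (hx.symm.trans hy)
  have hmap : G.map (glue a₁ b₁ a₂ b₂) =
      (G.deleteEdges {s(a₂, b₂)}).map (glue a₁ b₁ a₂ b₂) := by
    ext x y
    rw [SimpleGraph.map_adj', SimpleGraph.map_adj']
    refine and_congr_right fun hxy => ⟨?_, ?_⟩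
    · rintro ⟨u, v, huv, rfl, rfl⟩
      have na : a₁ ≠ a₂ := hn _ _ rfl rfl
      have na' : a₁ ≠ b₂ := hn _ _ rfl fb₂
      have nb : b₁ ≠ a₂ := hn _ _ fb₁ rfl
      have nb' : b₁ ≠ b₂ := hn _ _ fb₁ fb₂
      by_cases he : s(u, v) = s(a₂, b₂)
      · rw [Sym2.eq_iff] at he
        rcases he with ⟨rfl, rfl⟩ | ⟨rfl, rfl⟩
        · refine ⟨a₁, b₁, ⟨h₁.1, by simp [na, na']⟩, ?_, ?_⟩
          · rw [glue_left h₂.1.ne, glue_of_ne na na']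
          · rw [glue_right, glue_of_ne nb nb']
        · refine ⟨b₁, a₁, ⟨h₁.1.symm, by simp [na, na']⟩, ?_, ?_⟩
          · rw [glue_right, glue_of_ne nb nb']
          · rw [glue_left h₂.1.ne, glue_of_ne na na']
      · exact ⟨u, v, deleteEdges_adj.2 ⟨huv, by simpa using he⟩, rfl, rfl⟩
    · rintro ⟨u, v, huv, rfl, rfl⟩
      exact ⟨u, v, huv.1, rfl, rfl⟩
  unfold SimpleTwoTwo.twoSum
  rw [hmap]
  have hnc : ∀ {a b c d}, IsPendantK4 G a b c d → (a ≠ c ∧ a ≠ d) ∧ (b ≠ c ∧ b ≠ d) := by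
    intro a b c d hp
    exact ⟨⟨((hp.isNode_left.adj_iff a).2 (by simp)).ne', hp.isNode_left.2.1⟩,
      ⟨((hp.isNode_left.adj_iff b).2 (by simp)).ne', hp.isNode_left.2.2.1⟩⟩
  refine isCircuitFamily_glue (fun x y hxy => h.1 x y hxy.1) fb₁.symm fb₂.symm hne h₁.1.ne
    h₂.1.ne (by simp) ?_ ?_ (by simp) (by simp) ?_ ?_ ?_ ?_
  · simp [hn a₁ a₂ rfl rfl, hn a₁ b₂ rfl fb₂, hn a₁ c₂ rfl fc₂, hn a₁ d₂ rfl fd₂, hnc h₁]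
  · simp [hn b₁ a₂ fb₁ rfl, hn b₁ b₂ fb₁ fb₂, hn b₁ c₂ fb₁ fc₂, hn b₁ d₂ fb₁ fd₂, hnc h₁]
  · rintro x (rfl | rfl | rfl | rfl | rfl | rfl) <;> simp [*]
  · intro X i hX hi1 hi2 hXi
    have ha₂ : a₂ ∉ X := fun hx => hi2 (hXi a₂ hx).symm
    rw [adjCount_deleteEdge h₂.1]
    simpa [ha₂] using h.2 X i hX hXi
  · intro Y hY hYf
    have ha₂ : a₂ ∉ Y := fun hx => hne (hYf a₂ hx).1.symm
    rw [adjCount_deleteEdge h₂.1]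
    simp only [ha₂, false_and, if_false, sub_zero]
    have hs := h.pendant_side h₁ hY (fun y hy => (hYf y hy).1)
      (fun hx => (hYf c₁ hx).2 (by simp)) (fun hx => (hYf d₁ hx).2 (by simp))
    refine ⟨hs.1, fun ha hb => ⟨fun ⟨y, hy, hyD, hyf⟩ => (hs.2 ha hb).1 ⟨y, hy, ?_, ?_, hyf⟩,
      fun hall => (hs.2 ha hb).2 fun y hyf hyc hyd => hall y ?_ hyf⟩⟩
    · rintro rfl; simp at hyD
    · rintro rfl; simp at hyD
    · simp [hn y a₂ hyf rfl, hn y b₂ hyf fb₂, hn y c₂ hyf fc₂, hn y d₂ hyf fd₂, hyc, hyd]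
  · intro Y hY hYf
    have hc₂ : c₂ ∉ Y := fun hx => by
      rcases (hYf c₂ hx).2 (by simp) with e | e
      · exact (hnc h₂).1.1 e.symm
      · exact (hnc h₂).2.1 e.symm
    have hd₂ : d₂ ∉ Y := fun hx => by
      rcases (hYf d₂ hx).2 (by simp) with e | e
      · exact (hnc h₂).1.2 e.symm
      · exact (hnc h₂).2.2 e.symm
    rw [adjCount_deleteEdge h₂.1]
    have hs := h.pendant_side h₂ hY (fun y hy => (hYf y hy).1) hc₂ hd₂
    refine ⟨?_, fun ha hb => ?_⟩
    · split_ifs <;> omega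
    · simp only [ha, hb, and_self, if_true]
      refine ⟨fun ⟨y, hy, hyD, hyf⟩ => ?_, fun hall => ?_⟩
      · simp only [Set.mem_insert_iff, Set.mem_singleton_iff, not_or] at hyD
        have := (hs.2 ha hb).1 ⟨y, hy, hyD.2.2.2.2.1, hyD.2.2.2.2.2, hyf⟩
        omega
      · have := (hs.2 ha hb).2 fun y hyf hyc hyd => by
          by_cases hya : y = a₂
          · rwa [hya]
          · by_cases hyb : y = b₂
            · rwa [hyb]
            · refine hall y ?_ hyf
              have e₁ : y ≠ c₁ := (hn c₁ y fc₁ hyf).symm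
              have e₂ : y ≠ d₁ := (hn d₁ y fd₁ hyf).symm
              simp [*]
        omega

end IsCircuitFamily
end PendantSums

/-- The induction runs through disconnected graphs, so it carries a labelling whose fibres are the
circuits. For the sums, `reachable_of_eq` turns "different components" into "different labels". -/
theorem Generated.exists_isCircuitFamily {V : Type u} {G : SimpleGraph V} (h : Generated G) :
    Finite V ∧ ∃ (ι : Type u) (f : V → ι), IsCircuitFamily G f := by
  induction h with
  | @base V G h =>
    rcases h with ⟨⟨e⟩⟩ | ⟨⟨e⟩⟩ | ⟨⟨e⟩⟩
    · exact ⟨Finite.of_equiv _ e.symm.toEquiv, _, _, circ_K5MinusEdge.isCircuitFamily.iso e.symm⟩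
    · exact ⟨Finite.of_equiv _ e.symm.toEquiv, _, _, circ_K4ShareEdge.isCircuitFamily.iso e.symm⟩
    · exact ⟨Finite.of_equiv _ e.symm.toEquiv, _, _,
        circ_K4ShareVertex.isCircuitFamily.iso e.symm⟩
  | disjoint _ _ hG hH =>
    obtain ⟨_, ι, f, hf⟩ := hG
    obtain ⟨_, κ, g, hg⟩ := hH
    exact ⟨inferInstance, _, _, hf.sum hg⟩
  | iso _ e hG =>
    obtain ⟨_, ι, f, hf⟩ := hG
    exact ⟨Finite.of_equiv _ e.toEquiv, _, _, hf.iso e⟩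
  | hennebergTwo _ huw hzu hzw hz hG =>
    obtain ⟨_, ι, f, hf⟩ := hG
    exact ⟨inferInstance, _, _, hf.hennebergTwo huw hzu hzw (hf.eq_of_reachable hz)⟩
  | @oneSum V _ _ _ _ _ _ _ _ h₁ h₂ h hG =>
    obtain ⟨_, ι, f, hf⟩ := hG
    have := Fintype.ofFinite V
    exact ⟨inferInstance, _, _, hf.oneSum h₁ h₂ fun e => h (hf.reachable_of_eq e)⟩
  | @twoSum V _ _ _ _ _ _ _ _ _ _ h₁ h₂ h hG =>
    obtain ⟨_, ι, f, hf⟩ := hG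
    have := Fintype.ofFinite V
    exact ⟨inferInstance, _, _, hf.twoSum h₁ h₂ fun e => h (hf.reachable_of_eq e)⟩
  | threeSum _ h₁ h₂ h hG =>
    obtain ⟨_, ι, f, hf⟩ := hG
    exact ⟨inferInstance, _, _, hf.threeSum h₁ h₂ fun e => h (hf.reachable_of_eq e)⟩

theorem Generated.isCircuit {V : Type u} {G : SimpleGraph V} (h : Generated G)
    (hG : G.Connected) : IsCircuit G := by
  obtain ⟨_, ι, f, hf⟩ := h.exists_isCircuitFamily
  have := Fintype.ofFinite V
  exact isCircuit_iff_circ.2 (hf.circ_of_connected hG)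

/-! ### Building blocks for the inverse moves -/

section Constructions
variable {V W : Type*} {G : SimpleGraph V} {H : SimpleGraph W}

theorem even_adjCount_self [Fintype V] (X : Finset V) : Even (adjCount G X X) := by
  rw [← two_mul_spannedEdges]; exact even_two_mul _

theorem Circ.reachable [Fintype V] (hG : Circ G) (x y : V) : G.Reachable x y :=
  (Circ.isCircuitFamily.{0} hG).reachable_of_eq rfl

theorem Circ.connected [Fintype V] (hG : Circ G) : G.Connected := by
  have := hG.two_le_card
  have : Nonempty V := Fintype.card_pos_iff.1 (by omega)
  exact ⟨hG.reachable⟩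

/-- An isomorphism from an induced subgraph of an image, described by a map on the original
vertices. -/
theorem nonempty_iso_induce_map {S : Type*} (K : SimpleGraph S) (g : S → S) (D : Set S)
    (Ψ : S → V) (hinj : ∀ s ∉ D, ∀ t ∉ D, Ψ s = Ψ t → s = t) (hsurj : ∀ x, ∃ s ∉ D, Ψ s = x)
    (hg : ∀ s, Ψ (g s) = Ψ s)
    (h₁ : ∀ u v, K.Adj u v → g u ∉ D → g v ∉ D → G.Adj (Ψ u) (Ψ v))
    (h₂ : ∀ x y, G.Adj x y → ∃ u v, K.Adj u v ∧ g u ∉ D ∧ g v ∉ D ∧ Ψ u = x ∧ Ψ v = y) :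
    Nonempty ((K.map g).induce Dᶜ ≃g G) := by
  have hbij : Function.Bijective fun s : (Dᶜ : Set S) => Ψ s := by
    refine ⟨fun s t hst => Subtype.ext (hinj s s.2 t t.2 hst), fun x => ?_⟩
    obtain ⟨s, hs, rfl⟩ := hsurj x
    exact ⟨⟨s, hs⟩, rfl⟩
  refine ⟨⟨Equiv.ofBijective _ hbij, ?_⟩⟩
  rintro ⟨s, hs⟩ ⟨t, ht⟩
  change G.Adj (Ψ s) (Ψ t) ↔ (K.map g).Adj s t
  rw [SimpleGraph.map_adj']
  constructor
  · intro h
    refine ⟨fun hst => h.ne (by rw [hst]), ?_⟩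
    obtain ⟨u, v, huv, hu, hv, hus, hvt⟩ := h₂ _ _ h
    exact ⟨u, v, huv, hinj _ hu _ hs (by rw [hg, hus]), hinj _ hv _ ht (by rw [hg, hvt])⟩
  · rintro ⟨-, u, v, huv, rfl, rfl⟩
    rw [hg, hg]
    exact h₁ u v huv hs ht

theorem IsNode.sum_inl {v a b c : V} (h : IsNode G v a b c) :
    IsNode (G ⊕g H) (.inl v) (.inl a) (.inl b) (.inl c) := by
  refine ⟨by simpa using h.1, by simpa using h.2.1, by simpa using h.2.2.1, ?_⟩
  ext (x | x)
  · simp [h.adj_iff]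
  · simp

theorem IsNode.sum_inr {v a b c : W} (h : IsNode H v a b c) :
    IsNode (G ⊕g H) (.inr v) (.inr a) (.inr b) (.inr c) := by
  refine ⟨by simpa using h.1, by simpa using h.2.1, by simpa using h.2.2.1, ?_⟩
  ext (x | x)
  · simp
  · simp [h.adj_iff]

theorem IsPendantK4.sum_inl {a b c d : V} (h : IsPendantK4 G a b c d) :
    IsPendantK4 (G ⊕g H) (.inl a) (.inl b) (.inl c) (.inl d) := by
  obtain ⟨x, hx, hx'⟩ := h.2.2.2
  exact ⟨by simpa using h.1, h.isNode_left.sum_inl.2.2.2, h.isNode_right.sum_inl.2.2.2,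
    .inl x, hx.map Embedding.sumInl.toHom, by simpa using hx'⟩

theorem IsPendantK4.sum_inr {a b c d : W} (h : IsPendantK4 H a b c d) :
    IsPendantK4 (G ⊕g H) (.inr a) (.inr b) (.inr c) (.inr d) := by
  obtain ⟨x, hx, hx'⟩ := h.2.2.2
  exact ⟨by simpa using h.1, h.isNode_left.sum_inr.2.2.2, h.isNode_right.sum_inr.2.2.2,
    .inr x, hx.map Embedding.sumInr.toHom, by simpa using hx'⟩

theorem insertNone_eq_univ [Fintype V] {Y : Finset V} : insertNone Y = univ ↔ Y = univ := by
  simp only [eq_univ_iff_forall]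
  constructor
  · intro h x; simpa using h (some x)
  · rintro h (_ | x) <;> simp [h]

theorem circ_addVertex_triple [Fintype V] {a b c : V} (hab : a ≠ b) (hac : a ≠ c) (hbc : b ≠ c)
    (h₀ : adjCount G univ univ = 4 * Fintype.card V - 4)
    (h₁ : ∀ X : Finset V, X.Nonempty → adjCount G X X ≤ 4 * #X - 4)
    (h₂ : ∀ X : Finset V, X ≠ univ → a ∈ X → b ∈ X → c ∈ X → adjCount G X X ≤ 4 * #X - 6) :
    Circ (addVertex G {a, b, c}) := by
  classical
  refine ⟨?_, fun X hX hX' => ?_⟩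
  · rw [← insertNone_eq_univ.2 rfl, adjCount_addVertex_triple hab hac hbc, h₀]
    simp
    ring
  · obtain ⟨Y, rfl | rfl⟩ := eq_map_some_or_eq_insertNone X
    · rw [adjCount_addVertex_map, card_map]
      exact h₁ Y (by simpa using hX)
    · rw [adjCount_addVertex_triple hab hac hbc, card_insertNone]
      push_cast
      rcases Y.eq_empty_or_nonempty with rfl | hY
      · simp
      · have t₁ := h₁ Y hY
        by_cases hall : a ∈ Y ∧ b ∈ Y ∧ c ∈ Y
        · have t₂ := h₂ Y (fun h => hX' (insertNone_eq_univ.2 h)) hall.1 hall.2.1 hall.2.2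
          simp only [hall, if_true]
          omega
        · split_ifs <;> first | omega | tauto

variable (G) in
/-- A `K₄` is attached along `a, b`: its two other vertices are `some none` and `none`. -/
def withPendant (a b : V) : SimpleGraph (Option (Option V)) :=
  addVertex (addVertex G {a, b}) {some a, some b, none}

theorem adjCount_withPendant_univ [DecidableEq V] {a b : V} (hab : a ≠ b) (Y : Finset V) :
    adjCount (withPendant G a b) (insertNone (insertNone Y)) (insertNone (insertNone Y)) =
      adjCount G Y Y + 4 * ((if a ∈ Y then 1 else 0) + (if b ∈ Y then 1 else 0)) + 2 := by
  rw [withPendant, adjCount_addVertex_triple (by simpa using hab) (by simp) (by simp),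
    adjCount_addVertex_pair hab]
  simp
  ring

/-- Attaching the two vertices adds five edges, ten to the count against eight for the bound. So
slack 4 becomes 2 on the whole set, and slack 6 becomes 4 on proper sets containing `a` and `b`. -/
theorem circ_withPendant [Fintype V] {a b : V} (hab : a ≠ b)
    (h₀ : adjCount G univ univ = 4 * Fintype.card V - 4)
    (h₁ : ∀ X : Finset V, X.Nonempty → adjCount G X X ≤ 4 * #X - 4)
    (h₂ : ∀ X : Finset V, X ≠ univ → a ∈ X → b ∈ X → adjCount G X X ≤ 4 * #X - 6) :
    Circ (withPendant G a b) := by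
  classical
  refine ⟨?_, fun X hX hX' => ?_⟩
  · rw [← insertNone_eq_univ.2 (insertNone_eq_univ.2 rfl), adjCount_withPendant_univ hab, h₀]
    simp
    ring
  · obtain ⟨Z, rfl | rfl⟩ := eq_map_some_or_eq_insertNone X
    · obtain ⟨Y, rfl | rfl⟩ := eq_map_some_or_eq_insertNone Z
      · rw [withPendant, adjCount_addVertex_map, adjCount_addVertex_map, card_map, card_map]
        exact h₁ Y (by simpa using hX)
      · rw [withPendant, adjCount_addVertex_map, adjCount_addVertex_pair hab, card_map,
          card_insertNone]
        push_cast
        rcases Y.eq_empty_or_nonempty with rfl | hY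
        · simp
        · have t₁ := h₁ Y hY
          split_ifs <;> omega
    · obtain ⟨Y, rfl | rfl⟩ := eq_map_some_or_eq_insertNone Z
      · rw [withPendant, adjCount_addVertex_triple (by simpa using hab) (by simp) (by simp),
          adjCount_addVertex_map, card_insertNone, card_map]
        simp
        rcases Y.eq_empty_or_nonempty with rfl | hY
        · simp
        · have t₁ := h₁ Y hY
          split_ifs <;> omega
      · rw [adjCount_withPendant_univ hab, card_insertNone, card_insertNone]
        push_cast
        rcases Y.eq_empty_or_nonempty with rfl | hY
        · simp
        · have t₁ := h₁ Y hY
          by_cases hall : a ∈ Y ∧ b ∈ Y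
          · have t₂ := h₂ Y (fun h => hX' (insertNone_eq_univ.2 (insertNone_eq_univ.2 h)))
              hall.1 hall.2
            simp only [hall, if_true]
            omega
          · split_ifs <;> first | omega | tauto

theorem isPendantK4_withPendant {a b : V} (hab : G.Adj a b)
    (hx : ∃ x : V, (withPendant G a b).Reachable (some (some a)) (some (some x)) ∧
      x ≠ a ∧ x ≠ b) :
    IsPendantK4 (withPendant G a b) (some (some a)) (some (some b)) (some none) none := by
  obtain ⟨x, hx, hxa, hxb⟩ := hx
  refine ⟨hab, ?_, ?_, some (some x), hx, by simp [hxa, hxb]⟩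
  · ext (_ | _ | x) <;> simp [withPendant, mem_neighborSet]
  · ext (_ | _ | x) <;> simp [withPendant, mem_neighborSet]

end Constructions

/-- All circuits with fewer than `n` vertices are generated. -/
def GeneratedBelow (n : ℕ) : Prop :=
  ∀ (W : Type u) [Fintype W] (H : SimpleGraph W), Fintype.card W < n → Circ H → Generated H

/-! ### Undoing a Henneberg 2 move -/

section Inverse
variable {V : Type u} [Fintype V] [DecidableEq V] {G : SimpleGraph V}

/-- Only a critical set containing `a` and `b` could become too dense. Admissibility puts `c` into
it, so it contains all neighbours of `v` and is the whole of `V` without `v`. -/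
theorem circ_addEdge_of_admissible (hG : Circ G) {v a b c : V} (h : Admissible G v a b c) :
    Circ ((G ⊔ edge a b).comap (Subtype.val : {x // x ≠ v} → V)) := by
  obtain ⟨hN, hab, hblock⟩ := h
  have hcount : ∀ X : Finset {x // x ≠ v},
      adjCount ((G ⊔ edge a b).comap (Subtype.val : {x // x ≠ v} → V)) X X =
        adjCount G (X.map (.subtype _)) (X.map (.subtype _)) +
          if a ∈ X.map (.subtype _) ∧ b ∈ X.map (.subtype _) then 2 else 0 := by
    intro X
    rw [← adjCount_sup_edge hN.1 hab, adjCount_map]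
    rfl
  have hva := ((hN.adj_iff a).2 (by simp)).ne'
  have hvb := ((hN.adj_iff b).2 (by simp)).ne'
  have huniv : (univ : Finset {x // x ≠ v}).map (.subtype _) = univ.erase v := by
    ext x; simp
  have hcard : Fintype.card {x // x ≠ v} + 1 = Fintype.card V := by
    have : Fintype.card {x // x ≠ v} = #(univ.erase v) := by rw [← huniv, card_map, card_univ]
    rw [this, card_erase_of_mem (mem_univ v), card_univ]
    have := hG.two_le_card
    omega
  refine ⟨?_, fun X hX hX' => ?_⟩
  · rw [hcount, huniv]
    have h1 := adjCount_insert_self (G := G) (notMem_erase v univ)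
    rw [insert_erase (mem_univ v), hG.1] at h1
    have h2 := adjCount_singleton_add_compl (G := G) v {v}
    rw [hN.degree, adjCount_singleton, adjInd_self, compl_singleton] at h2
    simp [hva, hvb]
    simp only [ne_eq] at hcard
    omega
  · rw [hcount]
    obtain ⟨Y, hY⟩ : ∃ Y, Y = X.map (.subtype _) := ⟨_, rfl⟩
    have hvY : v ∉ Y := by simp [hY]
    have hc : #X = #Y := by rw [hY, card_map]
    rw [← hY, hc]
    have hYne : Y.Nonempty := by rw [hY]; simpa using hX
    have hle := hG.2 Y hYne (by rintro h; simp [h] at hvY)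
    split_ifs with hif
    · by_contra! hlt
      -- Parity rounds the strict inequality up to criticality.
      obtain ⟨k, hk⟩ := even_adjCount_self (G := G) Y
      have hcrit : Critical G Y := by unfold Critical; omega
      have hcY := hblock Y hcrit hif.1 hif.2 hvY
      have h1 := hG.insert_eq_univ hcrit hvY (by rw [hN.adjCount]; simp [hif, hcY])
      apply hX'
      rw [eq_univ_iff_forall]
      rintro ⟨x, hx⟩
      have : x ∈ insert v Y := by rw [h1]; simp
      have : x ∈ Y := by grind
      rw [hY] at this
      simpa [hx] using this
    · omega

theorem generated_of_admissible (hG : Circ G) {v a b c : V} (h : Admissible G v a b c)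
    (ih : GeneratedBelow.{u} (Fintype.card V)) : Generated G := by
  have hC := circ_addEdge_of_admissible hG h
  obtain ⟨hN, hab, -⟩ := h
  have hva := ((hN.adj_iff a).2 (by simp)).ne'
  have hvb := ((hN.adj_iff b).2 (by simp)).ne'
  have hvc := ((hN.adj_iff c).2 (by simp)).ne'
  have hgen := ih _ _ (Fintype.card_subtype_lt (x := v) (by simp)) hC
  have hmove := hgen.hennebergTwo (u := ⟨a, hva⟩) (w := ⟨b, hvb⟩) (z := ⟨c, hvc⟩)
    (by simp [edge_adj, hN.1]) (by simpa using hN.2.1.symm) (by simpa using hN.2.2.1.symm)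
    (hC.reachable _ _)
  refine hmove.iso ⟨Equiv.optionSubtypeNe v, ?_⟩
  rw [hennebergTwo_eq_addVertex]
  rintro (_ | ⟨x, hx⟩) (_ | ⟨y, hy⟩)
  · simp
  · simp [hN.adj_iff]
  · simp [G.adj_comm x v, hN.adj_iff]
  · simp only [Equiv.optionSubtypeNe_some, addVertex_adj_some_some, deleteEdges_adj, comap_adj,
      sup_adj, edge_adj, Set.mem_singleton_iff, Sym2.eq_iff, Subtype.mk.injEq]
    constructor
    · intro hxy
      refine ⟨Or.inl hxy, ?_⟩
      rintro (⟨rfl, rfl⟩ | ⟨rfl, rfl⟩)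
      · exact hab hxy
      · exact hab hxy.symm
    · tauto

end Inverse

/-! ### Partitions into two critical sets and undoing a 3-sum -/

section Partition
variable {V : Type u} [Fintype V] [DecidableEq V] {G : SimpleGraph V}

theorem Circ.cut_eq_three (hG : Circ G) {A : Finset V} (hA : Critical G A)
    (hA' : Critical G Aᶜ) : adjCount G A Aᶜ = 3 := by
  have h1 := adjCount_univ_univ_eq (G := G) A
  have h2 := card_add_card_compl A
  rw [hG.1, hA, hA'] at h1
  omega

theorem exists_isSep_of_two_le {A B : Finset V} (hB : B = Aᶜ) (hA : 4 ≤ #A) (hB4 : 4 ≤ #B)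
    (hcut : adjCount G A B = 3) {x : V} (hx : x ∈ A) (h2 : 2 ≤ adjCount G {x} B) :
    ∃ P Q a b, IsSep G P Q a b := by
  have hsplit := adjCount_union_left (G := G) (disjoint_sdiff (s := {x}) (t := A)) B
  rw [union_sdiff_of_subset (by simpa using hx), hcut] at hsplit
  have hmem : ∀ y, y ∈ B ↔ y ∉ A := by simp [hB]
  -- At most one of the three cut edges misses `x`; `z` is its end in `B`, or arbitrary if there is
  -- none. Then `x, z` meet all cut edges and separate `A ∪ {z}` from `B ∪ {x}`.
  obtain ⟨z, hz, hz0⟩ : ∃ z ∈ B, adjCount G (A \ {x}) (B \ {z}) = 0 := by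
    by_cases h0 : adjCount G (A \ {x}) B = 0
    · obtain ⟨z, hz⟩ := card_pos.1 (show 0 < #B by omega)
      refine ⟨z, hz, le_antisymm ?_ (adjCount_nonneg _ _)⟩
      rw [← h0]
      exact adjCount_mono le_rfl sdiff_subset
    · rw [adjCount_eq_zero_iff] at h0
      push Not at h0
      obtain ⟨y, hy, z, hz, hyz⟩ := h0
      refine ⟨z, hz, ?_⟩
      have h3 := adjCount_union_right (G := G) (A \ {x}) (disjoint_sdiff (s := {z}) (t := B))
      rw [union_sdiff_of_subset (by simpa using hz)] at h3
      have h4 : adjCount G {y} {z} ≤ adjCount G (A \ {x}) {z} :=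
        adjCount_mono (by simpa using hy) le_rfl
      rw [adjCount_singleton, adjInd_of_adj hyz] at h4
      have h5 := adjCount_nonneg (G := G) (A \ {x}) (B \ {z})
      omega
  have hzA := (hmem z).1 hz
  have hxB : x ∉ B := fun h => (hmem x).1 h hx
  refine ⟨insert z A, insert x B, x, z, ?_, ?_, ?_, ?_, Or.inr ⟨?_, ?_⟩⟩
  · ext y; have := hmem y; simp; tauto
  · ext y
    have := hmem y
    simp only [mem_inter, mem_insert, mem_singleton]
    constructor
    · tauto
    · rintro (rfl | rfl) <;> tauto
  · rintro rfl; exact hzA hx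
  · have e1 : insert z A \ insert x B = A \ {x} := by
      ext y; have := hmem y
      simp only [mem_sdiff, mem_insert, mem_singleton]
      constructor
      · rintro ⟨rfl | h, h'⟩ <;> tauto
      · tauto
    have e2 : insert x B \ insert z A = B \ {z} := by
      ext y; have := hmem y
      simp only [mem_sdiff, mem_insert, mem_singleton]
      constructor
      · rintro ⟨rfl | h, h'⟩ <;> tauto
      · tauto
    rw [e1, e2, hz0]
  · rw [card_insert_of_notMem hzA]; omega
  · rw [card_insert_of_notMem hxB]; omega

variable (G) in
/-- The edges between `A` and its complement are three disjoint edges. -/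
def IsThreeCut (A : Finset V) (a₁ b₁ c₁ a₂ b₂ c₂ : V) : Prop :=
  (a₁ ≠ b₁ ∧ a₁ ≠ c₁ ∧ b₁ ≠ c₁) ∧ (a₂ ≠ b₂ ∧ a₂ ≠ c₂ ∧ b₂ ≠ c₂) ∧
    (a₁ ∈ A ∧ b₁ ∈ A ∧ c₁ ∈ A) ∧ (a₂ ∉ A ∧ b₂ ∉ A ∧ c₂ ∉ A) ∧
    ∀ x ∈ A, ∀ y ∉ A, G.Adj x y ↔ (x = a₁ ∧ y = a₂) ∨ (x = b₁ ∧ y = b₂) ∨ (x = c₁ ∧ y = c₂)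

/-- Exactly three edges cross. Either two of them share an end, which leads to a separating pair, or
they form a matching. -/
theorem Circ.exists_isSep_or_isThreeCut (hG : Circ G) {A : Finset V} (hA : Critical G A)
    (hA' : Critical G Aᶜ) (h2 : 2 ≤ #A) (h2' : 2 ≤ #Aᶜ) :
    (∃ P Q a b, IsSep G P Q a b) ∨ ∃ a₁ b₁ c₁ a₂ b₂ c₂, IsThreeCut G A a₁ b₁ c₁ a₂ b₂ c₂ := by
  classical
  have h4 := hA.four_le_card h2
  have h4' := hA'.four_le_card h2'
  have hcut := hG.cut_eq_three hA hA'
  by_cases hx : ∃ x ∈ A, 2 ≤ adjCount G {x} Aᶜ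
  · obtain ⟨x, hx, hx2⟩ := hx
    exact Or.inl (exists_isSep_of_two_le rfl h4 h4' hcut hx hx2)
  by_cases hy : ∃ y ∈ Aᶜ, 2 ≤ adjCount G {y} A
  · obtain ⟨y, hy, hy2⟩ := hy
    exact Or.inl (exists_isSep_of_two_le (compl_compl A).symm h4' h4
      (by rw [adjCount_comm, hcut]) hy hy2)
  right
  push Not at hx hy
  have huniq : ∀ x ∈ A, ∀ y ∈ Aᶜ, ∀ z ∈ Aᶜ, G.Adj x y → G.Adj x z → y = z := by
    intro x hxA y hyA z hzA hxy hxz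
    by_contra hne
    have h1 : adjCount G {x} {y, z} ≤ adjCount G {x} Aᶜ :=
      adjCount_mono le_rfl (by simp only [insert_subset_iff, singleton_subset_iff]; tauto)
    rw [adjCount_singleton_left, sum_pair hne, adjInd_of_adj hxy, adjInd_of_adj hxz] at h1
    have := hx x hxA
    omega
  have huniq' : ∀ y ∈ Aᶜ, ∀ x ∈ A, ∀ z ∈ A, G.Adj y x → G.Adj y z → x = z := by
    intro y hyA x hxA z hzA hxy hxz
    by_contra hne
    have h1 : adjCount G {y} {x, z} ≤ adjCount G {y} A :=
      adjCount_mono le_rfl (by simp only [insert_subset_iff, singleton_subset_iff]; tauto)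
    rw [adjCount_singleton_left, sum_pair hne, adjInd_of_adj hxy, adjInd_of_adj hxz] at h1
    have := hy y hyA
    omega
  let S : Finset V := {x ∈ A | ∃ y ∈ Aᶜ, G.Adj x y}
  have hS3 : #S = 3 := by
    have h1 : ∀ x ∈ A, adjCount G {x} Aᶜ = if ∃ y ∈ Aᶜ, G.Adj x y then 1 else 0 := by
      intro x hxA
      split_ifs with hex
      · obtain ⟨y, hyA, hxy⟩ := hex
        have h1 : adjCount G {x} {y} ≤ adjCount G {x} Aᶜ :=
          adjCount_mono le_rfl (by simpa using hyA)
        rw [adjCount_singleton, adjInd_of_adj hxy] at h1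
        have := hx x hxA
        omega
      · rw [adjCount_eq_zero_iff]
        push Not at hex
        intro z hz y hyA hzy
        rw [mem_singleton] at hz
        exact hex y hyA (hz ▸ hzy)
    have h2 := sum_adjCount_singleton (G := G) A Aᶜ
    rw [sum_congr rfl h1, hcut] at h2
    have h3 : ((#S : ℕ) : ℤ) = 3 := by
      rw [← h2, card_filter]
      push_cast
      rfl
    exact_mod_cast h3
  obtain ⟨a₁, b₁, c₁, hab, hac, hbc, hS⟩ := card_eq_three.1 hS3
  have hSm : ∀ x, x ∈ S ↔ x ∈ A ∧ ∃ y ∈ Aᶜ, G.Adj x y := by simp [S]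
  obtain ⟨ha₁, a₂, ha₂, haa⟩ := (hSm a₁).1 (by rw [hS]; simp)
  obtain ⟨hb₁, b₂, hb₂, hbb⟩ := (hSm b₁).1 (by rw [hS]; simp)
  obtain ⟨hc₁, c₂, hc₂, hcc⟩ := (hSm c₁).1 (by rw [hS]; simp)
  refine ⟨a₁, b₁, c₁, a₂, b₂, c₂, ⟨hab, hac, hbc⟩, ⟨?_, ?_, ?_⟩, ⟨ha₁, hb₁, hc₁⟩,
    ⟨by simpa using ha₂, by simpa using hb₂, by simpa using hc₂⟩, fun x hxA y hyA => ⟨?_, ?_⟩⟩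
  · rintro rfl; exact hab (huniq' a₂ ha₂ a₁ ha₁ b₁ hb₁ haa.symm hbb.symm)
  · rintro rfl; exact hac (huniq' a₂ ha₂ a₁ ha₁ c₁ hc₁ haa.symm hcc.symm)
  · rintro rfl; exact hbc (huniq' b₂ hb₂ b₁ hb₁ c₁ hc₁ hbb.symm hcc.symm)
  · intro hxy
    have hyA' : y ∈ Aᶜ := by simpa using hyA
    have hxS : x ∈ S := (hSm x).2 ⟨hxA, y, hyA', hxy⟩
    rw [hS] at hxS
    simp only [mem_insert, mem_singleton] at hxS
    rcases hxS with rfl | rfl | rfl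
    · exact Or.inl ⟨rfl, huniq _ ha₁ _ hyA' _ ha₂ hxy haa⟩
    · exact Or.inr (Or.inl ⟨rfl, huniq _ hb₁ _ hyA' _ hb₂ hxy hbb⟩)
    · exact Or.inr (Or.inr ⟨rfl, huniq _ hc₁ _ hyA' _ hc₂ hxy hcc⟩)
  · rintro (⟨rfl, rfl⟩ | ⟨rfl, rfl⟩ | ⟨rfl, rfl⟩) <;> assumption

/-- One side of a cut with three disjoint edges, with a new vertex in place of the other side. -/
theorem circ_contract_side (hG : Circ G) {A B : Finset V} (hB : B = Aᶜ) (hA : Critical G A)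
    (hB' : Critical G B) {a b c : V} (hab : a ≠ b) (hac : a ≠ c) (hbc : b ≠ c) (ha : a ∈ A)
    (hb : b ∈ A) (hc : c ∈ A) (hadj : ∀ x ∈ A, ∀ y ∈ B, G.Adj x y → x = a ∨ x = b ∨ x = c) :
    Circ (addVertex (G.comap (Subtype.val : A → V)) {⟨a, ha⟩, ⟨b, hb⟩, ⟨c, hc⟩}) := by
  have hcount : ∀ X : Finset A, adjCount (G.comap (Subtype.val : A → V)) X X =
      adjCount G (X.map (.subtype _)) (X.map (.subtype _)) := fun X => by
    rw [adjCount_map]; rfl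
  have huniv : (univ : Finset A).map (.subtype _) = A := by ext x; simp
  have hsub : ∀ X : Finset A, X.map (.subtype _) ⊆ A := fun X x hx => by
    obtain ⟨y, -, rfl⟩ := mem_map.1 hx; exact y.2
  have hBne := hB'.nonempty
  have hcut : adjCount G A B = 3 := by rw [hB] at hB' ⊢; exact hG.cut_eq_three hA hB'
  have hdis : Disjoint A B := by rw [hB]; exact disjoint_compl_right
  refine circ_addVertex_triple (by simpa) (by simpa) (by simpa) ?_ (fun X hX => ?_)
    fun X hX' ma mb mc => ?_
  · rw [hcount, huniv, hA, Fintype.card_coe]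
  · rw [hcount, ← card_map (.subtype _)]
    refine hG.2 _ (by simpa using hX) fun h => ?_
    obtain ⟨y, hy⟩ := hBne
    have := hsub X (h ▸ mem_univ y)
    exact Finset.disjoint_left.1 hdis this hy
  · rw [hcount, ← card_map (.subtype _)]
    obtain ⟨Y, hY⟩ : ∃ Y, Y = X.map (.subtype _) := ⟨_, rfl⟩
    rw [← hY]
    have hYA : Y ⊆ A := hY ▸ hsub X
    have hd : Disjoint Y B := disjoint_of_subset_left hYA hdis
    have ma' : a ∈ Y := by rw [hY]; simpa using ⟨ha, ma⟩
    have mb' : b ∈ Y := by rw [hY]; simpa using ⟨hb, mb⟩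
    have mc' : c ∈ Y := by rw [hY]; simpa using ⟨hc, mc⟩
    have hYcut : adjCount G Y B = 3 := by
      have h1 := adjCount_union_left (G := G) (disjoint_sdiff (s := Y) (t := A)) B
      have h2 : adjCount G (A \ Y) B = 0 := by
        rw [adjCount_eq_zero_iff]
        intro x hx y hy hxy
        rw [mem_sdiff] at hx
        rcases hadj x hx.1 y hy hxy with rfl | rfl | rfl <;> tauto
      rw [union_sdiff_of_subset hYA, h2, hcut] at h1
      omega
    -- Restoring the critical side `B` together with all three cut edges gives a proper set of `G`;
    -- its bound improves that of `Y` to `4#Y - 6`.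
    have h1 := hG.2 (Y ∪ B) ⟨a, mem_union_left _ ma'⟩ fun h => by
      apply hX'
      rw [eq_univ_iff_forall]
      rintro ⟨x, hx⟩
      have h1 : x ∈ Y ∪ B := by rw [h]; simp
      have h2 : x ∉ B := Finset.disjoint_left.1 hdis hx
      have h3 : x ∈ Y := by grind
      rw [hY] at h3
      simpa [hx] using h3
    rw [adjCount_union_self hd, card_union_of_disjoint hd, hYcut, hB'] at h1
    push_cast at h1
    omega

theorem generated_of_isThreeCut (hG : Circ G) {A : Finset V} (hA : Critical G A)
    (hA' : Critical G Aᶜ) (h2 : 2 ≤ #A) (h2' : 2 ≤ #Aᶜ) {a₁ b₁ c₁ a₂ b₂ c₂ : V}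
    (h : IsThreeCut G A a₁ b₁ c₁ a₂ b₂ c₂) (ih : GeneratedBelow.{u} (Fintype.card V)) :
    Generated G := by
  obtain ⟨⟨hab₁, hac₁, hbc₁⟩, ⟨hab₂, hac₂, hbc₂⟩, ⟨ha₁, hb₁, hc₁⟩, ⟨ha₂, hb₂, hc₂⟩, hadj⟩ := h
  have ha₂' : a₂ ∈ Aᶜ := by simpa using ha₂
  have hb₂' : b₂ ∈ Aᶜ := by simpa using hb₂
  have hc₂' : c₂ ∈ Aᶜ := by simpa using hc₂
  have hC₁ := circ_contract_side hG rfl hA hA' hab₁ hac₁ hbc₁ ha₁ hb₁ hc₁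
    fun x hx y hy hxy => by
      have := (hadj x hx y (by simpa using hy)).1 hxy
      tauto
  have hC₂ := circ_contract_side hG (compl_compl A).symm hA' hA hab₂ hac₂ hbc₂ ha₂' hb₂' hc₂'
    fun y hy x hx hxy => by
      have := (hadj x hx y (by simpa using hy)).1 hxy.symm
      tauto
  have hcard := card_add_card_compl A
  have hg₁ := ih _ _ (by rw [Fintype.card_option, Fintype.card_coe]; omega) hC₁
  have hg₂ := ih _ _ (by rw [Fintype.card_option, Fintype.card_coe]; omega) hC₂
  have hgen := (hg₁.disjoint hg₂).threeSum
    (isNode_addVertex (by simpa) (by simpa) (by simpa)).sum_inl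
    (isNode_addVertex (by simpa) (by simpa) (by simpa)).sum_inr (not_reachable_sum_inl_inr _ _)
  -- The 3-sum deletes both copies of `none`, so the value `a₁` there is a dummy.
  let Ψ : Option A ⊕ Option (Aᶜ : Finset V) → V :=
    Sum.elim (fun o => o.elim a₁ Subtype.val) fun o => o.elim a₁ Subtype.val
  have key := nonempty_iso_induce_map (G := G)
    ((addVertex (G.comap (Subtype.val : A → V)) {⟨a₁, ha₁⟩, ⟨b₁, hb₁⟩, ⟨c₁, hc₁⟩} ⊕g
      addVertex (G.comap (Subtype.val : (Aᶜ : Finset V) → V)) {⟨a₂, ha₂'⟩, ⟨b₂, hb₂'⟩, ⟨c₂, hc₂'⟩})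
      ⊔ edge (Sum.inl (some ⟨a₁, ha₁⟩)) (Sum.inr (some ⟨a₂, ha₂'⟩))
      ⊔ edge (Sum.inl (some ⟨b₁, hb₁⟩)) (Sum.inr (some ⟨b₂, hb₂'⟩))
      ⊔ edge (Sum.inl (some ⟨c₁, hc₁⟩)) (Sum.inr (some ⟨c₂, hc₂'⟩)))
    id {Sum.inl none, Sum.inr none} Ψ ?_ ?_ ?_ ?_ ?_
  · rw [SimpleGraph.map_id] at key
    obtain ⟨e⟩ := key
    exact hgen.iso e
  · rintro ((_ | ⟨x, hx⟩) | (_ | ⟨x, hx⟩)) hs ((_ | ⟨y, hy⟩) | (_ | ⟨y, hy⟩)) ht hxy <;>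
      first
      | (simp at hs; done)
      | (simp at ht; done)
      | (simp only [Ψ, Sum.elim_inl, Sum.elim_inr, Option.elim_some] at hxy
         subst hxy
         first | rfl | exact absurd hx (mem_compl.1 hy) | exact absurd hy (mem_compl.1 hx))
  · intro x
    by_cases hx : x ∈ A
    · exact ⟨.inl (some ⟨x, hx⟩), by simp, rfl⟩
    · exact ⟨.inr (some ⟨x, by simpa using hx⟩), by simp, rfl⟩
  · intro s; rfl
  · have e₁ : G.Adj a₁ a₂ := (hadj a₁ ha₁ a₂ ha₂).2 (by simp)
    have e₂ : G.Adj b₁ b₂ := (hadj b₁ hb₁ b₂ hb₂).2 (by simp)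
    have e₃ : G.Adj c₁ c₂ := (hadj c₁ hc₁ c₂ hc₂).2 (by simp)
    intro u v huv hu hv
    simp only [id] at hu hv
    simp only [sup_adj] at huv
    rcases huv with ((huv | huv) | huv) | huv
    · rcases u with (_ | u) | (_ | u) <;> rcases v with (_ | v) | (_ | v) <;>
        simp at hu hv huv <;> exact huv
    all_goals
      rw [edge_adj] at huv
      rcases huv with ⟨⟨rfl, rfl⟩ | ⟨rfl, rfl⟩, -⟩ <;> first | assumption | (symm; assumption)
  · have hcross : ∀ x y, x ∈ A → y ∉ A → G.Adj x y → ∃ (hx : x ∈ A) (hy : y ∈ Aᶜ),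
        ((x = a₁ ∧ y = a₂) ∨ (x = b₁ ∧ y = b₂) ∨ (x = c₁ ∧ y = c₂)) := fun x y hx hy hxy =>
      ⟨hx, by simpa using hy, (hadj x hx y hy).1 hxy⟩
    intro x y hxy
    by_cases hx : x ∈ A <;> by_cases hy : y ∈ A
    · exact ⟨.inl (some ⟨x, hx⟩), .inl (some ⟨y, hy⟩), by simp [hxy], by simp, by simp, rfl, rfl⟩
    · obtain ⟨hx', hy', h⟩ := hcross x y hx hy hxy
      refine ⟨.inl (some ⟨x, hx⟩), .inr (some ⟨y, hy'⟩), ?_, by simp, by simp, rfl, rfl⟩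
      rcases h with ⟨rfl, rfl⟩ | ⟨rfl, rfl⟩ | ⟨rfl, rfl⟩ <;> simp [edge_adj]
    · obtain ⟨hy', hx', h⟩ := hcross y x hy hx hxy.symm
      refine ⟨.inr (some ⟨x, hx'⟩), .inl (some ⟨y, hy⟩), ?_, by simp, by simp, rfl, rfl⟩
      rcases h with ⟨rfl, rfl⟩ | ⟨rfl, rfl⟩ | ⟨rfl, rfl⟩ <;> simp [edge_adj]
    · exact ⟨.inr (some ⟨x, by simpa using hx⟩), .inr (some ⟨y, by simpa using hy⟩),
        by simp [hxy], by simp, by simp, rfl, rfl⟩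

end Partition

/-! ### Counts in induced subgraphs -/

section Comap
variable {V : Type u} {P : Finset V}

theorem adjCount_comap_coe (H : SimpleGraph V) (X : Finset P) :
    adjCount (H.comap (Subtype.val : P → V)) X X =
      adjCount H (X.map (.subtype _)) (X.map (.subtype _)) := by
  rw [adjCount_map]; rfl

theorem map_subtype_univ : (univ : Finset P).map (.subtype _) = P := by ext x; simp

theorem map_subtype_subset (X : Finset P) : X.map (.subtype _) ⊆ P := fun x hx => by
  obtain ⟨y, -, rfl⟩ := mem_map.1 hx; exact y.2

theorem map_subtype_ne {X : Finset P} (hX : X ≠ univ) : X.map (.subtype _) ≠ P := fun h =>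
  hX (map_injective (.subtype _) (h.trans map_subtype_univ.symm))

variable {a b : V}

theorem circ_withPendant_comap {H : SimpleGraph V} (hab : a ≠ b) (ha : a ∈ P) (hb : b ∈ P)
    (h₀ : adjCount H P P = 4 * #P - 4)
    (h₁ : ∀ X ⊆ P, X.Nonempty → adjCount H X X ≤ 4 * #X - 4)
    (h₂ : ∀ X ⊆ P, X ≠ P → a ∈ X → b ∈ X → adjCount H X X ≤ 4 * #X - 6) :
    Circ (withPendant (H.comap (Subtype.val : P → V)) ⟨a, ha⟩ ⟨b, hb⟩) := by
  refine circ_withPendant (by simpa) ?_ (fun X hX => ?_) fun X hX ma mb => ?_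
  · rw [adjCount_comap_coe, map_subtype_univ, h₀, Fintype.card_coe]
  · rw [adjCount_comap_coe, ← card_map (.subtype _)]
    exact h₁ _ (map_subtype_subset X) (by simpa using hX)
  · rw [adjCount_comap_coe, ← card_map (.subtype _)]
    exact h₂ _ (map_subtype_subset X) (map_subtype_ne hX) (by simpa using ⟨ha, ma⟩)
      (by simpa using ⟨hb, mb⟩)

theorem circ_comap {H : SimpleGraph V} (h₀ : adjCount H P P = 4 * #P - 2)
    (h₁ : ∀ X ⊆ P, X.Nonempty → X ≠ P → adjCount H X X ≤ 4 * #X - 4) :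
    Circ (H.comap (Subtype.val : P → V)) := by
  refine ⟨?_, fun X hX hX' => ?_⟩
  · rw [adjCount_comap_coe, map_subtype_univ, h₀, Fintype.card_coe]
  · rw [adjCount_comap_coe, ← card_map (.subtype _)]
    exact h₁ _ (map_subtype_subset X) (by simpa using hX) (map_subtype_ne hX')

end Comap

/-! ### Counting across a separating pair -/

section Separation
variable {V : Type u} [Fintype V] [DecidableEq V] {G : SimpleGraph V} {P Q : Finset V} {a b : V}

theorem IsSep.symm (h : IsSep G P Q a b) : IsSep G Q P a b := by
  obtain ⟨h1, h2, h3, h4, h5⟩ := h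
  exact ⟨by rwa [union_comm], by rwa [inter_comm], h3, by rwa [adjCount_comm],
    h5.imp (fun h => ⟨h.1, h.2.2, h.2.1⟩) fun h => ⟨h.2, h.1⟩⟩

theorem IsSep.mem (h : IsSep G P Q a b) : a ∈ P ∧ a ∈ Q ∧ b ∈ P ∧ b ∈ Q := by
  have h1 : a ∈ P ∩ Q := by rw [h.2.1]; simp
  have h2 : b ∈ P ∩ Q := by rw [h.2.1]; simp
  rw [mem_inter] at h1 h2
  exact ⟨h1.1, h1.2, h2.1, h2.2⟩

theorem IsSep.three_le (h : IsSep G P Q a b) : 3 ≤ #P ∧ 3 ≤ #Q := by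
  obtain h | h := h.2.2.2.2
  · exact h.2
  · omega

theorem IsSep.card_add_card (h : IsSep G P Q a b) : #P + #Q = Fintype.card V + 2 := by
  have := card_union_add_card_inter P Q
  rw [h.1, h.2.1, card_pair h.2.2.1, card_univ] at this
  exact this.symm

theorem IsSep.adjCount_union (h : IsSep G P Q a b) {X : Finset V} (hX : X ⊆ P) (ha : a ∈ X)
    (hb : b ∈ X) : adjCount G (X ∪ Q) (X ∪ Q) + adjCount G {a, b} {a, b} =
      adjCount G X X + adjCount G Q Q ∧ #(X ∪ Q) + 2 = #X + #Q := by
  have hm := h.mem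
  obtain ⟨-, hI, hab, h0, -⟩ := h
  have hXQ : X ∩ Q = {a, b} := by
    refine subset_antisymm (hI ▸ inter_subset_inter_right hX) ?_
    simp only [insert_subset_iff, singleton_subset_iff, mem_inter]
    tauto
  have hz : adjCount G (X \ Q) (Q \ X) = 0 := by
    refine le_antisymm ?_ (adjCount_nonneg _ _)
    rw [← h0]
    refine adjCount_mono (sdiff_subset_sdiff hX le_rfl) fun y hy => ?_
    rw [mem_sdiff] at hy ⊢
    refine ⟨hy.1, fun hyP => hy.2 ?_⟩
    have : y ∈ P ∩ Q := mem_inter.2 ⟨hyP, hy.1⟩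
    rw [hI, mem_insert, mem_singleton] at this
    rcases this with rfl | rfl <;> assumption
  have h1 := adjCount_union_add_inter (G := G) X Q
  have h2 := card_union_add_card_inter X Q
  rw [hXQ] at h1 h2
  rw [card_pair hab] at h2
  exact ⟨by omega, h2⟩

theorem IsSep.adjCount_add_adjCount (h : IsSep G P Q a b) (hG : Circ G) :
    adjCount G P P + adjCount G Q Q = 4 * #P + 4 * #Q - 10 + adjCount G {a, b} {a, b} := by
  have h1 := (h.adjCount_union subset_rfl h.mem.1 h.mem.2.2.1).1
  have h2 := h.card_add_card
  rw [h.1, hG.1] at h1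
  omega

/-- Completing `X` by all of `Q` still gives a proper set, so sets containing both `a` and `b` obey
a bound sharper than their own. -/
theorem IsSep.adjCount_le (h : IsSep G P Q a b) (hG : Circ G) {X : Finset V} (hX : X ⊆ P)
    (hXP : X ≠ P) (ha : a ∈ X) (hb : b ∈ X) :
    adjCount G X X + adjCount G Q Q ≤ 4 * #X + 4 * #Q - 12 + adjCount G {a, b} {a, b} := by
  obtain ⟨h1, h2⟩ := h.adjCount_union hX ha hb
  have h3 := hG.2 (X ∪ Q) ⟨a, mem_union_left _ ha⟩ fun hu => by
    apply hXP
    refine subset_antisymm hX fun y hy => ?_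
    by_cases hyQ : y ∈ Q
    · have : y ∈ P ∩ Q := mem_inter.2 ⟨hy, hyQ⟩
      rw [h.2.1, mem_insert, mem_singleton] at this
      rcases this with rfl | rfl <;> assumption
    · have : y ∈ X ∪ Q := by rw [hu]; simp
      simpa [hyQ] using this
  omega

theorem IsSep.adjCount_self_le (h : IsSep G P Q a b) (hG : Circ G) {X : Finset V} (hX : X ⊆ P)
    (hne : X.Nonempty) : adjCount G X X ≤ 4 * #X - 4 := by
  refine hG.2 X hne fun hu => ?_
  have h1 := h.card_add_card
  have h2 := h.three_le.2
  have h3 := card_le_card hX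
  rw [hu, card_univ] at h3
  omega

theorem IsSep.exists_ne (h : IsSep G P Q a b) : ∃ x ∈ P, x ≠ a ∧ x ≠ b := by
  by_contra! hx
  have h1 : P ⊆ {a, b} := fun x hxP => by
    by_cases hxa : x = a
    · simp [hxa]
    · simp [hx x hxP hxa]
  have h2 := card_le_card h1
  have h3 := h.three_le.1
  rw [card_pair h.2.2.1] at h2
  omega

theorem IsSep.isPendantK4 (h : IsSep G P Q a b) {H : SimpleGraph V} (ha : a ∈ P) (hb : b ∈ P)
    (hab : H.Adj a b)
    (hC : Circ (withPendant (H.comap (Subtype.val : P → V)) ⟨a, ha⟩ ⟨b, hb⟩)) :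
    IsPendantK4 (withPendant (H.comap (Subtype.val : P → V)) ⟨a, ha⟩ ⟨b, hb⟩)
      (some (some ⟨a, ha⟩)) (some (some ⟨b, hb⟩)) (some none) none := by
  obtain ⟨x, hx, hxa, hxb⟩ := h.exists_ne
  exact isPendantK4_withPendant (by simpa using hab)
    ⟨⟨x, hx⟩, hC.reachable _ _, by simpa using hxa, by simpa using hxb⟩

theorem IsSep.mem_or_mem (h : IsSep G P Q a b) {x y : V} (hxy : G.Adj x y) :
    (x ∈ P ∧ y ∈ P) ∨ (x ∈ Q ∧ y ∈ Q) := by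
  have h0 := adjCount_eq_zero_iff.1 h.2.2.2.1
  have hx : x ∈ P ∪ Q := by rw [h.1]; simp
  have hy : y ∈ P ∪ Q := by rw [h.1]; simp
  have h1 := h0 x
  have h2 := h0 y
  simp only [mem_sdiff, mem_union] at *
  by_contra! hc
  by_cases hxP : x ∈ P
  · exact h1 ⟨hxP, by tauto⟩ y (by tauto) hxy
  · exact h2 (by tauto) x (by tauto) hxy.symm

theorem IsSep.eq_or_eq (h : IsSep G P Q a b) {x : V} (hP : x ∈ P) (hQ : x ∈ Q) :
    x = a ∨ x = b := by
  have : x ∈ P ∩ Q := mem_inter.2 ⟨hP, hQ⟩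
  simpa [h.2.1] using this

theorem IsSep.mem_or (h : IsSep G P Q a b) (x : V) : x ∈ P ∨ x ∈ Q := by
  rw [← mem_union, h.1]; simp

end Separation

/-! ### Undoing 1-sums and 2-sums, and the induction -/

section Sums
variable {V : Type u} [Fintype V] [DecidableEq V] {G : SimpleGraph V} {P Q : Finset V} {a b : V}

theorem apply_glue {S T : Type*} {f : S → T} {a₁ b₁ a₂ b₂ : S} (hn : a₂ ≠ b₂) (ha : f a₂ = f a₁)
    (hb : f b₂ = f b₁) (s : S) : f (glue a₁ b₁ a₂ b₂ s) = f s := by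
  by_cases h₁ : s = a₂
  · subst h₁; rw [glue_left hn, ha]
  by_cases h₂ : s = b₂
  · subst h₂; rw [glue_right, hb]
  rw [glue_of_ne h₁ h₂]

/-- Adding `ab` turns `P` into a circuit. On `Q` it leaves the count at `4#Q - 4`, and a pendant
`K₄` supplies the rest. The 1-sum of the two circuits is `G`. -/
theorem IsSep.generated_of_not_adj (h : IsSep G P Q a b) (hG : Circ G) (hab : ¬ G.Adj a b)
    (hP : adjCount G P P = 4 * #P - 4) (hQ : adjCount G Q Q = 4 * #Q - 6)
    (ih : GeneratedBelow.{u} (Fintype.card V)) : Generated G := by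
  obtain ⟨haP, haQ, hbP, hbQ⟩ := h.mem
  have hne := h.2.2.1
  have h3 := h.three_le
  have hcard := h.card_add_card
  -- A set of at most four vertices with a nonadjacent pair cannot have count `4#P - 4`. Five
  -- vertices are needed for `#Q + 2 < |V| = #P + #Q - 2`.
  have hP5 : 5 ≤ #P := by
    have h1 := adjCount_self_le_of_not_adj haP hbP hne hab
    have h2 := h3.1
    rw [hP] at h1
    by_contra! hlt
    obtain hlt | hlt : #P = 3 ∨ #P = 4 := by omega
    all_goals rw [hlt] at h1; norm_num at h1
  have hz : adjCount G {a, b} {a, b} = 0 := by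
    rw [adjCount_eq_zero_iff]
    simp [hab, G.adj_comm b a]
  have hcount := adjCount_sup_edge hne hab
  have hC₁ : Circ ((G ⊔ edge a b).comap (Subtype.val : P → V)) := by
    refine circ_comap ?_ fun X hX hX0 hXP => ?_
    · rw [hcount, hP]; simp [haP, hbP]; ring
    · rw [hcount]
      split_ifs with hm
      · have := h.adjCount_le hG hX hXP hm.1 hm.2
        omega
      · have := h.adjCount_self_le hG hX hX0
        omega
  have hC₂ : Circ (withPendant ((G ⊔ edge a b).comap (Subtype.val : Q → V)) ⟨a, haQ⟩ ⟨b, hbQ⟩) := by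
    have hle : ∀ X ⊆ Q, X ≠ Q → a ∈ X → b ∈ X → adjCount G X X + 2 ≤ 4 * #X - 6 :=
      fun X hX hXQ ha hb => by
        have := h.symm.adjCount_le hG hX hXQ ha hb
        omega
    refine circ_withPendant_comap hne haQ hbQ ?_ (fun X hX hX0 => ?_) fun X hX hXQ ha hb => ?_
    · rw [hcount, hQ]; simp [haQ, hbQ]; ring
    · rw [hcount]
      split_ifs with hm
      · by_cases hXQ : X = Q
        · subst hXQ; omega
        · have := hle X hX hXQ hm.1 hm.2
          omega
      · have := h.symm.adjCount_self_le hG hX hX0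
        omega
    · rw [hcount, if_pos ⟨ha, hb⟩]
      exact hle X hX hXQ ha hb
  have hg₁ := ih _ _ (by rw [Fintype.card_coe]; omega) hC₁
  have hg₂ := ih _ _ (by rw [Fintype.card_option, Fintype.card_option, Fintype.card_coe]; omega) hC₂
  have hgen := (hg₁.disjoint hg₂).oneSum (a₁ := .inl ⟨a, haP⟩) (b₁ := .inl ⟨b, hbP⟩)
    (by simp [edge_adj, hne])
    (h.symm.isPendantK4 haQ hbQ (by simp [edge_adj, hne]) hC₂).sum_inr
    (not_reachable_sum_inl_inr _ _)
  -- The two pendant vertices are deleted, so their value `a` is a dummy; both copies of `a`, and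
  -- both of `b`, have equal images.
  let Ψ : P ⊕ Option (Option Q) → V :=
    Sum.elim Subtype.val fun o => o.elim a fun o => o.elim a Subtype.val
  have key := nonempty_iso_induce_map (G := G)
    (((G ⊔ edge a b).comap (Subtype.val : P → V) ⊕g
      withPendant ((G ⊔ edge a b).comap (Subtype.val : Q → V)) ⟨a, haQ⟩ ⟨b, hbQ⟩).deleteEdges
      {s(.inl ⟨a, haP⟩, .inl ⟨b, hbP⟩), s(.inr (some (some ⟨a, haQ⟩)), .inr (some (some ⟨b, hbQ⟩)))})
    (glue (Sum.inl ⟨a, haP⟩) (Sum.inl ⟨b, hbP⟩) (Sum.inr (some (some ⟨a, haQ⟩)))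
      (Sum.inr (some (some ⟨b, hbQ⟩))))
    {Sum.inr (some (some ⟨a, haQ⟩)), Sum.inr (some (some ⟨b, hbQ⟩)), Sum.inr (some none),
      Sum.inr none} Ψ ?_ ?_ ?_ ?_ ?_
  · obtain ⟨e⟩ := key
    exact hgen.iso e
  · rintro (⟨x, hx⟩ | _ | _ | ⟨x, hx⟩) hs (⟨y, hy⟩ | _ | _ | ⟨y, hy⟩) ht hxy
    all_goals
      first
      | (simp at hs; done)
      | (simp at ht; done)
      | (simp only [Ψ, Sum.elim_inl, Sum.elim_inr, Option.elim_some] at hxy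
         subst hxy
         first
         | rfl
         | (obtain rfl | rfl := h.eq_or_eq ‹_ ∈ P› ‹_ ∈ Q› <;> first | (simp at hs; done) | simp at ht))
  · intro x
    by_cases hxP : x ∈ P
    · exact ⟨.inl ⟨x, hxP⟩, by simp, rfl⟩
    · have hxQ := (h.mem_or x).resolve_left hxP
      exact ⟨.inr (some (some ⟨x, hxQ⟩)), by
        simpa using ⟨by rintro rfl; exact hxP haP, by rintro rfl; exact hxP hbP⟩, rfl⟩
  · exact apply_glue (by simpa using hne) rfl rfl
  · rintro (⟨x, hx⟩ | _ | _ | ⟨x, hx⟩) (⟨y, hy⟩ | _ | _ | ⟨y, hy⟩) huv hu hv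
    all_goals
      first
      | (exfalso; apply hu; rw [glue_of_ne] <;> simp; done)
      | (exfalso; apply hv; rw [glue_of_ne] <;> simp; done)
      | (simp [edge_adj, withPendant] at huv; done)
      | skip
    · simp [edge_adj] at huv
      simp only [Ψ, Sum.elim_inl]
      tauto
    · simp [edge_adj, withPendant] at huv
      simp only [Ψ, Sum.elim_inr, Option.elim_some]
      tauto
  · have hr : ∀ x (hx : x ∈ Q), glue (Sum.inl ⟨a, haP⟩) (Sum.inl ⟨b, hbP⟩)
        (Sum.inr (some (some ⟨a, haQ⟩))) (Sum.inr (some (some ⟨b, hbQ⟩)))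
        (Sum.inr (some (some ⟨x, hx⟩))) ∉
        ({Sum.inr (some (some ⟨a, haQ⟩)), Sum.inr (some (some ⟨b, hbQ⟩)), Sum.inr (some none),
          Sum.inr none} : Set (P ⊕ Option (Option Q))) := by
      intro x hx
      by_cases hxa : x = a
      · subst hxa; rw [glue_left (by simpa using hne)]; simp
      by_cases hxb : x = b
      · subst hxb; rw [glue_right]; simp
      rw [glue_of_ne] <;> simp [hxa, hxb]
    intro x y hxy
    have hns : ¬ ((x = a ∧ y = b) ∨ (x = b ∧ y = a)) := by
      rintro (⟨rfl, rfl⟩ | ⟨rfl, rfl⟩)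
      · exact hab hxy
      · exact hab hxy.symm
    obtain ⟨hx, hy⟩ | ⟨hx, hy⟩ := h.mem_or_mem hxy
    · exact ⟨.inl ⟨x, hx⟩, .inl ⟨y, hy⟩, by simp [hxy]; tauto,
        by rw [glue_of_ne] <;> simp, by rw [glue_of_ne] <;> simp, rfl, rfl⟩
    · exact ⟨.inr (some (some ⟨x, hx⟩)), .inr (some (some ⟨y, hy⟩)),
        by simp [hxy, withPendant]; tauto, hr x hx, hr y hy, rfl, rfl⟩

/-- As `ab` is counted on both sides, the two counts sum to `4#P + 4#Q - 8`, so both sides are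
critical. Each becomes a circuit by a pendant `K₄`, and it is smaller than `G` because the other
side has at least five vertices. -/
theorem IsSep.generated_of_adj (h : IsSep G P Q a b) (hG : Circ G) (hab : G.Adj a b)
    (ih : GeneratedBelow.{u} (Fintype.card V)) : Generated G := by
  obtain ⟨haP, haQ, hbP, hbQ⟩ := h.mem
  have hne := h.2.2.1
  have hcard := h.card_add_card
  obtain ⟨hP5, hQ5⟩ : 5 ≤ #P ∧ 5 ≤ #Q := by
    have := h.2.2.2.2
    tauto
  have hz : adjCount G {a, b} {a, b} = 2 := by
    rw [adjCount_clique (by simp [hab, hab.symm]), card_pair hne]; norm_num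
  have hsum := h.adjCount_add_adjCount hG
  have hP1 := h.adjCount_self_le hG subset_rfl ⟨a, haP⟩
  have hQ1 := h.symm.adjCount_self_le hG subset_rfl ⟨a, haQ⟩
  have hC₁ : Circ (withPendant (G.comap (Subtype.val : P → V)) ⟨a, haP⟩ ⟨b, hbP⟩) := by
    refine circ_withPendant_comap hne haP hbP (by omega) (fun X hX hX0 => h.adjCount_self_le hG hX hX0)
      fun X hX hXP ha hb => ?_
    have := h.adjCount_le hG hX hXP ha hb
    omega
  have hC₂ : Circ (withPendant (G.comap (Subtype.val : Q → V)) ⟨a, haQ⟩ ⟨b, hbQ⟩) := by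
    refine circ_withPendant_comap hne haQ hbQ (by omega)
      (fun X hX hX0 => h.symm.adjCount_self_le hG hX hX0) fun X hX hXP ha hb => ?_
    have := h.symm.adjCount_le hG hX hXP ha hb
    omega
  have hg₁ := ih _ _ (by rw [Fintype.card_option, Fintype.card_option, Fintype.card_coe]; omega) hC₁
  have hg₂ := ih _ _ (by rw [Fintype.card_option, Fintype.card_option, Fintype.card_coe]; omega) hC₂
  have hgen := (hg₁.disjoint hg₂).twoSum (h.isPendantK4 haP hbP hab hC₁).sum_inl
    (h.symm.isPendantK4 haQ hbQ hab hC₂).sum_inr (not_reachable_sum_inl_inr _ _)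
  let Ψ : Option (Option P) ⊕ Option (Option Q) → V :=
    Sum.elim (fun o => o.elim a fun o => o.elim a Subtype.val)
      fun o => o.elim a fun o => o.elim a Subtype.val
  have key := nonempty_iso_induce_map (G := G)
    (withPendant (G.comap (Subtype.val : P → V)) ⟨a, haP⟩ ⟨b, hbP⟩ ⊕g
      withPendant (G.comap (Subtype.val : Q → V)) ⟨a, haQ⟩ ⟨b, hbQ⟩)
    (glue (Sum.inl (some (some ⟨a, haP⟩))) (Sum.inl (some (some ⟨b, hbP⟩)))
      (Sum.inr (some (some ⟨a, haQ⟩))) (Sum.inr (some (some ⟨b, hbQ⟩))))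
    {Sum.inl (some none), Sum.inl none, Sum.inr (some (some ⟨a, haQ⟩)),
      Sum.inr (some (some ⟨b, hbQ⟩)), Sum.inr (some none), Sum.inr none} Ψ ?_ ?_ ?_ ?_ ?_
  · obtain ⟨e⟩ := key
    exact hgen.iso e
  · rintro ((_ | _ | ⟨x, hx⟩) | _ | _ | ⟨x, hx⟩) hs ((_ | _ | ⟨y, hy⟩) | _ | _ | ⟨y, hy⟩) ht hxy
    all_goals
      first
      | (simp at hs; done)
      | (simp at ht; done)
      | (simp only [Ψ, Sum.elim_inl, Sum.elim_inr, Option.elim_some] at hxy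
         subst hxy
         first
         | rfl
         | (obtain rfl | rfl := h.eq_or_eq ‹_ ∈ P› ‹_ ∈ Q› <;> first | (simp at hs; done) | simp at ht))
  · intro x
    by_cases hxP : x ∈ P
    · exact ⟨.inl (some (some ⟨x, hxP⟩)), by simp, rfl⟩
    · have hxQ := (h.mem_or x).resolve_left hxP
      exact ⟨.inr (some (some ⟨x, hxQ⟩)), by
        simpa using ⟨by rintro rfl; exact hxP haP, by rintro rfl; exact hxP hbP⟩, rfl⟩
  · exact apply_glue (by simpa using hne) rfl rfl
  · rintro ((_ | _ | ⟨x, hx⟩) | _ | _ | ⟨x, hx⟩) ((_ | _ | ⟨y, hy⟩) | _ | _ | ⟨y, hy⟩) huv hu hv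
    all_goals
      first
      | (exfalso; apply hu; rw [glue_of_ne] <;> simp; done)
      | (exfalso; apply hv; rw [glue_of_ne] <;> simp; done)
      | (simp [withPendant] at huv; done)
      | simpa [withPendant, Ψ] using huv
  · have hr : ∀ x (hx : x ∈ Q), glue (Sum.inl (some (some ⟨a, haP⟩)))
        (Sum.inl (some (some ⟨b, hbP⟩))) (Sum.inr (some (some ⟨a, haQ⟩))) (Sum.inr (some (some ⟨b, hbQ⟩)))
        (Sum.inr (some (some ⟨x, hx⟩))) ∉
        ({Sum.inl (some none), Sum.inl none, Sum.inr (some (some ⟨a, haQ⟩)),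
          Sum.inr (some (some ⟨b, hbQ⟩)), Sum.inr (some none), Sum.inr none} :
            Set (Option (Option P) ⊕ Option (Option Q))) := by
      intro x hx
      by_cases hxa : x = a
      · subst hxa; rw [glue_left (by simpa using hne)]; simp
      by_cases hxb : x = b
      · subst hxb; rw [glue_right]; simp
      rw [glue_of_ne] <;> simp [hxa, hxb]
    intro x y hxy
    obtain ⟨hx, hy⟩ | ⟨hx, hy⟩ := h.mem_or_mem hxy
    · exact ⟨.inl (some (some ⟨x, hx⟩)), .inl (some (some ⟨y, hy⟩)), by simp [hxy, withPendant],
        by rw [glue_of_ne] <;> simp, by rw [glue_of_ne] <;> simp, rfl, rfl⟩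
    · exact ⟨.inr (some (some ⟨x, hx⟩)), .inr (some (some ⟨y, hy⟩)),
        by simp [hxy, withPendant], hr x hx, hr y hy, rfl, rfl⟩

theorem generated_of_isSep (hG : Circ G) (h : IsSep G P Q a b)
    (ih : GeneratedBelow.{u} (Fintype.card V)) : Generated G := by
  by_cases hab : G.Adj a b
  · exact h.generated_of_adj hG hab ih
  have hz : adjCount G {a, b} {a, b} = 0 := by
    rw [adjCount_eq_zero_iff]
    simp [hab, G.adj_comm b a]
  have hm := h.mem
  have hsum := h.adjCount_add_adjCount hG
  have hP := h.adjCount_self_le hG subset_rfl ⟨a, hm.1⟩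
  have hQ := h.symm.adjCount_self_le hG subset_rfl ⟨a, hm.2.1⟩
  -- The two slacks are at least 4 and add up to 10. Parity excludes `5 + 5`, so they are 4 and 6 in
  -- some order.
  obtain ⟨k, hk⟩ := even_adjCount_self (G := G) P
  obtain hP' | hP' : adjCount G P P = 4 * #P - 4 ∨ adjCount G P P = 4 * #P - 6 := by omega
  · exact h.generated_of_not_adj hG hab hP' (by omega) ih
  · exact h.symm.generated_of_not_adj hG hab (by omega) hP' ih

theorem Circ.generated {V : Type u} [Fintype V] {G : SimpleGraph V} (hG : Circ G) :
    Generated G := by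
  classical
  suffices ∀ n, GeneratedBelow.{u} n from this _ V G (Nat.lt_succ_self _) hG
  intro n
  induction n with
  | zero => exact fun W _ H hW => absurd hW (by omega)
  | succ n ih =>
    intro W _ H hW hH
    classical
    have ih' : GeneratedBelow.{u} (Fintype.card W) := fun W' _ H' hlt => ih W' H' (by omega)
    obtain h | ⟨v, a, b, c, h⟩ | ⟨P, Q, a, b, h⟩ | ⟨A, hA, hA', h2, h2'⟩ := hH.exists_reduction
    · exact .base h
    · exact generated_of_admissible hH h ih'
    · exact generated_of_isSep hH h ih'
    · obtain ⟨P, Q, a, b, h⟩ | ⟨a₁, b₁, c₁, a₂, b₂, c₂, h⟩ :=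
        hH.exists_isSep_or_isThreeCut hA hA' h2 h2'
      · exact generated_of_isSep hH h ih'
      · exact generated_of_isThreeCut hH hA hA' h2 h2' h ih'

end Sums

end SimpleTwoTwo


theorem theorem2 {V : Type*} [Finite V] (G : SimpleGraph V) :
    SimpleTwoTwo.IsCircuit G ↔ G.Connected ∧ SimpleTwoTwo.Generated G := by
  have := Fintype.ofFinite V
  constructor
  · intro h
    have hG := SimpleTwoTwo.isCircuit_iff_circ.1 h
    exact ⟨hG.connected, hG.generated⟩
  · exact fun h => h.2.isCircuit h.1
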